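/- **Theorem B.** Let $M$ be a smooth manifold (Hausdorff, second countable). Let $J^1(TM)$ be the first jet bundle of $TM$, with anchor $\#\colon J^1(TM)\to TM$ the natural projection. Every smooth section of $J^1(TM)$ is uniquely of the form $J^1V+\phi$, with $V$ a vector field, $J^1V$ its first prolongation and $\phi$ a section of $T^*M\otimes TM=\mathrm{Hom}(TM,TM)\subset J^1(TM)$ (where $df\otimes V=J^1(fV)-fJ^1V$). Regard $J^1(TM)$ as a Lie algebroid with the bracket $$[J^1V_1+\phi_1,J^1V_2+\phi_2]=J^1[V_1,V_2]+(\phi_2\circ\phi_1-\phi_1\circ\phi_2)+\kappa_{V_1}\phi_2-\kappa_{V_2}\phi_1,\qquad (\kappa_V\phi)W=[V,\phi W]+\phi[W,V],$$ and let $\mathrm{ad}$ be its adjoint representation on $TM$, $\mathrm{ad}_{J^1V+\phi}W=[V,W]-\phi W$. Let $\mathfrak g\subset J^1(TM)$ be a transitive infinitesimal $G$-structure, i.e. a Lie subalgebroid (a smooth vector subbundle whose sections are closed under the bracket) with surjective anchor, and let $\mathfrak h=\ker(\#|_{\mathfrak g})\subset T^*M\otimes TM$. Let $\nabla$ be a Cartan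 connection on $\mathfrak g$, i.e. an affine connection on the vector bundle $\mathfrak g$ such that $$\nabla_V[X,Y]=[\nabla_VX,Y]+[X,\nabla_VY]+\nabla_{\bar\nabla_YV}X-\nabla_{\bar\nabla_XV}Y,\qquad \bar\nabla_XV:=\#\nabla_VX+[\#X,V],$$ for all sections $X,Y$ of $\mathfrak g$ and vector fields $V$. Suppose that $\bar\nabla_XV=\mathrm{ad}_XV$ for all such $X,V$, and that $\nabla$ is reductive with splitting $t$: that is, $t\colon TM\to\mathfrak g$ is a smooth vector bundle morphism with $\#\circ t=\mathrm{id}$ and $$\bar\nabla_X(tV)=t(\bar\nabla_XV),\qquad\text{where } \bar\nabla_XY:=\nabla_{\#Y}X+[X,Y]\text{ for sections } X,Y\text{ of }\mathfrak g.$$ Let $\nabla^{\mathrm{L\text{-}C}}$ be the affine connection on $TM$ given by $\nabla^{\mathrm{L\text{-}C}}_VW=\mathrm{ad}_{tV}W$. Then $(\mathfrak g,\nabla)$ is locally symmetric if and only if the torsion and the curvature of $\nabla^{\mathrm{L\text{-}C}}$ are both $\mathfrak h$-invariant and $\nabla^{\mathrm{L\text{-}C}}$-parallel. Here $(\mathfrak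 g,\nabla)$ is *locally symmetric* if every point of $M$ has an open neighbourhood $U$ such that $(\mathfrak g,\nabla)|_U$ is isomorphic, by a vector bundle isomorphism preserving anchors, brackets and connections, to an action algebroid $\mathfrak g_0\times U$ with its canonical flat connection $D$: $\mathfrak g_0$ is a finite-dimensional real Lie algebra acting on $U$ by a Lie algebra homomorphism $\mathfrak g_0\to\Gamma(TU)$, which defines the anchor $\#$, and $[X,Y]=D_{\#X}Y-D_{\#Y}X+[X(\cdot),Y(\cdot)]_{\mathfrak g_0}$. A tensor on $M$ is *$\mathfrak h$-invariant* if it is annihilated by every section of $\mathfrak h\subset\mathrm{Hom}(TM,TM)$ acting as a derivation of the tensor algebra: $\phi(T(V,W))=T(\phi V,W)+T(V,\phi W)$ for the torsion, and similarly for the curvature. -/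

import Mathlib

open scoped Manifold ContDiff Bundle Topology

noncomputable section

namespace InfGStr

variable {E : Type*} [NormedAddCommGroup E] [NormedSpace ℝ E]
  {M : Type*} [TopologicalSpace M] [ChartedSpace E M]

/-! ### Vector fields and endomorphism fields

Sections over an open set `U ⊆ M` are represented by functions on all of `M` whose values outside
`U` are irrelevant; every condition is imposed on `U` only. -/

variable (E M) in
/-- (Set-theoretic) vector fields. -/
abbrev VField := (x : M) → TangentSpace 𝓘(ℝ, E) x

variable (E M) in
/-- (Set-theoretic) sections of `T*M ⊗ TM = Hom(TM, TM)`. -/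
abbrev EndField := (x : M) → (TangentSpace 𝓘(ℝ, E) x →L[ℝ] TangentSpace 𝓘(ℝ, E) x)

variable (E) in
/-- `f` is a smooth function on `U`. -/
def FunSmoothOn (f : M → ℝ) (U : Set M) : Prop := ContMDiffOn 𝓘(ℝ, E) 𝓘(ℝ, ℝ) ∞ f U

variable (E) in
/-- The differential of a real function, as an element of `T*_x M`. -/
def dFun (f : M → ℝ) (x : M) : TangentSpace 𝓘(ℝ, E) x →L[ℝ] ℝ :=
  mfderiv 𝓘(ℝ, E) 𝓘(ℝ, ℝ) f x

/-- The Jacobi-Lie bracket of vector fields. -/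
def lie (V W : VField E M) : VField E M := VectorField.mlieBracket 𝓘(ℝ, E) V W

/-- Pointwise application of an endomorphism field to a vector field. -/
def EndField.app (φ : EndField E M) (V : VField E M) : VField E M := fun x => φ x (V x)

variable (E) in
/-- The fibre at `x` of the first jet bundle `J¹(TM)`. Mathlib represents `T_x M` by means of the
preferred chart at `x`; in the same way the one-jet at `x` of a vector field `V` is represented here
by the value `V x` together with the derivative at `x` of `V` read in the preferred chart at `x`
(see `prolong`). -/
abbrev Jet (x : M) :=
  TangentSpace 𝓘(ℝ, E) x × (TangentSpace 𝓘(ℝ, E) x →L[ℝ] TangentSpace 𝓘(ℝ, E) x)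

variable (E M) in
/-- (Set-theoretic) sections of `J¹(TM)`. -/
abbrev JSec := (x : M) → Jet E x

/-- The anchor `# : J¹(TM) → TM` (the natural projection), on sections. -/
def anchor (σ : JSec E M) : VField E M := fun x => (σ x).1

/-- The inclusion `T*M ⊗ TM → J¹(TM)`; it sends `df ⊗ V` to `J¹(f V) - f J¹ V`. -/
def incl (φ : EndField E M) : JSec E M := fun x => (0, φ x)

variable [IsManifold 𝓘(ℝ, E) ∞ M]

/-- `V` is a smooth vector field on `U`. -/
def VField.SmoothOn (V : VField E M) (U : Set M) : Prop :=
  ContMDiffOn 𝓘(ℝ, E) (𝓘(ℝ, E).prod 𝓘(ℝ, E)) ∞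
    (fun x => (⟨x, V x⟩ : TangentBundle 𝓘(ℝ, E) M)) U

/-- `φ` is a smooth section of `Hom(TM, TM)` on `U`. -/
def EndField.SmoothOn (φ : EndField E M) (U : Set M) : Prop :=
  ContMDiffOn 𝓘(ℝ, E) (𝓘(ℝ, E).prod 𝓘(ℝ, E →L[ℝ] E)) ∞
    (fun x => (⟨x, φ x⟩ : Bundle.TotalSpace (E →L[ℝ] E)
      (fun x : M => TangentSpace 𝓘(ℝ, E) x →L[ℝ] TangentSpace 𝓘(ℝ, E) x))) U

/-- The derivative at `x` of a vector field read in the preferred chart at `x`. -/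
def chartDeriv (V : VField E M) (x : M) :
    TangentSpace 𝓘(ℝ, E) x →L[ℝ] TangentSpace 𝓘(ℝ, E) x :=
  mfderiv 𝓘(ℝ, E) 𝓘(ℝ, E)
    (fun y => (trivializationAt E (TangentSpace 𝓘(ℝ, E) : M → Type _) x ⟨y, V y⟩).2) x

/-- The first prolongation `J¹ V`. -/
def prolong (V : VField E M) : JSec E M := fun x => (V x, chartDeriv V x)

/-- The `T*M ⊗ TM` component of a section of `J¹(TM)`, so that `σ = J¹(#σ) + vert σ`. -/
def vert (σ : JSec E M) : EndField E M := fun x => (σ x).2 - chartDeriv (anchor σ) x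

theorem prolong_add_incl_vert (σ : JSec E M) : prolong (anchor σ) + incl (vert σ) = σ := by
  funext x
  simp [prolong, incl, vert, anchor]

/-- Compatibility of the fibrewise linear structure of `J¹(TM)` with prolongation:
`J¹(f V) = f J¹ V + df ⊗ V`. -/
theorem prolong_smul (f : M → ℝ) (V : VField E M) (x : M)
    (hf : MDifferentiableAt 𝓘(ℝ, E) 𝓘(ℝ, ℝ) f x)
    (hV : MDifferentiableAt 𝓘(ℝ, E) (𝓘(ℝ, E).prod 𝓘(ℝ, E))
      (fun x => (⟨x, V x⟩ : TangentBundle 𝓘(ℝ, E) M)) x) :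
    prolong (fun y => f y • V y) x =
      f x • prolong V x + incl (fun y => (dFun E f y).smulRight (V y)) x := by
  suffices h : chartDeriv (fun y => f y • V y) x =
      f x • chartDeriv V x + (dFun E f x).smulRight (V x) by
    simp [prolong, incl, h]
  let e := trivializationAt E (TangentSpace 𝓘(ℝ, E) : M → Type _) x
  have h1 : MDifferentiableAt 𝓘(ℝ, E) 𝓘(ℝ, E) (fun y => (e ⟨y, V y⟩).2) x := by
    rw [mdifferentiableAt_section] at hV
    exact hV
  have key : (fun y => (e ⟨y, f y • V y⟩).2) =ᶠ[𝓝 x] (fun y => f y • (e ⟨y, V y⟩).2) := by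
    filter_upwards [e.open_baseSet.mem_nhds (FiberBundle.mem_baseSet_trivializationAt' x)] with y hy
    exact (e.linear ℝ hy).2 (f y) (V y)
  have h0 : (e ⟨x, V x⟩).2 = V x :=
    (tangentBundleCore 𝓘(ℝ, E) M).coordChange_self (achart E x) x (mem_chart_source E x) (V x)
  have h2 : HasMFDerivAt 𝓘(ℝ, E) 𝓘(ℝ, E) (fun y => f y • (e ⟨y, V y⟩).2) x
      (f x • chartDeriv V x + (dFun E f x).smulRight (V x)) := by
    refine ⟨hf.continuousAt.smul h1.continuousAt, ?_⟩
    have h5 := HasFDerivWithinAt.smul hf.hasMFDerivAt.2 h1.hasMFDerivAt.2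
    have e1 : (writtenInExtChartAt 𝓘(ℝ, E) 𝓘(ℝ, E) x (fun y => (e ⟨y, V y⟩).2))
        (extChartAt 𝓘(ℝ, E) x x) = V x :=
      Eq.trans (congrArg (fun z => (e ⟨z, V z⟩).2) (extChartAt_to_inv (I := 𝓘(ℝ, E)) x)) h0
    have e2 : (writtenInExtChartAt 𝓘(ℝ, E) 𝓘(ℝ, ℝ) x f) (extChartAt 𝓘(ℝ, E) x x) = f x :=
      congrArg f (extChartAt_to_inv (I := 𝓘(ℝ, E)) x)
    rw [e1, e2] at h5
    exact h5
  exact (h2.congr_of_eventuallyEq key).mfderiv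

/-- `σ` is a smooth section of `J¹(TM)` on `U`: it is the sum of the prolongation of a smooth vector
field and a smooth section of `T*M ⊗ TM`. -/
def JSec.SmoothOn (σ : JSec E M) (U : Set M) : Prop :=
  VField.SmoothOn (anchor σ) U ∧ EndField.SmoothOn (vert σ) U

/-! ### The Lie algebroid structure of `J¹(TM)` -/

/-- The bracket of the Lie algebra bundle `T*M ⊗ TM ⊆ J¹(TM)`. -/
def endBracket (φ₁ φ₂ : EndField E M) : EndField E M :=
  fun x => (φ₂ x).comp (φ₁ x) - (φ₁ x).comp (φ₂ x)

/-- The operator `V ↦ [X, φ V] + φ [V, X]`. -/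
def kappaOp (X : VField E M) (φ : EndField E M) (V : VField E M) : VField E M :=
  lie X (φ.app V) + φ.app (lie V X)

variable [FiniteDimensional ℝ E]

/-- `κ_X φ` is not a junk value: the operator defining it is tensorial at every point at which `φ` is
differentiable. -/
theorem kappaOp_tensorialAt (X : VField E M) (φ : EndField E M) (x : M)
    (hφ : MDifferentiableAt 𝓘(ℝ, E) (𝓘(ℝ, E).prod 𝓘(ℝ, E →L[ℝ] E))
      (fun x => (⟨x, φ x⟩ : Bundle.TotalSpace (E →L[ℝ] E)
        (fun x : M => TangentSpace 𝓘(ℝ, E) x →L[ℝ] TangentSpace 𝓘(ℝ, E) x))) x) :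
    TensorialAt 𝓘(ℝ, E) E (fun V : VField E M => kappaOp X φ V x) x := by
  have hap : ∀ V : VField E M, MDifferentiableAt 𝓘(ℝ, E) (𝓘(ℝ, E).prod 𝓘(ℝ, E))
      (fun x => (⟨x, V x⟩ : TangentBundle 𝓘(ℝ, E) M)) x →
      MDifferentiableAt 𝓘(ℝ, E) (𝓘(ℝ, E).prod 𝓘(ℝ, E))
      (fun x => (⟨x, φ.app V x⟩ : TangentBundle 𝓘(ℝ, E) M)) x :=
    fun V hV => hφ.clm_bundle_apply (b := id) hV
  have : CompleteSpace E := FiniteDimensional.complete ℝ E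
  constructor
  · intro f V hf hV
    have e : φ.app (f • V) = f • φ.app V := by funext y; simp [EndField.app]
    simp only [kappaOp, Pi.add_apply, e, lie]
    rw [VectorField.mlieBracket_smul_right hf (hap V hV)]
    show _ + φ x _ = f x • (_ + φ x _)
    rw [VectorField.mlieBracket_smul_left hf hV, (φ x).map_add, (φ x).map_smul, (φ x).map_smul]
    simp only [EndField.app]
    module
  · intro V W hV hW
    have e : φ.app (V + W) = φ.app V + φ.app W := by funext y; simp [EndField.app]
    simp only [kappaOp, Pi.add_apply, e, lie]
    rw [VectorField.mlieBracket_add_right (hap V hV) (hap W hW)]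
    show _ + φ x _ = (_ + φ x _) + (_ + φ x _)
    rw [VectorField.mlieBracket_add_left hV hW, (φ x).map_add]
    abel

open Classical in
/-- The section `κ_X φ` of `Hom(TM, TM)` determined by `(κ_X φ) V = [X, φ V] + φ [V, X]`. The
condition (the right-hand side is tensorial in `V`) holds wherever `φ` is differentiable. -/
def kappa (X : VField E M) (φ : EndField E M) : EndField E M := fun x =>
  if h : TensorialAt 𝓘(ℝ, E) E (fun V : VField E M => kappaOp X φ V x) x then
    TensorialAt.mkHom (fun V : VField E M => kappaOp X φ V x) x h
  else 0

/-- The Lie algebroid bracket of `J¹(TM)`: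
`[J¹X₁ + φ₁, J¹X₂ + φ₂] = J¹[X₁, X₂] + [φ₁, φ₂] + κ_{X₁} φ₂ - κ_{X₂} φ₁`. -/
def bracket (σ τ : JSec E M) : JSec E M :=
  prolong (lie (anchor σ) (anchor τ)) +
    incl (endBracket (vert σ) (vert τ) + kappa (anchor σ) (vert τ) - kappa (anchor τ) (vert σ))

/-- The adjoint representation of `J¹(TM)` on `TM`: `ad_{J¹V} W = [V, W]` and `ad_φ W = - φ W`. -/
def ad (σ : JSec E M) (W : VField E M) : VField E M :=
  lie (anchor σ) W - (vert σ).app W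

/-! ### Infinitesimal `G`-structures -/

variable (E M) in
/-- An infinitesimal `G`-structure: a Lie subalgebroid of `J¹(TM)`, i.e. a smooth vector subbundle
whose sections are closed under the bracket. -/
structure InfinitesimalGStructure where
  /-- The fibres. -/
  fiber : (x : M) → Submodule ℝ (Jet E x)
  exists_frame : ∀ x : M, ∃ U : Set M, IsOpen U ∧ x ∈ U ∧ ∃ (r : ℕ) (s : Fin r → JSec E M),
    (∀ i, (s i).SmoothOn U) ∧ ∀ y ∈ U, LinearIndependent ℝ (fun i => s i y) ∧
      Submodule.span ℝ (Set.range fun i => s i y) = fiber y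
  bracket_mem : ∀ (U : Set M) (σ τ : JSec E M), IsOpen U → σ.SmoothOn U → τ.SmoothOn U →
    (∀ x ∈ U, σ x ∈ fiber x) → (∀ x ∈ U, τ x ∈ fiber x) → ∀ x ∈ U, bracket σ τ x ∈ fiber x

namespace InfinitesimalGStructure

variable (𝔤 : InfinitesimalGStructure E M)

/-- `σ` is a smooth section of `𝔤` over `U`. -/
def IsSection (U : Set M) (σ : JSec E M) : Prop :=
  σ.SmoothOn U ∧ ∀ x ∈ U, σ x ∈ 𝔤.fiber x

/-- `𝔤` is transitive: its anchor is surjective. -/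
def IsTransitive : Prop :=
  ∀ (x : M) (v : TangentSpace 𝓘(ℝ, E) x), ∃ j ∈ 𝔤.fiber x, j.1 = v

/-- The fibre at `x` of the kernel `𝔥 ⊆ T*M ⊗ TM` of the anchor of `𝔤`. -/
def kernel (x : M) : Submodule ℝ (TangentSpace 𝓘(ℝ, E) x →L[ℝ] TangentSpace 𝓘(ℝ, E) x) :=
  (𝔤.fiber x).comap (LinearMap.inr ℝ (TangentSpace 𝓘(ℝ, E) x)
    (TangentSpace 𝓘(ℝ, E) x →L[ℝ] TangentSpace 𝓘(ℝ, E) x))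

/-- An affine connection on the vector bundle `𝔤`: `toFun σ x (V x)` is `∇_V σ` at `x`. -/
structure Connection where
  /-- The operator `σ ↦ (V ↦ ∇_V σ)`. -/
  toFun : JSec E M → (x : M) → (TangentSpace 𝓘(ℝ, E) x →L[ℝ] Jet E x)
  isSection : ∀ (U : Set M) (σ : JSec E M) (V : VField E M), IsOpen U → 𝔤.IsSection U σ →
    V.SmoothOn U → 𝔤.IsSection U (fun x => toFun σ x (V x))
  add : ∀ (U : Set M) (σ τ : JSec E M), IsOpen U → 𝔤.IsSection U σ → 𝔤.IsSection U τ →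
    ∀ x ∈ U, toFun (σ + τ) x = toFun σ x + toFun τ x
  leibniz : ∀ (U : Set M) (f : M → ℝ) (σ : JSec E M), IsOpen U → FunSmoothOn E f U →
    𝔤.IsSection U σ →
    ∀ x ∈ U, toFun (fun y => f y • σ y) x = f x • toFun σ x + (dFun E f x).smulRight (σ x)

/-- A (smooth) splitting `t : TM → 𝔤` of `0 → 𝔥 → 𝔤 → TM → 0`. -/
structure Splitting where
  /-- The fibre maps. -/
  toFun : (x : M) → (TangentSpace 𝓘(ℝ, E) x →L[ℝ] Jet E x)
  isSection : ∀ (U : Set M) (V : VField E M), IsOpen U → V.SmoothOn U →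
    𝔤.IsSection U (fun x => toFun x (V x))
  anchor_eq : ∀ (x : M) (v : TangentSpace 𝓘(ℝ, E) x), (toFun x v).1 = v

variable {𝔤}

/-- `t V`, for a vector field `V`. -/
def Splitting.app (t : 𝔤.Splitting) (V : VField E M) : JSec E M := fun x => t.toFun x (V x)

namespace Connection

variable (nabla : 𝔤.Connection)

/-- `∇_V σ`. -/
def cov (V : VField E M) (σ : JSec E M) : JSec E M := fun x => nabla.toFun σ x (V x)

/-- The `𝔤`-connection on `TM` given by `X, V ↦ #∇_V X + [#X, V]`. -/
def barTM (X : JSec E M) (V : VField E M) : VField E M :=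
  anchor (nabla.cov V X) + lie (anchor X) V

/-- The `𝔤`-connection on `𝔤` given by `X, Y ↦ ∇_{#Y} X + [X, Y]`. -/
def barSelf (X Y : JSec E M) : JSec E M := nabla.cov (anchor Y) X + bracket X Y

/-- `∇` is a Cartan connection: it is compatible with the bracket of `𝔤`. -/
def IsCartan : Prop :=
  ∀ (U : Set M) (X Y : JSec E M) (V : VField E M), IsOpen U → 𝔤.IsSection U X → 𝔤.IsSection U Y →
    V.SmoothOn U → ∀ x ∈ U,
      nabla.cov V (bracket X Y) x =
        bracket (nabla.cov V X) Y x + bracket X (nabla.cov V Y) x +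
          nabla.cov (nabla.barTM Y V) X x - nabla.cov (nabla.barTM X V) Y x

/-- The representation of `𝔤` on `TM` determined by `∇` is the restricted adjoint one. -/
def BarEqAd : Prop :=
  ∀ (U : Set M) (X : JSec E M) (V : VField E M), IsOpen U → 𝔤.IsSection U X → V.SmoothOn U →
    ∀ x ∈ U, nabla.barTM X V x = ad X V x

/-- The splitting `t` is equivariant with respect to the representations of `𝔤` on `TM` and on `𝔤`
determined by `∇`. A Cartan connection is reductive if there is such a splitting. -/
def IsReductiveWith (t : 𝔤.Splitting) : Prop :=
  ∀ (U : Set M) (X : JSec E M) (V : VField E M), IsOpen U → 𝔤.IsSection U X → V.SmoothOn U →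
    ∀ x ∈ U, nabla.barSelf X (t.app V) x = t.app (nabla.barTM X V) x

end Connection

/-- The affine connection `∇^{L-C} = ad ∘ t` on `TM`: `∇^{L-C}_V W = ad_{tV} W`. -/
def Splitting.leviCivita (t : 𝔤.Splitting) (V W : VField E M) : VField E M := ad (t.app V) W

end InfinitesimalGStructure

/-! ### Torsion, curvature, parallelism and invariance of tensors on `TM` -/

/-- The torsion of an affine connection on `TM`. -/
def torsion (D : VField E M → VField E M → VField E M) (V W : VField E M) : VField E M :=
  D V W - D W V - lie V W

/-- The curvature of an affine connection on `TM`. -/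
def curvature (D : VField E M → VField E M → VField E M) (V W Y : VField E M) : VField E M :=
  D V (D W Y) - D W (D V Y) - D (lie V W) Y

/-- The `TM`-valued tensor `T` with two arguments is `D`-parallel. -/
def IsParallel₂ (D : VField E M → VField E M → VField E M)
    (T : VField E M → VField E M → VField E M) : Prop :=
  ∀ (U : Set M) (Z V W : VField E M), IsOpen U → Z.SmoothOn U → V.SmoothOn U → W.SmoothOn U →
    ∀ x ∈ U, (D Z (T V W) - T (D Z V) W - T V (D Z W)) x = 0

/-- The `TM`-valued tensor `T` with three arguments is `D`-parallel. -/
def IsParallel₃ (D : VField E M → VField E M → VField E M)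
    (T : VField E M → VField E M → VField E M → VField E M) : Prop :=
  ∀ (U : Set M) (Z V W Y : VField E M), IsOpen U → Z.SmoothOn U → V.SmoothOn U → W.SmoothOn U →
    Y.SmoothOn U →
    ∀ x ∈ U, (D Z (T V W Y) - T (D Z V) W Y - T V (D Z W) Y - T V W (D Z Y)) x = 0

namespace InfinitesimalGStructure

variable (𝔤 : InfinitesimalGStructure E M)

/-- `φ` is a smooth section over `U` of the kernel `𝔥` of the anchor of `𝔤`. -/
def IsKernelSection (U : Set M) (φ : EndField E M) : Prop :=
  φ.SmoothOn U ∧ ∀ x ∈ U, φ x ∈ 𝔤.kernel x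

/-- The `TM`-valued tensor `T` with two arguments is `𝔥`-invariant. -/
def IsKernelInvariant₂ (T : VField E M → VField E M → VField E M) : Prop :=
  ∀ (U : Set M) (φ : EndField E M) (V W : VField E M), IsOpen U → 𝔤.IsKernelSection U φ →
    V.SmoothOn U → W.SmoothOn U →
    ∀ x ∈ U, (φ.app (T V W) - T (φ.app V) W - T V (φ.app W)) x = 0

/-- The `TM`-valued tensor `T` with three arguments is `𝔥`-invariant. -/
def IsKernelInvariant₃ (T : VField E M → VField E M → VField E M → VField E M) : Prop :=
  ∀ (U : Set M) (φ : EndField E M) (V W Y : VField E M), IsOpen U → 𝔤.IsKernelSection U φ →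
    V.SmoothOn U → W.SmoothOn U → Y.SmoothOn U →
    ∀ x ∈ U, (φ.app (T V W Y) - T (φ.app V) W Y - T V (φ.app W) Y - T V W (φ.app Y)) x = 0

end InfinitesimalGStructure

/-! ### Action Lie algebroids and local symmetry -/

section Action

variable {L : Type*} [AddCommGroup L] [Module ℝ L]

variable (E) in
/-- A section `X : M → L` of the trivial bundle with finite-dimensional fibre `L` is smooth on `U`. -/
def TrivSmoothOn (X : M → L) (U : Set M) : Prop :=
  ∀ ℓ : L →ₗ[ℝ] ℝ, FunSmoothOn E (fun y => ℓ (X y)) U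

variable [FiniteDimensional ℝ L]

/-- The canonical flat connection `∇_V X` on the trivial bundle with finite-dimensional fibre `L`,
i.e. the componentwise derivative of `X` along `V`. -/
def flatCov (V : VField E M) (X : M → L) : M → L := fun x =>
  ∑ i, dFun E (fun y => (Module.finBasis ℝ L).repr (X y) i) x (V x) • Module.finBasis ℝ L i

end Action

section Symmetric

variable (𝔤₀ : Type*) [LieRing 𝔤₀] [LieAlgebra ℝ 𝔤₀] [FiniteDimensional ℝ 𝔤₀]

variable (E M) in
/-- A smooth infinitesimal action of the Lie algebra `𝔤₀` on the open set `U`: a Lie algebra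
homomorphism from `𝔤₀` to the smooth vector fields on `U`. -/
structure LieAction (U : Set M) where
  /-- The vector field attached to an element of `𝔤₀`. -/
  toFun : (x : M) → (𝔤₀ →ₗ[ℝ] TangentSpace 𝓘(ℝ, E) x)
  smooth : ∀ ξ : 𝔤₀, VField.SmoothOn (fun x => toFun x ξ) U
  map_lie : ∀ ξ η : 𝔤₀, ∀ x ∈ U,
    toFun x ⁅ξ, η⁆ = lie (fun y => toFun y ξ) (fun y => toFun y η) x

variable {𝔤₀} {U : Set M}

/-- The anchor of the action algebroid `𝔤₀ × U`, on sections. -/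
def LieAction.anchor (a : LieAction E M 𝔤₀ U) (X : M → 𝔤₀) : VField E M := fun x => a.toFun x (X x)

/-- The bracket of the action algebroid: `[X, Y] = ∇_{#X} Y - ∇_{#Y} X + τ(X, Y)`, where `∇` is the
canonical flat connection and `τ` the pointwise bracket. -/
def LieAction.bracket (a : LieAction E M 𝔤₀ U) (X Y : M → 𝔤₀) : M → 𝔤₀ :=
  flatCov (a.anchor X) Y - flatCov (a.anchor Y) X + fun x => ⁅X x, Y x⁆

variable {𝔤 : InfinitesimalGStructure E M}

/-- An isomorphism of Cartan algebroids from the action algebroid `𝔤₀ × U`, with its canonical flat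
connection, onto the restriction of `(𝔤, ∇)` to `U`. -/
structure ActionIso (a : LieAction E M 𝔤₀ U) (nabla : 𝔤.Connection) where
  /-- The fibre maps. -/
  toFun : (x : M) → (𝔤₀ →ₗ[ℝ] Jet E x)
  injective : ∀ x ∈ U, Function.Injective (toFun x)
  range_eq : ∀ x ∈ U, LinearMap.range (toFun x) = 𝔤.fiber x
  smooth : ∀ X : M → 𝔤₀, TrivSmoothOn E X U → JSec.SmoothOn (fun x => toFun x (X x)) U
  anchor_eq : ∀ x ∈ U, ∀ ξ : 𝔤₀, (toFun x ξ).1 = a.toFun x ξ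
  map_bracket : ∀ X Y : M → 𝔤₀, TrivSmoothOn E X U → TrivSmoothOn E Y U → ∀ x ∈ U,
    toFun x (a.bracket X Y x) =
      InfGStr.bracket (fun y => toFun y (X y)) (fun y => toFun y (Y y)) x
  map_cov : ∀ (V : VField E M) (X : M → 𝔤₀), V.SmoothOn U → TrivSmoothOn E X U → ∀ x ∈ U,
    toFun x (flatCov V X x) = nabla.cov V (fun y => toFun y (X y)) x

end Symmetric

namespace InfinitesimalGStructure.Connection

variable {𝔤 : InfinitesimalGStructure E M} (nabla : 𝔤.Connection)

/-- The restriction of `(𝔤, ∇)` to the open set `U` is symmetric: it is isomorphic to an action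
algebroid `𝔤₀ × U` with its canonical flat connection. -/
def IsSymmetricOn (U : Set M) : Prop :=
  ∃ (𝔤₀ : Type) (_ : LieRing 𝔤₀) (_ : LieAlgebra ℝ 𝔤₀) (_ : FiniteDimensional ℝ 𝔤₀)
    (a : LieAction E M 𝔤₀ U), Nonempty (ActionIso a nabla)

/-- `(𝔤, ∇)` is locally symmetric. -/
def IsLocallySymmetric : Prop :=
  ∀ x : M, ∃ U : Set M, IsOpen U ∧ x ∈ U ∧ nabla.IsSymmetricOn U

end InfinitesimalGStructure.Connection

end InfGStr

end

open scoped Manifold ContDiff Bundle Topology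

set_option linter.unusedSectionVars false

noncomputable section

/-! Write D for ∇^{L-C}, with torsion T and curvature R. A section X of 𝔤 acts on vector fields by
ad_X, and on tensors by the Leibniz rule. The map ad is a representation (`ad_bracket`), the value
of ad_X W at a point depends on X only through its value there (`ad_eq_adAt`), and a one-jet is
determined by its action on vector fields (`jet_ext`). Identities in J¹(TM) are therefore proved by
letting both sides act.

Since ∇̄ is ad on TM, equivariance of t says ∇_V X = t(ad_X V) - [X, tV] (`cov_eq`). Applying ad
gives ad_{∇_V X} W = D_V(ad_X W) - ad_X(D_V W) + D_{ad_X V} W (`ad_cov`): up to sign, ∇X is the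
derivative of the connection D along X. Moreover X - t(#X) is a section φ of 𝔥, so ad_X = D_{#X} -
φ. Hence T and R are 𝔥-invariant and D-parallel exactly when ad_X T = 0 and ad_X R = 0 for every X
(`preservesTorsion_iff`, `preservesCurvature_iff`).

If (𝔤, ∇) is locally symmetric, the constant sections of the action algebroid give a parallel
section e through every element of 𝔤. For such e, ad_e is the Lie derivative along #e and it
preserves D, hence also T and R, which are built from D and the Lie bracket. As T and R are tensors,
ad_X T and ad_X R at x depend only on X(x), so they vanish for all X.

Conversely, using `ad_cov` twice, the curvature of ∇ evaluated on (V, W; X) acts on Z as D_{(ad_X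
T)(V,W)} Z - (ad_X R)(V,W)Z. Invariance thus makes ∇ flat (`flat_of_preserves`), and the Frobenius
theorem gives local parallel frames (`exists_parallel_of_flat`, `IsFlat.exists_parallel_frame`). The
Cartan identity makes brackets of parallel sections parallel, so the structure functions of such a
frame are constants; they define 𝔤₀, which acts through the anchor, and the frame identifies 𝔤 with
the action algebroid (`isSymmetricOn_of_parallel_frame`). -/

namespace InfGStr

/-! ### Frobenius theorem for flat linear connections on a ball. -/

section Frobenius

variable {E F : Type*} [NormedAddCommGroup E] [NormedSpace ℝ E] [NormedAddCommGroup F]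
  [NormedSpace ℝ F]

/-- The equation is solved along each ray from z₀. The solution on the ray to x + h is compared with
the first-order guess t ↦ u_x(t) - t A(z₀ + t x) h u_x(t). Flatness makes this guess satisfy the
equation of the new ray up to O(‖h‖²), and Grönwall turns the small defect into a small error at t =
1. -/
theorem hasFDerivAt_radial_solution {z₀ : E} {δ B : ℝ} (hB : 1 ≤ B) (hδ : δ ≤ 1)
    {A : E → E →L[ℝ] F →L[ℝ] F} {A' : E → E →ₗ[ℝ] E →L[ℝ] F →L[ℝ] F}
    (hA : ∀ z ∈ Metric.ball z₀ δ, ∀ k, HasFDerivAt (fun z => A z k) (A' z k) z)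
    (hAB : ∀ z ∈ Metric.ball z₀ δ, ∀ k v, ‖A z k v‖ ≤ B * ‖k‖ * ‖v‖)
    (hAB' : ∀ z ∈ Metric.ball z₀ δ, ∀ k h v, ‖A' z k h v‖ ≤ B * ‖k‖ * ‖h‖ * ‖v‖)
    (htaylor : ∀ z ∈ Metric.ball z₀ δ, ∀ w ∈ Metric.ball z₀ δ,
      ∀ k v, ‖(A w k - A z k - A' z k (w - z)) v‖ ≤ B * ‖w - z‖ ^ 2 * ‖k‖ * ‖v‖)
    (hflat : ∀ z ∈ Metric.ball z₀ δ, ∀ (h k : E) (y : F),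
      A' z k h y - A' z h k y + (A z h (A z k y) - A z k (A z h y)) = 0)
    {u : E → ℝ → F} {c : F} (hu0 : ∀ x, ‖x‖ < δ → u x 0 = c)
    (hu : ∀ x, ‖x‖ < δ → ∀ t ∈ Set.Icc (0 : ℝ) 1,
      HasDerivWithinAt (u x) (-A (z₀ + t • x) x (u x t)) (Set.Icc 0 1) t)
    {x : E} (hx : ‖x‖ < δ) :
    HasFDerivAt (fun x => u x 1) (-(A (z₀ + x)).flip (u x 1)) x := by
  have hball : ∀ {y : E} {t : ℝ}, ‖y‖ < δ → t ∈ Set.Icc (0 : ℝ) 1 →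
      z₀ + t • y ∈ Metric.ball z₀ δ := by
    intro y t hy ht
    rw [mem_ball_iff_norm, add_sub_cancel_left, norm_smul, Real.norm_of_nonneg ht.1]
    exact (mul_le_of_le_one_left (norm_nonneg y) ht.2).trans_lt hy
  have hcont : ∀ {y : E}, ‖y‖ < δ → ContinuousOn (u y) (Set.Icc 0 1) :=
    fun hy t ht => (hu _ hy t ht).continuousWithinAt
  obtain ⟨m, hm⟩ := (isCompact_Icc (a := (0 : ℝ)) (b := 1)).exists_bound_of_continuousOn (hcont hx)
  have hm0 : 0 ≤ m := (norm_nonneg _).trans (hm 0 ⟨le_rfl, zero_le_one⟩)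
  have hB0 : 0 ≤ B := zero_le_one.trans hB
  -- the approximate solution
  let g : E → ℝ → F := fun h t => u x t - t • A (z₀ + t • x) h (u x t)
  let g' : E → ℝ → F := fun h t => -A (z₀ + t • x) x (u x t) -
    (t • (A' (z₀ + t • x) h x (u x t) + A (z₀ + t • x) h (-A (z₀ + t • x) x (u x t))) +
      (1 : ℝ) • A (z₀ + t • x) h (u x t))
  have hg : ∀ h, ∀ t ∈ Set.Icc (0 : ℝ) 1, HasDerivWithinAt (g h) (g' h t) (Set.Icc 0 1) t := by
    intro h t ht
    have h1 : HasDerivWithinAt (fun t : ℝ => z₀ + t • x) x (Set.Icc 0 1) t := by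
      simpa using ((hasDerivAt_id t).smul_const x).hasDerivWithinAt.const_add z₀
    have h3 : HasDerivWithinAt (fun t : ℝ => A (z₀ + t • x) h) (A' (z₀ + t • x) h x)
        (Set.Icc 0 1) t := by
      have h2 := hA _ (hball hx ht) h
      exact HasFDerivAt.comp_hasDerivWithinAt (f := fun t : ℝ => z₀ + t • x) t h2 h1
    exact (hu x hx t ht).sub ((hasDerivAt_id t).hasDerivWithinAt.smul
      (h3.clm_apply (hu x hx t ht)))
  have hIci : ∀ {f : ℝ → F} {f' : F} {t : ℝ}, t ∈ Set.Ico (0 : ℝ) 1 →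
      HasDerivWithinAt f f' (Set.Icc 0 1) t → HasDerivWithinAt f f' (Set.Ici t) t :=
    fun ht h => h.mono_of_mem_nhdsWithin (Icc_mem_nhdsGE_of_mem ht)
  -- The defect of the guess in the equation of the ray to x + h. The four errors `n1` to `n4`
  -- contribute 1 + 1 + 2 + 2 times B² m ‖h‖²; the 8 leaves slack.
  have hest : ∀ h : E, ‖h‖ ≤ 1 → ‖x + h‖ < δ → ∀ t ∈ Set.Ico (0 : ℝ) 1,
      dist (g' h t) (-A (z₀ + t • (x + h)) (x + h) (g h t)) ≤ 8 * B ^ 2 * m * ‖h‖ ^ 2 := by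
    intro h hh hxh t ht
    have ht' := Set.Ico_subset_Icc_self ht
    set z := z₀ + t • x with hz
    set y := u x t with hy
    have hzw : z₀ + t • (x + h) = z + t • h := by rw [hz, smul_add, add_assoc]
    have hzb := hball hx ht'
    have hwb := hball hxh ht'
    rw [hzw] at hwb ⊢
    let R : E → F →L[ℝ] F := fun k => A (z + t • h) k - A z k - A' z k (t • h)
    have hRn : ∀ k v, ‖R k v‖ ≤ B * ‖h‖ ^ 2 * ‖k‖ * ‖v‖ := fun k v => by
      have := htaylor z hzb _ hwb k v
      rw [add_sub_cancel_left, norm_smul, Real.norm_of_nonneg ht'.1, mul_pow] at this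
      refine this.trans ?_
      gcongr
      exact mul_le_of_le_one_left (sq_nonneg _) (pow_le_one₀ ht'.1 ht'.2)
    have hAz : ∀ k v, A (z + t • h) k v = A z k v + t • A' z k h v + R k v := fun k v => by
      simp only [R, map_smul, _root_.sub_apply, _root_.smul_apply]
      abel
    have hyn : ‖y‖ ≤ m := hm t ht'
    have hAh : ∀ v : F, ‖A z h v‖ ≤ B * ‖h‖ * ‖v‖ := hAB z hzb h
    have hgn : ‖g h t‖ ≤ 2 * B * m := by
      have h1 : ‖t • A z h y‖ ≤ B * m := by
        rw [norm_smul, Real.norm_of_nonneg ht'.1]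
        refine (mul_le_of_le_one_left (norm_nonneg _) ht'.2).trans ((hAh y).trans ?_)
        calc B * ‖h‖ * ‖y‖ ≤ B * 1 * m := by gcongr
          _ = B * m := by ring
      calc ‖g h t‖ ≤ ‖y‖ + ‖t • A z h y‖ := norm_sub_le _ _
        _ ≤ 1 * m + B * m := by linarith
        _ ≤ B * m + B * m := by gcongr
        _ = 2 * B * m := by ring
    -- After Taylor expansion of A at z, the terms linear in h sum to t times the flatness identity
    -- for the directions h and x; only quadratic terms are left.
    have key : g' h t - -A (z + t • h) (x + h) (g h t) =
        -(t • A z h (A z h y)) - (t * t) • A' z x h (A z h y) +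
          (t • A' z h h (g h t) + R (x + h) (g h t)) := by
      have hf := hflat z hzb h x y
      have hf' := congrArg (fun v => t • v) hf
      simp only [smul_zero] at hf'
      rw [← sub_eq_zero]
      refine Eq.trans ?_ hf'
      simp only [hAz]
      simp only [g, g', ← hz, ← hy, map_add, map_sub, map_neg, map_smul, _root_.add_apply]
      module
    rw [dist_eq_norm, key]
    have hh2 : ‖h‖ ^ 2 = ‖h‖ * ‖h‖ := sq _
    have hx1 : ‖x‖ ≤ 1 := hx.le.trans hδ
    have n1 : ‖t • A z h (A z h y)‖ ≤ B ^ 2 * m * ‖h‖ ^ 2 := by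
      rw [norm_smul, Real.norm_of_nonneg ht'.1]
      refine (mul_le_of_le_one_left (norm_nonneg _) ht'.2).trans ((hAh _).trans ?_)
      calc B * ‖h‖ * ‖A z h y‖ ≤ B * ‖h‖ * (B * ‖h‖ * ‖y‖) := by gcongr; exact hAh y
        _ ≤ B * ‖h‖ * (B * ‖h‖ * m) := by gcongr
        _ = B ^ 2 * m * ‖h‖ ^ 2 := by ring
    have n2 : ‖(t * t) • A' z x h (A z h y)‖ ≤ B ^ 2 * m * ‖h‖ ^ 2 := by
      rw [norm_smul, Real.norm_of_nonneg (mul_nonneg ht'.1 ht'.1)]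
      refine (mul_le_of_le_one_left (norm_nonneg _)
        (mul_le_one₀ ht'.2 ht'.1 ht'.2)).trans ((hAB' z hzb _ _ _).trans ?_)
      calc B * ‖x‖ * ‖h‖ * ‖A z h y‖ ≤ B * 1 * ‖h‖ * (B * ‖h‖ * ‖y‖) := by
            gcongr; exact hAh y
        _ ≤ B * 1 * ‖h‖ * (B * ‖h‖ * m) := by gcongr
        _ = B ^ 2 * m * ‖h‖ ^ 2 := by ring
    have n3 : ‖t • A' z h h (g h t)‖ ≤ 2 * B ^ 2 * m * ‖h‖ ^ 2 := by
      rw [norm_smul, Real.norm_of_nonneg ht'.1]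
      refine (mul_le_of_le_one_left (norm_nonneg _) ht'.2).trans ((hAB' z hzb _ _ _).trans ?_)
      calc B * ‖h‖ * ‖h‖ * ‖g h t‖ ≤ B * ‖h‖ * ‖h‖ * (2 * B * m) := by gcongr
        _ = 2 * B ^ 2 * m * ‖h‖ ^ 2 := by ring
    have n4 : ‖R (x + h) (g h t)‖ ≤ 2 * B ^ 2 * m * ‖h‖ ^ 2 := by
      calc _ ≤ B * ‖h‖ ^ 2 * ‖x + h‖ * ‖g h t‖ := hRn _ _
        _ ≤ B * ‖h‖ ^ 2 * 1 * (2 * B * m) := by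
          gcongr
          exact hxh.le.trans hδ
        _ = _ := by ring
    calc _ ≤ ‖-(t • A z h (A z h y))‖ + ‖(t * t) • A' z x h (A z h y)‖ +
          (‖t • A' z h h (g h t)‖ + ‖R (x + h) (g h t)‖) :=
        (norm_add_le _ _).trans (add_le_add (norm_sub_le _ _) (norm_add_le _ _))
      _ ≤ B ^ 2 * m * ‖h‖ ^ 2 + B ^ 2 * m * ‖h‖ ^ 2 +
          (2 * B ^ 2 * m * ‖h‖ ^ 2 + 2 * B ^ 2 * m * ‖h‖ ^ 2) := by
        rw [norm_neg]
        exact add_le_add (add_le_add n1 n2) (add_le_add n3 n4)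
      _ ≤ 8 * B ^ 2 * m * ‖h‖ ^ 2 := by
        have : 0 ≤ B ^ 2 * m * ‖h‖ ^ 2 := by positivity
        linarith
  have hgron : ∀ h : E, ‖h‖ ≤ 1 → ‖x + h‖ < δ →
      ‖u (x + h) 1 - (u x 1 - A (z₀ + x) h (u x 1))‖ ≤
        (8 * B ^ 2 * m * (Real.exp B)) * ‖h‖ ^ 2 := by
    intro h hh hxh
    have hlip : ∀ t ∈ Set.Ico (0 : ℝ) 1,
        LipschitzOnWith B.toNNReal (fun v => -A (z₀ + t • (x + h)) (x + h) v) Set.univ := by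
      intro t ht
      refine LipschitzWith.lipschitzOnWith ?_
      refine LipschitzWith.of_dist_le_mul fun v w => ?_
      rw [dist_neg_neg, dist_eq_norm, dist_eq_norm, ← map_sub, ← norm_neg, ← map_neg, neg_sub]
      rw [Real.coe_toNNReal B hB0]
      calc _ ≤ B * ‖x + h‖ * ‖w - v‖ := hAB _ (hball hxh (Set.Ico_subset_Icc_self ht)) _ _
        _ ≤ B * 1 * ‖w - v‖ := by
          gcongr
          exact hxh.le.trans hδ
        _ = B * ‖v - w‖ := by rw [mul_one, norm_sub_rev]
    -- Both curves start at c, so Grönwall sees only the defect. Dividing by the Lipschitz constant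
    -- B is harmless because B ≥ 1.
    have h1 := dist_le_of_approx_trajectories_ODE_of_mem (a := 0) (b := 1)
      (f := u (x + h)) (g := g h) (g' := g' h) (δ := 0) (εf := 0)
      (f' := fun t => -A (z₀ + t • (x + h)) (x + h) (u (x + h) t)) hlip (hcont hxh)
      (fun t ht => hIci ht (hu _ hxh t (Set.Ico_subset_Icc_self ht)))
      (fun t _ => (dist_self _).le) (fun _ _ => trivial)
      (fun t ht => (hg h t ht).continuousWithinAt)
      (fun t ht => hIci ht (hg h t (Set.Ico_subset_Icc_self ht))) (hest h hh hxh)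
      (fun _ _ => trivial) (by simp [g, hu0 x hx, hu0 _ hxh]) 1 ⟨zero_le_one, le_rfl⟩
    rw [dist_eq_norm, zero_add, sub_zero, Real.coe_toNNReal B hB0,
      gronwallBound_of_K_ne_0 (by positivity)] at h1
    simp only [g, one_smul, zero_mul, zero_add, mul_one] at h1
    refine h1.trans ?_
    have e1 : 8 * B ^ 2 * m * ‖h‖ ^ 2 / B ≤ 8 * B ^ 2 * m * ‖h‖ ^ 2 :=
      div_le_self (by positivity) hB
    have e2 : Real.exp B - 1 ≤ Real.exp B := by linarith
    have e3 : 0 ≤ Real.exp B - 1 := by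
      have := Real.add_one_le_exp B
      linarith
    calc _ ≤ 8 * B ^ 2 * m * ‖h‖ ^ 2 * Real.exp B := by gcongr
      _ = _ := by ring
  have hbig : (fun h : E => u (x + h) 1 - u x 1 - (-(A (z₀ + x)).flip (u x 1)) h) =O[𝓝 0]
      fun h => ‖h‖ ^ 2 := by
    refine Asymptotics.IsBigO.of_bound (8 * B ^ 2 * m * (Real.exp B)) ?_
    have hnear : ∀ᶠ h : E in 𝓝 0, ‖x + h‖ < δ := by
      have : Continuous fun h : E => ‖x + h‖ := by fun_prop
      exact this.continuousAt.eventually_lt continuousAt_const (by simpa using hx)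
    filter_upwards [hnear, Metric.ball_mem_nhds (0 : E) one_pos] with h h1 h2
    rw [Real.norm_of_nonneg (sq_nonneg _)]
    refine le_trans (le_of_eq ?_) (hgron h (mem_ball_zero_iff.1 h2).le h1)
    congr 1
    simp only [_root_.neg_apply, ContinuousLinearMap.flip_apply]
    abel
  rw [hasFDerivAt_iff_isLittleO_nhds_zero]
  refine hbig.trans_isLittleO ?_
  exact (Asymptotics.isLittleO_norm_pow_id one_lt_two)

end Frobenius

section Frobenius

variable {E G H : Type*} [NormedAddCommGroup E] [NormedSpace ℝ E] [NormedAddCommGroup G]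
  [NormedSpace ℝ G] [NormedAddCommGroup H] [NormedSpace ℝ H]

/-- The derivative is C¹, hence Lipschitz near z₀, and the mean value inequality gives the quadratic
remainder. One constant B serves for the value, the derivative and the remainder. -/
theorem exists_taylor_bound {f : E → H} {z₀ : E} (hf : ContDiffAt ℝ ∞ f z₀) :
    ∃ δ > 0, ∃ B : ℝ, 1 ≤ B ∧ ∀ z ∈ Metric.ball z₀ δ, HasFDerivAt f (fderiv ℝ f z) z ∧
      ‖f z‖ ≤ B ∧ ‖fderiv ℝ f z‖ ≤ B ∧
      ∀ w ∈ Metric.ball z₀ δ, ‖f w - f z - fderiv ℝ f z (w - z)‖ ≤ B * ‖w - z‖ ^ 2 := by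
  have hf' : ContDiffAt ℝ 1 (fderiv ℝ f) z₀ := hf.fderiv_right (by norm_cast)
  obtain ⟨K, s, hs, hK⟩ := hf'.exists_lipschitzOnWith
  have hev : ∀ᶠ z in 𝓝 z₀, z ∈ s ∧ DifferentiableAt ℝ f z ∧ ‖f z‖ < ‖f z₀‖ + 1 ∧
      ‖fderiv ℝ f z‖ < ‖fderiv ℝ f z₀‖ + 1 := by
    refine Filter.Eventually.and hs (.and ?_ (.and ?_ ?_))
    · have h1 : ContDiffAt ℝ 1 f z₀ := hf.of_le (by norm_cast)
      filter_upwards [h1.eventually (by simp)] with z hz using hz.differentiableAt one_ne_zero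
    · exact hf.continuousAt.norm.eventually_lt continuousAt_const (lt_add_one _)
    · exact hf'.continuousAt.norm.eventually_lt continuousAt_const (lt_add_one _)
  obtain ⟨δ, hδ, hball⟩ := Metric.eventually_nhds_iff_ball.1 hev
  refine ⟨δ, hδ, K + (‖f z₀‖ + 1) + (‖fderiv ℝ f z₀‖ + 1), ?_, fun z hz => ?_⟩
  · have h1 : (0 : ℝ) ≤ K := K.2
    linarith [norm_nonneg (f z₀), norm_nonneg (fderiv ℝ f z₀)]
  have hK0 : (0 : ℝ) ≤ K := K.2
  have n1 := norm_nonneg (f z₀)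
  have n2 := norm_nonneg (fderiv ℝ f z₀)
  obtain ⟨hzs, hzd, hz1, hz2⟩ := hball z hz
  refine ⟨hzd.hasFDerivAt, by linarith, by linarith, fun w hw => ?_⟩
  -- Intersecting with the closed ball of radius ‖w - z‖ about z keeps the domain convex and bounds
  -- the variation of the derivative by K ‖w - z‖.
  have key := Convex.norm_image_sub_le_of_norm_hasFDerivWithin_le' (𝕜 := ℝ) (f := f)
    (f' := fderiv ℝ f) (φ := fderiv ℝ f z) (C := K * ‖w - z‖) (x := z) (y := w)
    (s := Metric.ball z₀ δ ∩ Metric.closedBall z ‖w - z‖)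
    (fun y hy => (hball y hy.1).2.1.hasFDerivAt.hasFDerivWithinAt)
    (fun y hy => (hK.norm_sub_le (hball y hy.1).1 hzs).trans
      (mul_le_mul_of_nonneg_left (mem_closedBall_iff_norm.1 hy.2) hK0))
    ((convex_ball _ _).inter (convex_closedBall _ _))
    ⟨hz, Metric.mem_closedBall_self (norm_nonneg _)⟩ ⟨hw, mem_closedBall_iff_norm.2 le_rfl⟩
  refine key.trans ?_
  rw [mul_assoc, ← sq]
  gcongr
  linarith

theorem exists_taylor_bound_apply {A : E → E →L[ℝ] G} {z₀ : E} (hA : ContDiffAt ℝ ∞ A z₀) :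
    ∃ δ > 0, ∃ B : ℝ, 1 ≤ B ∧ ∃ A' : E → E →ₗ[ℝ] E →L[ℝ] G, ∀ z ∈ Metric.ball z₀ δ,
      (∀ k, HasFDerivAt (fun z => A z k) (A' z k) z) ∧
      (∀ k, ‖A z k‖ ≤ B * ‖k‖) ∧ (∀ k h, ‖A' z k h‖ ≤ B * ‖k‖ * ‖h‖) ∧
      ∀ w ∈ Metric.ball z₀ δ, ∀ k, ‖A w k - A z k - A' z k (w - z)‖ ≤ B * ‖w - z‖ ^ 2 * ‖k‖ := by
  obtain ⟨δ, hδ, B, hB, h⟩ := exists_taylor_bound hA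
  refine ⟨δ, hδ, B, hB, fun z => (fderiv ℝ A z).flip.toLinearMap, fun z hz => ?_⟩
  obtain ⟨h1, h2, h3, h4⟩ := h z hz
  refine ⟨fun k => ?_, fun k => (A z).le_of_opNorm_le h2 k, fun k h => ?_, fun w hw k => ?_⟩
  · refine (h1.clm_apply (hasFDerivAt_const k z)).congr_fderiv ?_
    ext v
    simp
  · refine ((fderiv ℝ A z).le_of_opNorm₂_le_of_le h3 le_rfl le_rfl).trans (le_of_eq ?_)
    ring
  · exact ContinuousLinearMap.le_of_opNorm_le _ (h4 w hw) k

variable {F : Type*} [NormedAddCommGroup F] [NormedSpace ℝ F]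

/-- The bound 1/2 allows Picard–Lindelöf to cover the whole unit interval: in the ball of radius ‖c‖
about c one has ‖v‖ ≤ 2‖c‖, so the speed is at most ‖c‖ and the ball is not left before time 1. -/
theorem exists_radial_solution [CompleteSpace F] {A : ℝ → F →L[ℝ] F}
    (hA : ContinuousOn A (Set.Icc 0 1)) (hA' : ∀ t ∈ Set.Icc (0 : ℝ) 1, ‖A t‖ ≤ 1 / 2) (c : F) :
    ∃ u : ℝ → F, u 0 = c ∧
      ∀ t ∈ Set.Icc (0 : ℝ) 1, HasDerivWithinAt u (-A t (u t)) (Set.Icc 0 1) t := by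
  have hP : IsPicardLindelof (fun t v => -A t v) (tmin := 0) (tmax := 1) ⟨0, le_rfl, zero_le_one⟩ c
      ‖c‖₊ 0 ‖c‖₊ 1 := by
    refine ⟨fun t ht => ?_, fun v _ => ?_, fun t ht v hv => ?_, ?_⟩
    · refine (LipschitzWith.of_dist_le_mul fun v w => ?_).lipschitzOnWith
      rw [dist_neg_neg, dist_eq_norm, dist_eq_norm, ← map_sub]
      exact (A t).le_of_opNorm_le ((hA' t ht).trans (by norm_num)) _
    · exact (hA.clm_apply continuousOn_const).neg
    · rw [norm_neg, coe_nnnorm]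
      have h1 : ‖v‖ ≤ ‖c‖ + ‖c‖ := by
        have := mem_closedBall_iff_norm.1 hv
        rw [coe_nnnorm] at this
        linarith [norm_le_norm_add_norm_sub' v c]
      refine ((A t).le_of_opNorm_le (hA' t ht) v).trans ?_
      linarith
    · simp
  obtain ⟨u, hu0, hu⟩ := hP.exists_eq_forall_mem_Icc_hasDerivWithinAt₀
  exact ⟨u, hu0, hu⟩

/-- **Frobenius theorem** for flat linear connections: parallel sections with an arbitrary initial
value exist on a ball. -/
theorem exists_parallel_of_flat [FiniteDimensional ℝ E] [CompleteSpace F]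
    {A : E → E →L[ℝ] F →L[ℝ] F} {s : Set E} (hs : IsOpen s) {z₀ : E} (hz₀ : z₀ ∈ s)
    (hA : ContDiffOn ℝ ∞ A s)
    (hflat : ∀ z ∈ s, ∀ (h k : E) (y : F), fderiv ℝ (fun z => A z k) z h y -
      fderiv ℝ (fun z => A z h) z k y + (A z h (A z k y) - A z k (A z h y)) = 0) :
    ∃ ρ > 0, Metric.ball z₀ ρ ⊆ s ∧ ∀ c : F, ∃ u : E → F, u z₀ = c ∧
      ContDiffOn ℝ ∞ u (Metric.ball z₀ ρ) ∧
      ∀ z ∈ Metric.ball z₀ ρ, HasFDerivAt u (-(A z).flip (u z)) z := by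
  obtain ⟨δ₁, hδ₁, B, hB, A', hA'⟩ := exists_taylor_bound_apply (hA.contDiffAt (hs.mem_nhds hz₀))
  obtain ⟨δ₂, hδ₂, hsub⟩ := Metric.isOpen_iff.1 hs z₀ hz₀
  have hB0 : 0 < B := zero_lt_one.trans_le hB
  -- Here δ₁ gives the Taylor bounds, δ₂ keeps the ball in s, 1 is needed in the radial estimate,
  -- and 1/(2B) makes ‖A(z₀ + t x) x‖ ≤ 1/2.
  let δ := min (min δ₁ δ₂) (min 1 (1 / (2 * B)))
  have hδ : 0 < δ := by positivity
  have hd1 : Metric.ball z₀ δ ⊆ Metric.ball z₀ δ₁ :=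
    Metric.ball_subset_ball ((min_le_left _ _).trans (min_le_left _ _))
  have hds : Metric.ball z₀ δ ⊆ s :=
    (Metric.ball_subset_ball ((min_le_left _ _).trans (min_le_right _ _))).trans hsub
  have hδ1 : δ ≤ 1 := (min_le_right _ _).trans (min_le_left _ _)
  have hδB : B * δ ≤ 1 / 2 := by
    have h1 : δ ≤ 1 / (2 * B) := (min_le_right _ _).trans (min_le_right _ _)
    calc B * δ ≤ B * (1 / (2 * B)) := by gcongr
      _ = 1 / 2 := by field_simp
  have hA1 : ContDiffOn ℝ ∞ A (Metric.ball z₀ δ) := hA.mono hds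
  refine ⟨δ, hδ, hds, fun c => ?_⟩
  have hex : ∀ x : E, ∃ u : ℝ → F, ‖x‖ < δ → u 0 = c ∧
      ∀ t ∈ Set.Icc (0 : ℝ) 1, HasDerivWithinAt u (-A (z₀ + t • x) x (u t)) (Set.Icc 0 1) t := by
    intro x
    by_cases hx : ‖x‖ < δ
    · have hb : ∀ t ∈ Set.Icc (0 : ℝ) 1, z₀ + t • x ∈ Metric.ball z₀ δ := by
        intro t ht
        rw [mem_ball_iff_norm, add_sub_cancel_left, norm_smul, Real.norm_of_nonneg ht.1]
        exact (mul_le_of_le_one_left (norm_nonneg x) ht.2).trans_lt hx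
      obtain ⟨u, hu⟩ := exists_radial_solution (A := fun t => A (z₀ + t • x) x)
        ((hA1.continuousOn.comp (by fun_prop) hb).clm_apply continuousOn_const)
        (fun t ht => ((hA' _ (hd1 (hb t ht))).2.1 x).trans
          ((mul_le_mul_of_nonneg_left hx.le hB0.le).trans hδB)) c
      exact ⟨u, fun _ => hu⟩
    · exact ⟨0, fun h => absurd h hx⟩
  choose u hu using hex
  have hder : ∀ z ∈ Metric.ball z₀ δ,
      HasFDerivAt (fun z => u (z - z₀) 1) (-(A z).flip (u (z - z₀) 1)) z := by
    intro z hz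
    have hz' : ‖z - z₀‖ < δ := mem_ball_iff_norm.1 hz
    have h1 := hasFDerivAt_radial_solution (A := A) (A' := A') (u := u) (c := c) hB hδ1
      (fun z hz => (hA' z (hd1 hz)).1)
      (fun z hz k v => (A z k).le_of_opNorm_le ((hA' z (hd1 hz)).2.1 k) v)
      (fun z hz k h v => (A' z k h).le_of_opNorm_le ((hA' z (hd1 hz)).2.2.1 k h) v)
      (fun z hz w hw k v => ContinuousLinearMap.le_of_opNorm_le _
        ((hA' z (hd1 hz)).2.2.2 w (hd1 hw) k) v)
      (fun z hz h k y => by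
        have := hflat z (hds hz) h k y
        rwa [((hA' z (hd1 hz)).1 k).fderiv, ((hA' z (hd1 hz)).1 h).fderiv] at this)
      (fun x hx => (hu x hx).1) (fun x hx => (hu x hx).2) hz'
    rw [add_sub_cancel] at h1
    have h2 : HasFDerivAt (fun z => z - z₀) (ContinuousLinearMap.id ℝ E) z :=
      (hasFDerivAt_id z).sub_const z₀
    exact HasFDerivAt.comp (f := fun z => z - z₀) z h1 h2
  refine ⟨fun z => u (z - z₀) 1, ?_, ?_, hder⟩
  · show u (z₀ - z₀) 1 = c
    rw [sub_self]
    have h0 : ‖(0 : E)‖ < δ := by rwa [norm_zero]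
    -- On the degenerate ray x = 0 the equation reads u' = 0, so the value at time 1 is still c.
    have hd := (hu 0 h0).2
    simp only [map_zero, _root_.zero_apply, neg_zero] at hd
    rw [← (hu 0 h0).1]
    have := (convex_Icc (0 : ℝ) 1).norm_image_sub_le_of_norm_hasDerivWithin_le (C := 0) hd
      (fun _ _ => norm_zero.le) ⟨le_rfl, zero_le_one⟩ ⟨zero_le_one, le_rfl⟩
    rw [zero_mul] at this
    exact sub_eq_zero.1 (norm_le_zero_iff.1 this)
  · rw [contDiffOn_infty]
    have hdiff : DifferentiableOn ℝ (fun z => u (z - z₀) 1) (Metric.ball z₀ δ) :=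
      fun z hz => (hder z hz).differentiableAt.differentiableWithinAt
    intro n
    -- Bootstrap: the derivative of u in a direction y is -A(z) y u, which is as smooth as u.
    induction n with
    | zero => exact contDiffOn_zero.2 hdiff.continuousOn
    | succ n ih =>
      push_cast
      refine contDiffOn_succ_of_fderiv_apply (n := (n : WithTop ℕ∞)) hdiff (fun h => by simp at h) fun y => ?_
      have h1 : ContDiffOn ℝ n (fun z => -(A z y (u (z - z₀) 1))) (Metric.ball z₀ δ) :=
        ((((hA1.of_le (by exact_mod_cast le_top)).clm_apply contDiffOn_const)).clm_apply ih).neg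
      refine h1.congr fun z hz => ?_
      rw [fderivWithin_of_isOpen Metric.isOpen_ball hz, (hder z hz).fderiv]
      rfl

end Frobenius

/-! ### Smooth vector fields and endomorphism fields in a chart. -/

section

variable {E : Type*} [NormedAddCommGroup E] [NormedSpace ℝ E]
  {M : Type*} [TopologicalSpace M] [ChartedSpace E M] [IsManifold 𝓘(ℝ, E) ∞ M]

open VectorField

theorem VField.SmoothOn.contMDiffAt {V : VField E M} {U : Set M} (hV : V.SmoothOn U)
    (hU : IsOpen U) {x : M} (hx : x ∈ U) :
    ContMDiffAt 𝓘(ℝ, E) (𝓘(ℝ, E).prod 𝓘(ℝ, E)) ∞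
      (fun x => (⟨x, V x⟩ : TangentBundle 𝓘(ℝ, E) M)) x :=
  ContMDiffOn.contMDiffAt hV (hU.mem_nhds hx)

theorem VField.SmoothOn.mdifferentiableAt {V : VField E M} {U : Set M} (hV : V.SmoothOn U)
    (hU : IsOpen U) {x : M} (hx : x ∈ U) :
    MDifferentiableAt 𝓘(ℝ, E) (𝓘(ℝ, E).prod 𝓘(ℝ, E))
      (fun x => (⟨x, V x⟩ : TangentBundle 𝓘(ℝ, E) M)) x :=
  (hV.contMDiffAt hU hx).mdifferentiableAt (by simp)

theorem VField.SmoothOn.mono {V : VField E M} {U U' : Set M} (hV : V.SmoothOn U) (h : U' ⊆ U) :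
    V.SmoothOn U' := ContMDiffOn.mono hV h

theorem VField.SmoothOn.congr {V W : VField E M} {U : Set M} (hV : V.SmoothOn U)
    (h : ∀ x ∈ U, W x = V x) : W.SmoothOn U :=
  ContMDiffOn.congr hV fun x hx => by rw [h x hx]

theorem VField.SmoothOn.add {V W : VField E M} {U : Set M} (hV : V.SmoothOn U)
    (hW : W.SmoothOn U) : (V + W).SmoothOn U :=
  ContMDiffOn.add_section hV hW

theorem VField.SmoothOn.neg {V : VField E M} {U : Set M} (hV : V.SmoothOn U) : (-V).SmoothOn U :=
  ContMDiffOn.neg_section hV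

theorem VField.SmoothOn.sub {V W : VField E M} {U : Set M} (hV : V.SmoothOn U)
    (hW : W.SmoothOn U) : (V - W).SmoothOn U :=
  ContMDiffOn.sub_section hV hW

theorem VField.SmoothOn.smul {f : M → ℝ} {V : VField E M} {U : Set M} (hf : FunSmoothOn E f U)
    (hV : V.SmoothOn U) : VField.SmoothOn (fun x => f x • V x) U :=
  ContMDiffOn.smul_section hf hV

theorem VField.SmoothOn.zero (U : Set M) : VField.SmoothOn (0 : VField E M) U :=
  (Bundle.contMDiff_zeroSection ℝ (TangentSpace 𝓘(ℝ, E) : M → Type _)).contMDiffOn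

variable [FiniteDimensional ℝ E]

theorem VField.SmoothOn.lie {V W : VField E M} {U : Set M} (hU : IsOpen U) (hV : V.SmoothOn U)
    (hW : W.SmoothOn U) : (InfGStr.lie V W).SmoothOn U := by
  have : CompleteSpace E := FiniteDimensional.complete ℝ E
  intro x hx
  refine ContMDiffAt.contMDiffWithinAt ?_
  have : IsManifold 𝓘(ℝ, E) (((⊤ : ℕ∞) : WithTop ℕ∞) + 1) M := by simpa
  have : IsManifold 𝓘(ℝ, E) (minSmoothness ℝ 2) M := by
    rw [minSmoothness_of_isRCLikeNormedField]; infer_instance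
  exact ContMDiffAt.mlieBracket_vectorField (m := ⊤) (n := ⊤) (hV.contMDiffAt hU hx)
    (hW.contMDiffAt hU hx) (by simp)

theorem FunSmoothOn.mdifferentiableAt {f : M → ℝ} {U : Set M} (hf : FunSmoothOn E f U)
    (hU : IsOpen U) {x : M} (hx : x ∈ U) : MDifferentiableAt 𝓘(ℝ, E) 𝓘(ℝ, ℝ) f x :=
  (ContMDiffOn.contMDiffAt hf (hU.mem_nhds hx)).mdifferentiableAt (by simp)

theorem lie_congr {V V' W W' : VField E M} {U : Set M} (hU : IsOpen U) (hV : ∀ x ∈ U, V x = V' x)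
    (hW : ∀ x ∈ U, W x = W' x) {x : M} (hx : x ∈ U) : lie V W x = lie V' W' x :=
  Filter.EventuallyEq.mlieBracket_vectorField_eq
    (Filter.eventually_of_mem (hU.mem_nhds hx) hV) (Filter.eventually_of_mem (hU.mem_nhds hx) hW)

theorem lie_swap (V W : VField E M) (x : M) : lie V W x = - lie W V x :=
  mlieBracket_swap_apply

/-- The tangent coordinates defined by the preferred chart at `x`. -/
def coord (x y : M) : TangentSpace 𝓘(ℝ, E) y →L[ℝ] E :=
  mfderiv 𝓘(ℝ, E) 𝓘(ℝ, E) (extChartAt 𝓘(ℝ, E) x) y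

/-- The coordinate vector field `w` in the preferred chart at `x`. -/
def coordField (x : M) (w : E) : VField E M :=
  mpullback 𝓘(ℝ, E) 𝓘(ℝ, E) (extChartAt 𝓘(ℝ, E) x) fun _ => w

theorem coord_eq_trivializationAt {x y : M} (hy : y ∈ (chartAt E x).source)
    (v : TangentSpace 𝓘(ℝ, E) y) :
    coord x y v = (trivializationAt E (TangentSpace 𝓘(ℝ, E) : M → Type _) x ⟨y, v⟩).2 := by
  unfold coord
  rw [← TangentBundle.continuousLinearMapAt_trivializationAt hy]
  rw [Bundle.Trivialization.continuousLinearMapAt_apply, Bundle.Trivialization.linearMapAt_apply]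
  rw [if_pos (by rwa [TangentBundle.trivializationAt_baseSet])]

/-- T_x M is modelled on E by the preferred chart at x itself, so no coordinate change intervenes at
the centre. -/
theorem coord_self (x : M) (v : TangentSpace 𝓘(ℝ, E) x) : coord x x v = v := by
  rw [coord_eq_trivializationAt (mem_chart_source E x)]
  exact (tangentBundleCore 𝓘(ℝ, E) M).coordChange_self (achart E x) x (mem_chart_source E x) v

theorem isInvertible_coord {x y : M} (hy : y ∈ (chartAt E x).source) :
    (coord (E := E) x y).IsInvertible :=
  isInvertible_mfderiv_extChartAt (by simpa using hy)

theorem coord_coordField {x y : M} (hy : y ∈ (chartAt E x).source) (w : E) :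
    coord x y (coordField x w y) = w :=
  ContinuousLinearMap.IsInvertible.self_apply_inverse (isInvertible_coord hy) _

theorem coord_injective {x y : M} (hy : y ∈ (chartAt E x).source) :
    Function.Injective (coord (E := E) x y) :=
  (isInvertible_coord hy).injective

theorem coordField_coord {x y : M} (hy : y ∈ (chartAt E x).source)
    (v : TangentSpace 𝓘(ℝ, E) y) : coordField x (coord x y v) y = v :=
  coord_injective hy (coord_coordField hy _)

theorem smoothOn_iff_coord {x : M} {V : VField E M} {U : Set M} (hU : IsOpen U)
    (hUx : U ⊆ (chartAt E x).source) :
    V.SmoothOn U ↔ ContMDiffOn 𝓘(ℝ, E) 𝓘(ℝ, E) ∞ (fun y => coord x y (V y)) U := by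
  refine ((trivializationAt E (TangentSpace 𝓘(ℝ, E) : M → Type _) x).contMDiffOn_section_iff hU
    (by rwa [TangentBundle.trivializationAt_baseSet])).trans ?_
  exact contMDiffOn_congr fun y hy => (coord_eq_trivializationAt (hUx hy) (V y)).symm

theorem smoothOn_coordField (x : M) (w : E) :
    (coordField x w).SmoothOn (chartAt E x).source := by
  rw [smoothOn_iff_coord (chartAt E x).open_source le_rfl]
  exact (contMDiffOn_const (c := w)).congr fun y hy => coord_coordField hy w

theorem lie_coordField {x y : M} (hy : y ∈ (chartAt E x).source) (v w : E) :
    lie (coordField x v) (coordField x w) y = 0 := by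
  have : CompleteSpace E := FiniteDimensional.complete ℝ E
  have : IsManifold 𝓘(ℝ, E) (minSmoothness ℝ 2) M := by
    rw [minSmoothness_of_isRCLikeNormedField]; infer_instance
  have h : ∀ (u : E) (z : E), MDifferentiableAt 𝓘(ℝ, E) (𝓘(ℝ, E).prod 𝓘(ℝ, E))
      (fun z => (⟨z, u⟩ : TangentBundle 𝓘(ℝ, E) E)) z := fun u z =>
    (contMDiffAt_vectorSpace_iff_contDiffAt (V := fun _ => u) (n := 1).2 contDiffAt_const).mdifferentiableAt (by simp)
  unfold lie coordField
  rw [← mpullback_mlieBracket (h v _) (h w _)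
    (contMDiffAt_extChartAt' (n := ∞) (by simpa using hy))
    (by rw [minSmoothness_of_isRCLikeNormedField]; exact WithTop.coe_le_coe.2 (le_top (a := (2 : ℕ∞))))]
  have h0 : mlieBracket 𝓘(ℝ, E) (fun _ : E => v) (fun _ => w) = 0 := by
    refine mlieBracketWithin_univ.symm.trans (mlieBracketWithin_eq_lieBracketWithin.trans ?_)
    funext z
    simp [lieBracketWithin]
    rfl
  exact (congrArg (fun F => mpullback 𝓘(ℝ, E) 𝓘(ℝ, E) (extChartAt 𝓘(ℝ, E) x) F y) h0).trans
    (map_zero _)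

theorem chartDeriv_eq (V : VField E M) (x : M) :
    chartDeriv V x = mfderiv 𝓘(ℝ, E) 𝓘(ℝ, E) (fun y => coord x y (V y)) x := by
  refine Filter.EventuallyEq.mfderiv_eq ?_
  filter_upwards [(chartAt E x).open_source.mem_nhds (mem_chart_source E x)] with y hy
  exact (coord_eq_trivializationAt hy _).symm

theorem mdifferentiableAt_coord {V : VField E M} {x : M}
    (hV : MDifferentiableAt 𝓘(ℝ, E) (𝓘(ℝ, E).prod 𝓘(ℝ, E))
      (fun x => (⟨x, V x⟩ : TangentBundle 𝓘(ℝ, E) M)) x) :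
    MDifferentiableAt 𝓘(ℝ, E) 𝓘(ℝ, E) (fun y => coord x y (V y)) x := by
  rw [mdifferentiableAt_section] at hV
  refine hV.congr_of_eventuallyEq ?_
  filter_upwards [(chartAt E x).open_source.mem_nhds (mem_chart_source E x)] with y hy
  exact coord_eq_trivializationAt hy _

theorem mpullbackWithin_extChartAt_symm (V : VField E M) (x : M) {z : E}
    (hz : z ∈ (extChartAt 𝓘(ℝ, E) x).target) :
    mpullbackWithin 𝓘(ℝ, E) 𝓘(ℝ, E) (extChartAt 𝓘(ℝ, E) x).symm V (Set.range 𝓘(ℝ, E)) z =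
      coord x ((extChartAt 𝓘(ℝ, E) x).symm z) (V ((extChartAt 𝓘(ℝ, E) x).symm z)) := by
  refine (isInvertible_mfderivWithin_extChartAt_symm hz).inverse_apply_eq.2 ?_
  have := mfderivWithin_extChartAt_symm_comp_mfderiv_extChartAt hz
  exact (DFunLike.congr_fun this (V ((extChartAt 𝓘(ℝ, E) x).symm z))).symm

/-- Read in the chart at x, a field has value V x and derivative `chartDeriv V x` at the centre,
where the coordinate map is the identity; the formula is then the bracket of vector fields on E. -/
theorem lie_eq_chartDeriv {V W : VField E M} {x : M}
    (hV : MDifferentiableAt 𝓘(ℝ, E) (𝓘(ℝ, E).prod 𝓘(ℝ, E))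
      (fun x => (⟨x, V x⟩ : TangentBundle 𝓘(ℝ, E) M)) x)
    (hW : MDifferentiableAt 𝓘(ℝ, E) (𝓘(ℝ, E).prod 𝓘(ℝ, E))
      (fun x => (⟨x, W x⟩ : TangentBundle 𝓘(ℝ, E) M)) x) :
    lie V W x = chartDeriv W x (V x) - chartDeriv V x (W x) := by
  have hinv : ∀ u : E, (coord (E := E) x x).inverse u = u := fun u =>
    (isInvertible_coord (mem_chart_source E x)).inverse_apply_eq.2 (coord_self x u).symm
  have key : ∀ {V : VField E M}, MDifferentiableAt 𝓘(ℝ, E) (𝓘(ℝ, E).prod 𝓘(ℝ, E))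
      (fun x => (⟨x, V x⟩ : TangentBundle 𝓘(ℝ, E) M)) x → 
      mpullbackWithin 𝓘(ℝ, E) 𝓘(ℝ, E) (extChartAt 𝓘(ℝ, E) x).symm V (Set.range 𝓘(ℝ, E)) 
        (extChartAt 𝓘(ℝ, E) x x) = V x ∧
      fderivWithin ℝ (mpullbackWithin 𝓘(ℝ, E) 𝓘(ℝ, E) (extChartAt 𝓘(ℝ, E) x).symm V
        (Set.range 𝓘(ℝ, E))) ((extChartAt 𝓘(ℝ, E) x).symm ⁻¹' Set.univ ∩ Set.range 𝓘(ℝ, E))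
        (extChartAt 𝓘(ℝ, E) x x) = chartDeriv V x := by
    intro V hV
    constructor
    · rw [mpullbackWithin_extChartAt_symm V x (mem_extChartAt_target x), extChartAt_to_inv]
      exact coord_self x (V x)
    · rw [chartDeriv_eq, (mdifferentiableAt_coord hV).mfderiv]
      have hs : (extChartAt 𝓘(ℝ, E) x).symm ⁻¹' Set.univ ∩ Set.range 𝓘(ℝ, E) = 
        Set.range 𝓘(ℝ, E) := by simp
      rw [hs]
      refine Filter.EventuallyEq.fderivWithin_eq ?_ ?_
      · filter_upwards [extChartAt_target_mem_nhdsWithin x] with z hz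
        exact mpullbackWithin_extChartAt_symm V x hz
      · exact mpullbackWithin_extChartAt_symm V x (mem_extChartAt_target x)
  unfold lie
  rw [← mlieBracketWithin_univ, mlieBracketWithin_apply]
  refine (hinv _).trans ?_
  unfold lieBracketWithin
  rw [(key hV).1, (key hV).2, (key hW).1, (key hW).2]
  rfl

theorem contMDiffAt_clm_of_apply {K F : Type*} [NormedAddCommGroup K] [NormedSpace ℝ K]
    [FiniteDimensional ℝ K] [NormedAddCommGroup F] [NormedSpace ℝ F]
    {Φ : M → (K →L[ℝ] F)} {x : M}
    (h : ∀ w, ContMDiffAt 𝓘(ℝ, E) 𝓘(ℝ, F) ∞ (fun y => Φ y w) x) :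
    ContMDiffAt 𝓘(ℝ, E) 𝓘(ℝ, K →L[ℝ] F) ∞ Φ x := by
  let b := Module.finBasis ℝ K
  have e : Φ = fun y => ∑ i, ContinuousLinearMap.smulRightL ℝ K F
      (LinearMap.toContinuousLinearMap (b.coord i)) (Φ y (b i)) := by
    funext y
    ext w
    conv_lhs => rw [← b.sum_repr w, map_sum]
    simp
  rw [e]
  exact contMDiffAt_finsetSum fun i _ => (contMDiffAt_const (c := _)).clm_apply (h (b i))

theorem EndField.SmoothOn.app {φ : EndField E M} {V : VField E M} {U : Set M} (hφ : φ.SmoothOn U)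
    (hV : V.SmoothOn U) : (φ.app V).SmoothOn U :=
  ContMDiffOn.clm_bundle_apply hφ hV

theorem EndField.SmoothOn.mono {φ : EndField E M} {U U' : Set M} (hφ : φ.SmoothOn U)
    (h : U' ⊆ U) : φ.SmoothOn U' := ContMDiffOn.mono hφ h

/-- Coordinate fields suffice as tests. Smaller open sets enter the hypothesis because those fields
are available only on a chart domain. -/
theorem EndField.smoothOn_of_app {φ : EndField E M} {U : Set M} (hU : IsOpen U)
    (h : ∀ (U' : Set M) (V : VField E M), IsOpen U' → U' ⊆ U → V.SmoothOn U' →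
      (φ.app V).SmoothOn U') : φ.SmoothOn U := by
  intro x hx
  refine ContMDiffAt.contMDiffWithinAt ?_
  refine (contMDiffAt_hom_bundle _).2 ⟨contMDiffAt_id, ?_⟩
  refine contMDiffAt_clm_of_apply fun w => ?_
  have hS := (chartAt E x).open_source
  have h1 := h (U ∩ (chartAt E x).source) (coordField x w) (hU.inter hS)
    Set.inter_subset_left ((smoothOn_coordField x w).mono Set.inter_subset_right)
  rw [smoothOn_iff_coord (hU.inter hS) Set.inter_subset_right] at h1
  have hm : U ∩ (chartAt E x).source ∈ 𝓝 x :=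
    (hU.inter hS).mem_nhds ⟨hx, mem_chart_source E x⟩
  refine (h1.contMDiffAt hm).congr_of_eventuallyEq ?_
  filter_upwards [hm] with y hy
  have hb : y ∈ (trivializationAt E (TangentSpace 𝓘(ℝ, E) : M → Type _) x).baseSet := by
    rw [TangentBundle.trivializationAt_baseSet]; exact hy.2
  have hsymm : (trivializationAt E (TangentSpace 𝓘(ℝ, E) : M → Type _) x).symm y w =
      coordField x w y := by
    apply coord_injective hy.2
    rw [coord_coordField hy.2, coord_eq_trivializationAt hy.2,
      Bundle.Trivialization.apply_mk_symm _ hb]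
  rw [EndField.app, coord_eq_trivializationAt hy.2, ← hsymm]
  rw [ContinuousLinearMap.inCoordinates_eq hb hb]
  rfl

theorem EndField.SmoothOn.mdifferentiableAt {φ : EndField E M} {U : Set M} (hφ : φ.SmoothOn U)
    (hU : IsOpen U) {x : M} (hx : x ∈ U) :
    MDifferentiableAt 𝓘(ℝ, E) (𝓘(ℝ, E).prod 𝓘(ℝ, E →L[ℝ] E))
      (fun x => (⟨x, φ x⟩ : Bundle.TotalSpace (E →L[ℝ] E)
        (fun x : M => TangentSpace 𝓘(ℝ, E) x →L[ℝ] TangentSpace 𝓘(ℝ, E) x))) x :=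
  (ContMDiffOn.contMDiffAt hφ (hU.mem_nhds hx)).mdifferentiableAt (by simp)

theorem kappa_apply {X V : VField E M} {φ : EndField E M} {U : Set M} (hU : IsOpen U)
    (hφ : φ.SmoothOn U) (hV : V.SmoothOn U) {x : M} (hx : x ∈ U) :
    kappa X φ x (V x) = lie X (φ.app V) x + φ x (lie V X x) := by
  have h := kappaOp_tensorialAt X φ x (hφ.mdifferentiableAt hU hx)
  rw [kappa, dif_pos h, TensorialAt.mkHom_apply h (hV.mdifferentiableAt hU hx)]
  rfl

theorem chartDeriv_congr {V W : VField E M} {U : Set M} (hU : IsOpen U)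
    (h : ∀ x ∈ U, V x = W x) {x : M} (hx : x ∈ U) : chartDeriv V x = chartDeriv W x := by
  rw [chartDeriv_eq, chartDeriv_eq]
  refine Filter.EventuallyEq.mfderiv_eq ?_
  filter_upwards [hU.mem_nhds hx] with y hy
  rw [h y hy]

theorem chartDeriv_add {V W : VField E M} {x : M}
    (hV : MDifferentiableAt 𝓘(ℝ, E) (𝓘(ℝ, E).prod 𝓘(ℝ, E))
      (fun x => (⟨x, V x⟩ : TangentBundle 𝓘(ℝ, E) M)) x)
    (hW : MDifferentiableAt 𝓘(ℝ, E) (𝓘(ℝ, E).prod 𝓘(ℝ, E))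
      (fun x => (⟨x, W x⟩ : TangentBundle 𝓘(ℝ, E) M)) x) :
    chartDeriv (V + W) x = chartDeriv V x + chartDeriv W x := by
  rw [chartDeriv_eq, chartDeriv_eq, chartDeriv_eq]
  refine Eq.trans ?_ (mfderiv_add (mdifferentiableAt_coord hV) (mdifferentiableAt_coord hW))
  congr 1
  funext y
  exact map_add _ _ _

theorem chartDeriv_smul {f : M → ℝ} {V : VField E M} {x : M}
    (hf : MDifferentiableAt 𝓘(ℝ, E) 𝓘(ℝ, ℝ) f x)
    (hV : MDifferentiableAt 𝓘(ℝ, E) (𝓘(ℝ, E).prod 𝓘(ℝ, E))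
      (fun x => (⟨x, V x⟩ : TangentBundle 𝓘(ℝ, E) M)) x) :
    chartDeriv (fun y => f y • V y) x =
      f x • chartDeriv V x + (dFun E f x).smulRight (V x) := by
  simpa [prolong, incl] using congrArg Prod.snd (prolong_smul f V x hf hV)

/-! ### One-jets as first-order operators on vector fields. -/

/-- The action of a one-jet at `x` on vector fields: the value at `x` of `ad`. -/
def adAt {x : M} (j : Jet E x) (W : VField E M) : TangentSpace 𝓘(ℝ, E) x :=
  chartDeriv W x j.1 - j.2 (W x)

theorem adAt_add_left {x : M} (j k : Jet E x) (W : VField E M) :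
    adAt (j + k) W = adAt j W + adAt k W := by
  simp only [adAt, Prod.fst_add, Prod.snd_add, map_add, _root_.add_apply]
  abel

theorem adAt_sub_left {x : M} (j k : Jet E x) (W : VField E M) :
    adAt (j - k) W = adAt j W - adAt k W := by
  simp only [adAt, Prod.fst_sub, Prod.snd_sub, map_sub, _root_.sub_apply]
  abel

theorem adAt_zero_left {x : M} (W : VField E M) : adAt (0 : Jet E x) W = 0 := by
  simp [adAt]

theorem adAt_smul_left {x : M} (c : ℝ) (j : Jet E x) (W : VField E M) :
    adAt (c • j) W = c • adAt j W := by
  simp only [adAt, Prod.smul_fst, Prod.smul_snd, map_smul, _root_.smul_apply, smul_sub]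

/-- The derivative of the anchor in the Lie bracket cancels the one subtracted in `vert`. So the
action at x involves no derivative of σ, only its value. -/
theorem ad_eq_adAt {σ : JSec E M} {W : VField E M} {x : M}
    (hσ : MDifferentiableAt 𝓘(ℝ, E) (𝓘(ℝ, E).prod 𝓘(ℝ, E))
      (fun x => (⟨x, anchor σ x⟩ : TangentBundle 𝓘(ℝ, E) M)) x)
    (hW : MDifferentiableAt 𝓘(ℝ, E) (𝓘(ℝ, E).prod 𝓘(ℝ, E))
      (fun x => (⟨x, W x⟩ : TangentBundle 𝓘(ℝ, E) M)) x) :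
    ad σ W x = adAt (σ x) W := by
  simp only [ad, Pi.sub_apply, lie_eq_chartDeriv hσ hW, EndField.app, vert, adAt,
    _root_.sub_apply]
  simp only [anchor]
  abel

theorem chartDeriv_coordField (x : M) (w : E) : chartDeriv (coordField x w) x = 0 := by
  rw [chartDeriv_eq]
  refine Eq.trans ?_ (mfderiv_const (I := 𝓘(ℝ, E)) (I' := 𝓘(ℝ, E)) (M := M) (c := w) (x := x))
  refine Filter.EventuallyEq.mfderiv_eq ?_
  filter_upwards [(chartAt E x).open_source.mem_nhds (mem_chart_source E x)] with y hy
  exact coord_coordField hy w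

theorem adAt_smul_right {x : M} (j : Jet E x) {f : M → ℝ} {W : VField E M}
    (hf : MDifferentiableAt 𝓘(ℝ, E) 𝓘(ℝ, ℝ) f x)
    (hW : MDifferentiableAt 𝓘(ℝ, E) (𝓘(ℝ, E).prod 𝓘(ℝ, E))
      (fun x => (⟨x, W x⟩ : TangentBundle 𝓘(ℝ, E) M)) x) :
    adAt j (fun y => f y • W y) = dFun E f x j.1 • W x + f x • adAt j W := by
  simp only [adAt, chartDeriv_smul hf hW, _root_.add_apply,
    _root_.smul_apply, ContinuousLinearMap.smulRight_apply, map_smul, smul_sub]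
  abel

theorem dFun_clm_extChartAt (x : M) (ℓ : E →L[ℝ] ℝ) (v : TangentSpace 𝓘(ℝ, E) x) :
    MDifferentiableAt 𝓘(ℝ, E) 𝓘(ℝ, ℝ) (fun y => ℓ (extChartAt 𝓘(ℝ, E) x y)) x ∧
    dFun E (fun y => ℓ (extChartAt 𝓘(ℝ, E) x y)) x v = ℓ v := by
  have h := (mdifferentiableAt_extChartAt (I := 𝓘(ℝ, E)) (mem_chart_source E x)).hasMFDerivAt
  have h2 := (ℓ.hasMFDerivAt (x := extChartAt 𝓘(ℝ, E) x x)).comp x h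
  refine ⟨h2.mdifferentiableAt, ?_⟩
  have h3 := h2.mfderiv
  refine (DFunLike.congr_fun h3 v).trans ?_
  exact congrArg ℓ (coord_self x v)

/-- A difference of jets is tested in two stages. Coordinate fields have zero derivative in the
chart at x and so detect the endomorphism part. A coordinate field multiplied by a linear coordinate
function then detects the vector part through the Leibniz rule. -/
theorem jet_ext {x : M} {j k : Jet E x}
    (h : ∀ W : VField E M, W.SmoothOn (chartAt E x).source → adAt j W = adAt k W) : j = k := by
  rw [← sub_eq_zero]
  have h0 : ∀ W : VField E M, W.SmoothOn (chartAt E x).source → adAt (j - k) W = 0 := by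
    intro W hW
    rw [adAt_sub_left, h W hW, sub_self]
  generalize j - k = i at h0
  have hc : ∀ w : TangentSpace 𝓘(ℝ, E) x, coordField x (coord x x w) x = w := fun w =>
    coordField_coord (mem_chart_source E x) w
  have h2 : i.2 = 0 := by
    ext w
    have := h0 (coordField x (coord x x w)) (smoothOn_coordField x _)
    rw [adAt, chartDeriv_coordField, hc] at this
    simpa using this
  have h1 : i.1 = 0 := by
    by_contra hne
    have hne' : coord x x i.1 ≠ 0 := fun h =>
      hne (coord_injective (mem_chart_source E x) (h.trans (map_zero _).symm))
    obtain ⟨ℓ, hℓ⟩ := SeparatingDual.exists_ne_zero (R := ℝ) hne'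
    have hsm : FunSmoothOn E (fun y => ℓ (extChartAt 𝓘(ℝ, E) x y)) (chartAt E x).source :=
      ℓ.contMDiff.comp_contMDiffOn contMDiffOn_extChartAt
    have h3 := h0 _ (VField.SmoothOn.smul hsm (smoothOn_coordField x (coord x x i.1)))
    rw [adAt_smul_right i (dFun_clm_extChartAt x ℓ i.1).1
      ((smoothOn_coordField x _).mdifferentiableAt (chartAt E x).open_source
        (mem_chart_source E x)), h0 _ (smoothOn_coordField x _), smul_zero, add_zero,
      (dFun_clm_extChartAt x ℓ i.1).2, hc] at h3
    exact (smul_ne_zero (fun h => hℓ ((congrArg ℓ (coord_self x i.1)).trans h)) hne) h3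
  exact Prod.ext h1 h2

theorem lie_add_right (V : VField E M) {W Y : VField E M} {U : Set M} (hU : IsOpen U)
    (hW : W.SmoothOn U) (hY : Y.SmoothOn U) {x : M} (hx : x ∈ U) :
    lie V (W + Y) x = lie V W x + lie V Y x := by
  have : CompleteSpace E := FiniteDimensional.complete ℝ E
  exact mlieBracket_add_right (hW.mdifferentiableAt hU hx) (hY.mdifferentiableAt hU hx)

theorem lie_neg_right (V : VField E M) {W : VField E M} {U : Set M} (hU : IsOpen U)
    (hW : W.SmoothOn U) {x : M} (hx : x ∈ U) : lie V (-W) x = - lie V W x := by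
  have h := lie_add_right V hU hW hW.neg hx
  have h0 : lie V (W + -W) x = 0 := by
    rw [add_neg_cancel]
    exact congrFun mlieBracket_zero_right x
  rw [h0] at h
  exact (neg_eq_of_add_eq_zero_right h.symm).symm

theorem lie_sub_right (V : VField E M) {W Y : VField E M} {U : Set M} (hU : IsOpen U)
    (hW : W.SmoothOn U) (hY : Y.SmoothOn U) {x : M} (hx : x ∈ U) :
    lie V (W - Y) x = lie V W x - lie V Y x := by
  rw [sub_eq_add_neg, lie_add_right V hU hW hY.neg hx, lie_neg_right V hU hY hx, sub_eq_add_neg]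

theorem lie_lie {V W Y : VField E M} {U : Set M} (hU : IsOpen U) (hV : V.SmoothOn U)
    (hW : W.SmoothOn U) (hY : Y.SmoothOn U) {x : M} (hx : x ∈ U) :
    lie V (lie W Y) x = lie (lie V W) Y x + lie W (lie V Y) x := by
  have : CompleteSpace E := FiniteDimensional.complete ℝ E
  have h3 : IsManifold 𝓘(ℝ, E) (minSmoothness ℝ 3) M := by
    rw [minSmoothness_of_isRCLikeNormedField]; infer_instance
  have hle : minSmoothness ℝ 2 ≤ (∞ : WithTop ℕ∞) := by
    rw [minSmoothness_of_isRCLikeNormedField]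
    exact WithTop.coe_le_coe.2 (le_top (a := (2 : ℕ∞)))
  exact leibniz_identity_mlieBracket_apply ((hV.contMDiffAt hU hx).of_le hle)
    ((hW.contMDiffAt hU hx).of_le hle) ((hY.contMDiffAt hU hx).of_le hle)

theorem adAt_congr {x : M} (j : Jet E x) {V W : VField E M} {U : Set M} (hU : IsOpen U)
    (h : ∀ x ∈ U, V x = W x) (hx : x ∈ U) : adAt j V = adAt j W := by
  rw [adAt, adAt, chartDeriv_congr hU h hx, h x hx]

namespace JSec.SmoothOn

variable {σ τ : JSec E M} {U U' : Set M}

theorem mono (hσ : σ.SmoothOn U) (h : U' ⊆ U) : σ.SmoothOn U' :=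
  ⟨hσ.1.mono h, hσ.2.mono h⟩

theorem ad_apply (hσ : σ.SmoothOn U) (hU : IsOpen U) {W : VField E M} (hW : W.SmoothOn U)
    {x : M} (hx : x ∈ U) : ad σ W x = adAt (σ x) W :=
  ad_eq_adAt (hσ.1.mdifferentiableAt hU hx) (hW.mdifferentiableAt hU hx)

theorem ad (hσ : σ.SmoothOn U) (hU : IsOpen U) {W : VField E M} (hW : W.SmoothOn U) :
    (ad σ W).SmoothOn U :=
  (VField.SmoothOn.lie hU hσ.1 hW).sub (hσ.2.app hW)

end JSec.SmoothOn

/-- `vert` is not a fibrewise operation, since it differentiates the anchor, whereas the action on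
vector fields is. The closure properties of smooth sections are proved through this criterion. -/
theorem JSec.smoothOn_of_ad {σ : JSec E M} {U : Set M} (hU : IsOpen U)
    (h1 : (anchor σ).SmoothOn U)
    (h2 : ∀ (U' : Set M) (W : VField E M), IsOpen U' → U' ⊆ U → W.SmoothOn U' →
      VField.SmoothOn (fun x => adAt (σ x) W) U') : σ.SmoothOn U := by
  refine ⟨h1, EndField.smoothOn_of_app hU fun U' W hU' hUU hW => ?_⟩
  refine ((VField.SmoothOn.lie hU' (h1.mono hUU) hW).sub (h2 U' W hU' hUU hW)).congr fun x hx => ?_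
  have h := ad_eq_adAt ((h1.mono hUU).mdifferentiableAt hU' hx) (hW.mdifferentiableAt hU' hx)
  rw [Pi.sub_apply, ← h]
  simp [InfGStr.ad]

namespace JSec.SmoothOn

variable {σ τ : JSec E M} {U U' : Set M}

theorem adAt (hσ : σ.SmoothOn U) (hU : IsOpen U) {W : VField E M} (hW : W.SmoothOn U) :
    VField.SmoothOn (fun x => adAt (σ x) W) U :=
  (hσ.ad hU hW).congr fun _ hx => (hσ.ad_apply hU hW hx).symm

theorem congr (hU : IsOpen U) (hσ : σ.SmoothOn U) (h : ∀ x ∈ U, τ x = σ x) : τ.SmoothOn U :=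
  smoothOn_of_ad hU (hσ.1.congr fun x hx => congrArg Prod.fst (h x hx))
    fun U' W hU' hUU hW => ((hσ.mono hUU).adAt hU' hW).congr fun x hx => by rw [h x (hUU hx)]

theorem add (hU : IsOpen U) (hσ : σ.SmoothOn U) (hτ : τ.SmoothOn U) : (σ + τ).SmoothOn U :=
  smoothOn_of_ad hU (hσ.1.add hτ.1) fun _ _ hU' hUU hW =>
    (((hσ.mono hUU).adAt hU' hW).add ((hτ.mono hUU).adAt hU' hW)).congr
      fun _ _ => adAt_add_left _ _ _

theorem sub (hU : IsOpen U) (hσ : σ.SmoothOn U) (hτ : τ.SmoothOn U) : (σ - τ).SmoothOn U :=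
  smoothOn_of_ad hU (hσ.1.sub hτ.1) fun _ _ hU' hUU hW =>
    (((hσ.mono hUU).adAt hU' hW).sub ((hτ.mono hUU).adAt hU' hW)).congr
      fun _ _ => adAt_sub_left _ _ _

theorem smul (hU : IsOpen U) {f : M → ℝ} (hf : FunSmoothOn E f U) (hσ : σ.SmoothOn U) :
    JSec.SmoothOn (fun x => f x • σ x) U :=
  smoothOn_of_ad hU (VField.SmoothOn.smul hf hσ.1) fun _ _ hU' hUU hW =>
    (VField.SmoothOn.smul (ContMDiffOn.mono hf hUU) ((hσ.mono hUU).adAt hU' hW)).congr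
      fun _ _ => adAt_smul_left _ _ _

theorem zero (hU : IsOpen U) : (0 : JSec E M).SmoothOn U :=
  smoothOn_of_ad hU (VField.SmoothOn.zero U) fun _ _ _ _ _ =>
    (VField.SmoothOn.zero _).congr fun _ _ => adAt_zero_left _

theorem sum (hU : IsOpen U) {ι : Type*} (s : Finset ι) {σ : ι → JSec E M}
    (h : ∀ i ∈ s, (σ i).SmoothOn U) : JSec.SmoothOn (fun x => ∑ i ∈ s, σ i x) U := by
  classical
  induction s using Finset.induction_on with
  | empty => exact (zero hU).congr hU fun x _ => by simp
  | insert a s ha ih =>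
    refine ((h a (by simp)).add hU (ih fun i hi => h i (by simp [hi]))).congr hU fun x _ => ?_
    simp [Finset.sum_insert ha]

end JSec.SmoothOn

/-! ### The adjoint representation of J¹(TM). -/

theorem anchor_bracket (σ τ : JSec E M) : anchor (bracket σ τ) = lie (anchor σ) (anchor τ) := by
  funext x
  simp [anchor, bracket, prolong, incl]

theorem vert_bracket (σ τ : JSec E M) : vert (bracket σ τ) =
    endBracket (vert σ) (vert τ) + kappa (anchor σ) (vert τ) - kappa (anchor τ) (vert σ) := by
  funext x
  unfold vert
  rw [anchor_bracket]
  simp [bracket, prolong, incl]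
  rfl

/-- For prolongations this is the Jacobi identity of vector fields; the κ terms are the commutators
of a Lie derivative with an endomorphism; and the order φ₂φ₁ - φ₁φ₂ in the fibre bracket is the one
compatible with ad_φ = -φ. -/
theorem ad_bracket {σ τ : JSec E M} {W : VField E M} {U : Set M} (hU : IsOpen U)
    (hσ : σ.SmoothOn U) (hτ : τ.SmoothOn U) (hW : W.SmoothOn U) {x : M} (hx : x ∈ U) :
    ad (bracket σ τ) W x = ad σ (ad τ W) x - ad τ (ad σ W) x := by
  have hV₁ := hσ.1
  have hV₂ := hτ.1
  have e1 : ad (bracket σ τ) W x = lie (lie (anchor σ) (anchor τ)) W x -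
      ((vert τ x) (vert σ x (W x)) - (vert σ x) (vert τ x (W x)) +
        (lie (anchor σ) ((vert τ).app W) x + vert τ x (lie W (anchor σ) x)) -
        (lie (anchor τ) ((vert σ).app W) x + vert σ x (lie W (anchor τ) x))) := by
    rw [← kappa_apply hU hτ.2 hW hx, ← kappa_apply hU hσ.2 hW hx]
    unfold ad
    rw [anchor_bracket, vert_bracket]
    rfl
  have e2 : ∀ {σ τ : JSec E M}, σ.SmoothOn U → τ.SmoothOn U → ad σ (ad τ W) x =
      lie (anchor σ) (lie (anchor τ) W) x - lie (anchor σ) ((vert τ).app W) x -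
        (vert σ x (lie (anchor τ) W x) - vert σ x (vert τ x (W x))) := by
    intro σ τ hσ hτ
    rw [← map_sub]
    refine congrArg (· - (vert σ x (lie (anchor τ) W x - vert τ x (W x)))) ?_
    exact lie_sub_right _ hU (VField.SmoothOn.lie hU hτ.1 hW) (hτ.2.app hW) hx
  rw [e1, e2 hσ hτ, e2 hτ hσ, lie_lie hU hV₁ hV₂ hW hx, lie_swap W (anchor σ),
    lie_swap W (anchor τ), map_neg, map_neg]
  abel

theorem JSec.SmoothOn.bracket {σ τ : JSec E M} {U : Set M} (hU : IsOpen U)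
    (hσ : σ.SmoothOn U) (hτ : τ.SmoothOn U) : (bracket σ τ).SmoothOn U := by
  have h1 : (anchor (InfGStr.bracket σ τ)).SmoothOn U := by
    rw [anchor_bracket]
    exact VField.SmoothOn.lie hU hσ.1 hτ.1
  refine JSec.smoothOn_of_ad hU h1 fun U' W hU' hUU hW => ?_
  have hσ' := hσ.mono hUU
  have hτ' := hτ.mono hUU
  refine ((hσ'.ad hU' (hτ'.ad hU' hW)).sub (hτ'.ad hU' (hσ'.ad hU' hW))).congr fun x hx => ?_
  rw [Pi.sub_apply, ← ad_bracket hU' hσ' hτ' hW hx, ad_eq_adAt ((h1.mono hUU).mdifferentiableAt hU' hx)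
    (hW.mdifferentiableAt hU' hx)]

theorem lie_neg_left (V : VField E M) {W : VField E M} {U : Set M} (hU : IsOpen U)
    (hW : W.SmoothOn U) {x : M} (hx : x ∈ U) : lie (-W) V x = - lie W V x := by
  rw [lie_swap, lie_neg_right V hU hW hx, neg_neg, lie_swap V W]

theorem lie_add_left (V : VField E M) {W Y : VField E M} {U : Set M} (hU : IsOpen U)
    (hW : W.SmoothOn U) (hY : Y.SmoothOn U) {x : M} (hx : x ∈ U) :
    lie (W + Y) V x = lie W V x + lie Y V x := by
  rw [lie_swap, lie_add_right V hU hW hY hx, lie_swap V W, lie_swap V Y, neg_add, neg_neg, neg_neg]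

theorem ad_congr (σ : JSec E M) {V W : VField E M} {U : Set M} (hU : IsOpen U)
    (h : ∀ x ∈ U, V x = W x) {x : M} (hx : x ∈ U) : ad σ V x = ad σ W x := by
  simp only [ad, Pi.sub_apply, EndField.app]
  rw [lie_congr hU (fun _ _ => rfl) h hx, h x hx]

theorem ad_add_right (σ : JSec E M) {V W : VField E M} {U : Set M} (hU : IsOpen U)
    (hV : V.SmoothOn U) (hW : W.SmoothOn U) {x : M} (hx : x ∈ U) :
    ad σ (V + W) x = ad σ V x + ad σ W x := by
  simp only [ad, Pi.sub_apply, EndField.app, Pi.add_apply]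
  rw [lie_add_right _ hU hV hW hx, map_add]
  abel

theorem ad_neg_right (σ : JSec E M) {V : VField E M} {U : Set M} (hU : IsOpen U)
    (hV : V.SmoothOn U) {x : M} (hx : x ∈ U) : ad σ (-V) x = - ad σ V x := by
  simp only [ad, Pi.sub_apply, EndField.app, Pi.neg_apply]
  rw [lie_neg_right _ hU hV hx, map_neg]
  abel

theorem ad_sub_right (σ : JSec E M) {V W : VField E M} {U : Set M} (hU : IsOpen U)
    (hV : V.SmoothOn U) (hW : W.SmoothOn U) {x : M} (hx : x ∈ U) :
    ad σ (V - W) x = ad σ V x - ad σ W x := by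
  rw [sub_eq_add_neg, ad_add_right σ hU hV hW.neg hx, ad_neg_right σ hU hW hx, sub_eq_add_neg]

theorem vert_incl (φ : EndField E M) : vert (incl φ) = φ := by
  have h0 : anchor (incl φ) = 0 := rfl
  have h1 : chartDeriv (0 : VField E M) = 0 := by
    funext x
    have h := chartDeriv_add (V := (0 : VField E M)) (W := 0) (x := x)
      ((VField.SmoothOn.zero Set.univ).mdifferentiableAt isOpen_univ trivial)
      ((VField.SmoothOn.zero Set.univ).mdifferentiableAt isOpen_univ trivial)
    rw [add_zero] at h
    simpa using h
  funext x
  rw [vert, h0, h1]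
  simp [incl]

theorem ad_incl (φ : EndField E M) (V : VField E M) : ad (incl φ) V = - φ.app V := by
  have h0 : anchor (incl φ) = 0 := rfl
  funext x
  rw [ad, h0, vert_incl, lie, VectorField.mlieBracket_zero_left, zero_sub]

/-! ### The connection ∇^{L-C}: tensoriality of its torsion and curvature. -/

namespace InfinitesimalGStructure

variable {𝔤 : InfinitesimalGStructure E M} (t : 𝔤.Splitting)

namespace Splitting

variable {U : Set M} {V V' W W' Y Y' : VField E M}

theorem app_smoothOn (hU : IsOpen U) (hV : V.SmoothOn U) : (t.app V).SmoothOn U :=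
  (t.isSection U V hU hV).1

theorem anchor_app (V : VField E M) : anchor (t.app V) = V :=
  funext fun x => t.anchor_eq x (V x)

theorem leviCivita_smoothOn (hU : IsOpen U) (hV : V.SmoothOn U) (hW : W.SmoothOn U) :
    (t.leviCivita V W).SmoothOn U :=
  (t.app_smoothOn hU hV).ad hU hW

theorem leviCivita_apply (hU : IsOpen U) (hV : V.SmoothOn U) (hW : W.SmoothOn U) {x : M}
    (hx : x ∈ U) : t.leviCivita V W x = adAt (t.toFun x (V x)) W :=
  (t.app_smoothOn hU hV).ad_apply hU hW hx

theorem leviCivita_congr (hU : IsOpen U) (hV : V.SmoothOn U) (hW : W.SmoothOn U)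
    (hV' : ∀ x ∈ U, V' x = V x) (hW' : ∀ x ∈ U, W' x = W x) {x : M}
    (hx : x ∈ U) : t.leviCivita V' W' x = t.leviCivita V W x := by
  rw [t.leviCivita_apply hU hV hW hx, t.leviCivita_apply hU (hV.congr hV') (hW.congr hW') hx,
    adAt_congr _ hU hW' hx, hV' x hx]

theorem leviCivita_add_left (hU : IsOpen U) (hV : V.SmoothOn U) (hV' : V'.SmoothOn U)
    (hW : W.SmoothOn U) {x : M} (hx : x ∈ U) :
    t.leviCivita (V + V') W x = t.leviCivita V W x + t.leviCivita V' W x := by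
  rw [t.leviCivita_apply hU hV hW hx, t.leviCivita_apply hU hV' hW hx,
    t.leviCivita_apply hU (hV.add hV') hW hx, Pi.add_apply, map_add, adAt_add_left]

theorem leviCivita_neg_left (hU : IsOpen U) (hV : V.SmoothOn U)
    (hW : W.SmoothOn U) {x : M} (hx : x ∈ U) :
    t.leviCivita (-V) W x = - t.leviCivita V W x := by
  have h := t.leviCivita_add_left hU hV hV.neg hW hx
  have h0 : t.leviCivita (V + -V) W x = 0 := by
    rw [add_neg_cancel, t.leviCivita_apply hU (VField.SmoothOn.zero U) hW hx, Pi.zero_apply,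
      map_zero, adAt_zero_left]
  rw [h0] at h
  exact (neg_eq_of_add_eq_zero_right h.symm).symm

theorem torsion_smoothOn (hU : IsOpen U) (hV : V.SmoothOn U) (hW : W.SmoothOn U) :
    (torsion t.leviCivita V W).SmoothOn U :=
  ((t.leviCivita_smoothOn hU hV hW).sub (t.leviCivita_smoothOn hU hW hV)).sub
    (VField.SmoothOn.lie hU hV hW)

/-- The derivatives of V and W cancel against those of the Lie bracket, leaving the endomorphism
part of the splitting. -/
theorem torsion_apply (hU : IsOpen U) (hV : V.SmoothOn U) (hW : W.SmoothOn U) {x : M}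
    (hx : x ∈ U) : torsion t.leviCivita V W x =
      (t.toFun x (W x)).2 (V x) - (t.toFun x (V x)).2 (W x) := by
  simp only [torsion, Pi.sub_apply]
  rw [t.leviCivita_apply hU hV hW hx, t.leviCivita_apply hU hW hV hx,
    lie_eq_chartDeriv (hV.mdifferentiableAt hU hx) (hW.mdifferentiableAt hU hx), adAt, adAt,
    t.anchor_eq, t.anchor_eq]
  abel

theorem torsion_congr (hU : IsOpen U) (hV : V.SmoothOn U) (hW : W.SmoothOn U)
    (hV' : V'.SmoothOn U) (hW' : W'.SmoothOn U) {x : M} (hx : x ∈ U) (h : V' x = V x)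
    (h' : W' x = W x) :
    torsion t.leviCivita V' W' x = torsion t.leviCivita V W x := by
  rw [t.torsion_apply hU hV hW hx, t.torsion_apply hU hV' hW' hx, h, h']

theorem torsion_add_left (hU : IsOpen U) (hV : V.SmoothOn U) (hV' : V'.SmoothOn U)
    (hW : W.SmoothOn U) {x : M} (hx : x ∈ U) :
    torsion t.leviCivita (V + V') W x =
      torsion t.leviCivita V W x + torsion t.leviCivita V' W x := by
  rw [t.torsion_apply hU hV hW hx, t.torsion_apply hU hV' hW hx,
    t.torsion_apply hU (hV.add hV') hW hx]
  simp only [Pi.add_apply, map_add, Prod.snd_add, _root_.add_apply]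
  abel

theorem torsion_swap (hU : IsOpen U) (hV : V.SmoothOn U) (hW : W.SmoothOn U) {x : M}
    (hx : x ∈ U) : torsion t.leviCivita V W x = - torsion t.leviCivita W V x := by
  rw [t.torsion_apply hU hV hW hx, t.torsion_apply hU hW hV hx]
  abel

theorem torsion_add_right (hU : IsOpen U) (hV : V.SmoothOn U) (hW : W.SmoothOn U)
    (hW' : W'.SmoothOn U) {x : M} (hx : x ∈ U) :
    torsion t.leviCivita V (W + W') x =
      torsion t.leviCivita V W x + torsion t.leviCivita V W' x := by
  rw [t.torsion_swap hU hV (hW.add hW') hx, t.torsion_add_left hU hW hW' hV hx,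
    t.torsion_swap hU hV hW hx, t.torsion_swap hU hV hW' hx, neg_add]

theorem torsion_neg_left (hU : IsOpen U) (hV : V.SmoothOn U) (hW : W.SmoothOn U) {x : M}
    (hx : x ∈ U) : torsion t.leviCivita (-V) W x = - torsion t.leviCivita V W x := by
  rw [t.torsion_apply hU hV hW hx, t.torsion_apply hU hV.neg hW hx]
  simp only [Pi.neg_apply, map_neg, Prod.snd_neg, _root_.neg_apply]
  abel

theorem torsion_neg_right (hU : IsOpen U) (hV : V.SmoothOn U) (hW : W.SmoothOn U) {x : M}
    (hx : x ∈ U) : torsion t.leviCivita V (-W) x = - torsion t.leviCivita V W x := by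
  rw [t.torsion_swap hU hV hW.neg hx, t.torsion_neg_left hU hW hV hx,
    t.torsion_swap hU hV hW hx]

theorem curvature_smoothOn (hU : IsOpen U) (hV : V.SmoothOn U) (hW : W.SmoothOn U)
    (hY : Y.SmoothOn U) : (curvature t.leviCivita V W Y).SmoothOn U :=
  ((t.leviCivita_smoothOn hU hV (t.leviCivita_smoothOn hU hW hY)).sub
    (t.leviCivita_smoothOn hU hW (t.leviCivita_smoothOn hU hV hY))).sub
    (t.leviCivita_smoothOn hU (VField.SmoothOn.lie hU hV hW) hY)

theorem curvature_swap (hU : IsOpen U) (hV : V.SmoothOn U) (hW : W.SmoothOn U)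
    (hY : Y.SmoothOn U) {x : M} (hx : x ∈ U) :
    curvature t.leviCivita V W Y x = - curvature t.leviCivita W V Y x := by
  have h := t.leviCivita_congr hU (VField.SmoothOn.lie hU hW hV).neg hY
    (V' := lie V W) (fun y _ => lie_swap V W y) (fun _ _ => rfl) hx
  rw [t.leviCivita_neg_left hU (VField.SmoothOn.lie hU hW hV) hY hx] at h
  simp only [curvature, Pi.sub_apply, h]
  abel

theorem curvature_add_left (hU : IsOpen U) (hV : V.SmoothOn U) (hV' : V'.SmoothOn U)
    (hW : W.SmoothOn U) (hY : Y.SmoothOn U) {x : M} (hx : x ∈ U) :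
    curvature t.leviCivita (V + V') W Y x =
      curvature t.leviCivita V W Y x + curvature t.leviCivita V' W Y x := by
  have hl := VField.SmoothOn.lie hU hV hW
  have hl' := VField.SmoothOn.lie hU hV' hW
  have h1 := t.leviCivita_congr hU (hl.add hl') hY (V' := lie (V + V') W)
    (fun y hy => lie_add_left W hU hV hV' hy) (fun _ _ => rfl) hx
  rw [t.leviCivita_add_left hU hl hl' hY hx] at h1
  have h2 := t.leviCivita_congr hU hW ((t.leviCivita_smoothOn hU hV hY).add
    (t.leviCivita_smoothOn hU hV' hY)) (W' := t.leviCivita (V + V') Y) (fun _ _ => rfl)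
    (fun y hy => t.leviCivita_add_left hU hV hV' hY hy) hx
  have h3 := ad_add_right (t.app W) hU (t.leviCivita_smoothOn hU hV hY)
    (t.leviCivita_smoothOn hU hV' hY) hx
  have h4 := h2.trans h3
  simp only [curvature, Pi.sub_apply, h1, h4,
    t.leviCivita_add_left hU hV hV' (t.leviCivita_smoothOn hU hW hY) hx]
  simp only [leviCivita]
  abel

theorem curvature_neg_left (hU : IsOpen U) (hV : V.SmoothOn U)
    (hW : W.SmoothOn U) (hY : Y.SmoothOn U) {x : M} (hx : x ∈ U) :
    curvature t.leviCivita (-V) W Y x = - curvature t.leviCivita V W Y x := by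
  have hl := VField.SmoothOn.lie hU hV hW
  have h1 := t.leviCivita_congr hU hl.neg hY (V' := lie (-V) W)
    (fun y hy => lie_neg_left W hU hV hy) (fun _ _ => rfl) hx
  rw [t.leviCivita_neg_left hU hl hY hx] at h1
  have h2 := t.leviCivita_congr hU hW (t.leviCivita_smoothOn hU hV hY).neg
    (W' := t.leviCivita (-V) Y) (fun _ _ => rfl)
    (fun y hy => t.leviCivita_neg_left hU hV hY hy) hx
  have h4 := h2.trans (ad_neg_right (t.app W) hU (t.leviCivita_smoothOn hU hV hY) hx)
  simp only [curvature, Pi.sub_apply, h1, h4,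
    t.leviCivita_neg_left hU hV (t.leviCivita_smoothOn hU hW hY) hx]
  simp only [leviCivita]
  abel

/-- The curvature is the action of a section of `𝔥`. -/
theorem curvature_apply (hU : IsOpen U) (hV : V.SmoothOn U) (hW : W.SmoothOn U)
    (hY : Y.SmoothOn U) {x : M} (hx : x ∈ U) :
    curvature t.leviCivita V W Y x =
      - (bracket (t.app V) (t.app W) x - t.toFun x (lie V W x)).2 (Y x) := by
  have hb := JSec.SmoothOn.bracket hU (t.app_smoothOn hU hV) (t.app_smoothOn hU hW)
  have h1 : curvature t.leviCivita V W Y x =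
      adAt (bracket (t.app V) (t.app W) x - t.toFun x (lie V W x)) Y := by
    rw [adAt_sub_left, ← hb.ad_apply hU hY hx,
      ad_bracket hU (t.app_smoothOn hU hV) (t.app_smoothOn hU hW) hY hx,
      ← t.leviCivita_apply hU (VField.SmoothOn.lie hU hV hW) hY hx]
    rfl
  have h2 : (bracket (t.app V) (t.app W) x - t.toFun x (lie V W x)).1 = 0 := by
    have := congrFun (anchor_bracket (t.app V) (t.app W)) x
    rw [t.anchor_app, t.anchor_app] at this
    rw [Prod.fst_sub, t.anchor_eq]
    exact sub_eq_zero.2 this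
  rw [h1, adAt, h2, map_zero, zero_sub]

/-- With Y fixed, Z ↦ D_Z Y is an endomorphism field φ. When V vanishes at x, the curvature there is
-([W, φV] + φ[V, W]) = -(κ_W φ)V, which vanishes because κ_W φ is tensorial. -/
theorem curvature_eq_zero (hU : IsOpen U) (hV : V.SmoothOn U)
    (hW : W.SmoothOn U) (hY : Y.SmoothOn U) {x : M} (hx : x ∈ U) (h0 : V x = 0) :
    curvature t.leviCivita V W Y x = 0 := by
  let ev : E → (E →L[ℝ] E) →L[ℝ] E := fun v => ContinuousLinearMap.apply ℝ E v
  let T : M → E →L[ℝ] E × (E →L[ℝ] E) := fun y => t.toFun y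
  let C : M → E →L[ℝ] E := fun y => chartDeriv Y y
  let ψ : M → E →L[ℝ] E := fun y =>
    (C y).comp ((ContinuousLinearMap.fst ℝ E (E →L[ℝ] E)).comp (T y)) -
      (ev (Y y)).comp ((ContinuousLinearMap.snd ℝ E (E →L[ℝ] E)).comp (T y))
  let φ : EndField E M := fun y => ψ y
  have happ : ∀ (Z : VField E M) (y : M), φ.app Z y = adAt (t.toFun y (Z y)) Y := fun _ _ => rfl
  have hφ : φ.SmoothOn U := EndField.smoothOn_of_app hU fun U' Z hU' hUU hZ =>
    (t.leviCivita_smoothOn hU' hZ (hY.mono hUU)).congr fun y hy => by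
      rw [happ, t.leviCivita_apply hU' hZ (hY.mono hUU) hy]
  have e1 : t.leviCivita V (t.leviCivita W Y) x = 0 := by
    rw [t.leviCivita_apply hU hV (t.leviCivita_smoothOn hU hW hY) hx, h0, map_zero,
      adAt_zero_left]
  have e2 : t.leviCivita W (t.leviCivita V Y) x = lie W (φ.app V) x := by
    rw [t.leviCivita_congr hU hW (hφ.app hV) (V' := W) (W' := t.leviCivita V Y) (fun _ _ => rfl)
      (fun y hy => by rw [happ, t.leviCivita_apply hU hV hY hy]) hx]
    have hz : φ.app V x = 0 := by rw [happ, h0, map_zero, adAt_zero_left]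
    rw [leviCivita, ad, Pi.sub_apply, t.anchor_app, EndField.app, hz, map_zero, sub_zero]
  have e3 : t.leviCivita (lie V W) Y x = φ x (lie V W x) := by
    rw [t.leviCivita_apply hU (VField.SmoothOn.lie hU hV hW) hY hx]
    rfl
  have e4 := kappa_apply (X := W) hU hφ hV hx
  rw [h0, map_zero] at e4
  simp only [curvature, Pi.sub_apply]
  rw [e1, e2, e3, zero_sub, ← neg_add', ← e4, neg_zero]

theorem curvature_congr_left (hU : IsOpen U) (hV : V.SmoothOn U) (hV' : V'.SmoothOn U)
    (hW : W.SmoothOn U) (hY : Y.SmoothOn U) {x : M} (hx : x ∈ U) (h : V' x = V x) :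
    curvature t.leviCivita V' W Y x = curvature t.leviCivita V W Y x := by
  have h1 := t.curvature_eq_zero hU (hV'.add hV.neg) hW hY hx
    (by rw [Pi.add_apply, h, Pi.neg_apply, add_neg_cancel])
  rw [t.curvature_add_left hU hV' hV.neg hW hY hx, t.curvature_neg_left hU hV hW hY hx,
    ← sub_eq_add_neg] at h1
  exact sub_eq_zero.1 h1

/-- Pointwise dependence in the first slot comes from `curvature_eq_zero`, in the second by
antisymmetry, and in the third from the endomorphism formula `curvature_apply`. -/
theorem curvature_congr (hU : IsOpen U) (hV : V.SmoothOn U) (hV' : V'.SmoothOn U)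
    (hW : W.SmoothOn U) (hW' : W'.SmoothOn U) (hY : Y.SmoothOn U) (hY' : Y'.SmoothOn U) {x : M}
    (hx : x ∈ U) (h : V' x = V x) (h' : W' x = W x) (h'' : Y' x = Y x) :
    curvature t.leviCivita V' W' Y' x = curvature t.leviCivita V W Y x := by
  rw [t.curvature_congr_left hU hV hV' hW' hY' hx h, t.curvature_swap hU hV hW' hY' hx,
    t.curvature_congr_left hU hW hW' hV hY' hx h', ← t.curvature_swap hU hV hW hY' hx,
    t.curvature_apply hU hV hW hY' hx, t.curvature_apply hU hV hW hY hx, h'']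

theorem curvature_add_middle (hU : IsOpen U) (hV : V.SmoothOn U) (hW : W.SmoothOn U)
    (hW' : W'.SmoothOn U) (hY : Y.SmoothOn U) {x : M} (hx : x ∈ U) :
    curvature t.leviCivita V (W + W') Y x =
      curvature t.leviCivita V W Y x + curvature t.leviCivita V W' Y x := by
  rw [t.curvature_swap hU hV (hW.add hW') hY hx, t.curvature_add_left hU hW hW' hV hY hx,
    t.curvature_swap hU hV hW hY hx, t.curvature_swap hU hV hW' hY hx, neg_add]

theorem curvature_neg_middle (hU : IsOpen U) (hV : V.SmoothOn U) (hW : W.SmoothOn U)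
    (hY : Y.SmoothOn U) {x : M} (hx : x ∈ U) :
    curvature t.leviCivita V (-W) Y x = - curvature t.leviCivita V W Y x := by
  rw [t.curvature_swap hU hV hW.neg hY hx, t.curvature_neg_left hU hW hV hY hx,
    t.curvature_swap hU hV hW hY hx]

theorem curvature_add_right (hU : IsOpen U) (hV : V.SmoothOn U) (hW : W.SmoothOn U)
    (hY : Y.SmoothOn U) (hY' : Y'.SmoothOn U) {x : M} (hx : x ∈ U) :
    curvature t.leviCivita V W (Y + Y') x =
      curvature t.leviCivita V W Y x + curvature t.leviCivita V W Y' x := by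
  rw [t.curvature_apply hU hV hW hY hx, t.curvature_apply hU hV hW hY' hx,
    t.curvature_apply hU hV hW (hY.add hY') hx, Pi.add_apply, map_add, neg_add]

theorem curvature_neg_right (hU : IsOpen U) (hV : V.SmoothOn U) (hW : W.SmoothOn U)
    (hY : Y.SmoothOn U) {x : M} (hx : x ∈ U) :
    curvature t.leviCivita V W (-Y) x = - curvature t.leviCivita V W Y x := by
  rw [t.curvature_apply hU hV hW hY hx, t.curvature_apply hU hV hW hY.neg hx, Pi.neg_apply,
    map_neg]

end Splitting

end InfinitesimalGStructure

/-! ### The Cartan connection expressed through ad, and its curvature. -/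

namespace InfinitesimalGStructure

variable {𝔤 : InfinitesimalGStructure E M} {U U' : Set M} {σ τ : JSec E M}

namespace IsSection

theorem mono (h : 𝔤.IsSection U σ) (hU : U' ⊆ U) : 𝔤.IsSection U' σ :=
  ⟨h.1.mono hU, fun x hx => h.2 x (hU hx)⟩

theorem congr (hU : IsOpen U) (h : 𝔤.IsSection U σ) (hτ : ∀ x ∈ U, τ x = σ x) :
    𝔤.IsSection U τ :=
  ⟨h.1.congr hU hτ, fun x hx => by rw [hτ x hx]; exact h.2 x hx⟩

theorem zero (hU : IsOpen U) : 𝔤.IsSection U 0 :=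
  ⟨JSec.SmoothOn.zero hU, fun x _ => (𝔤.fiber x).zero_mem⟩

theorem sub (hU : IsOpen U) (hσ : 𝔤.IsSection U σ) (hτ : 𝔤.IsSection U τ) :
    𝔤.IsSection U (σ - τ) :=
  ⟨hσ.1.sub hU hτ.1, fun x hx => (𝔤.fiber x).sub_mem (hσ.2 x hx) (hτ.2 x hx)⟩

theorem smul (hU : IsOpen U) {f : M → ℝ} (hf : FunSmoothOn E f U) (hσ : 𝔤.IsSection U σ) :
    𝔤.IsSection U (fun x => f x • σ x) :=
  ⟨hσ.1.smul hU hf, fun x hx => (𝔤.fiber x).smul_mem _ (hσ.2 x hx)⟩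

theorem sum (hU : IsOpen U) {ι : Type*} (s : Finset ι) {σ : ι → JSec E M}
    (h : ∀ i ∈ s, 𝔤.IsSection U (σ i)) : 𝔤.IsSection U (fun x => ∑ i ∈ s, σ i x) :=
  ⟨JSec.SmoothOn.sum hU s fun i hi => (h i hi).1,
    fun x hx => (𝔤.fiber x).sum_mem fun i hi => (h i hi).2 x hx⟩

theorem bracket (hU : IsOpen U) (hσ : 𝔤.IsSection U σ) (hτ : 𝔤.IsSection U τ) :
    𝔤.IsSection U (bracket σ τ) :=
  ⟨JSec.SmoothOn.bracket hU hσ.1 hτ.1, 𝔤.bracket_mem U σ τ hU hσ.1 hτ.1 hσ.2 hτ.2⟩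

end IsSection

theorem Splitting.app_isSection (t : 𝔤.Splitting) (hU : IsOpen U) {V : VField E M}
    (hV : V.SmoothOn U) : 𝔤.IsSection U (t.app V) :=
  t.isSection U V hU hV

namespace Connection

variable (nabla : 𝔤.Connection)

theorem toFun_smul_apply (hU : IsOpen U) {f : M → ℝ} (hf : FunSmoothOn E f U)
    (hσ : 𝔤.IsSection U σ) {x : M} (hx : x ∈ U) (v : TangentSpace 𝓘(ℝ, E) x) :
    nabla.toFun (fun y => f y • σ y) x v = f x • nabla.toFun σ x v + dFun E f x v • σ x :=
  DFunLike.congr_fun (nabla.leibniz U f σ hU hf hσ x hx) v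

theorem toFun_add_apply (hU : IsOpen U) (hσ : 𝔤.IsSection U σ) (hτ : 𝔤.IsSection U τ) {x : M}
    (hx : x ∈ U) (v : TangentSpace 𝓘(ℝ, E) x) :
    nabla.toFun (σ + τ) x v = nabla.toFun σ x v + nabla.toFun τ x v :=
  DFunLike.congr_fun (nabla.add U σ τ hU hσ hτ x hx) v

/-- Locality of ∇. Multiplying by the indicator of the complement of U leaves σ unchanged
everywhere, while the indicator is smooth on U, being 0 there; the Leibniz rule then gives ∇σ = 0 on
U. -/
theorem toFun_apply_eq_zero (hU : IsOpen U) (h : ∀ x ∈ U, σ x = 0) {x : M} (hx : x ∈ U)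
    (v : TangentSpace 𝓘(ℝ, E) x) : nabla.toFun σ x v = 0 := by
  have hσ : 𝔤.IsSection U σ := (IsSection.zero hU).congr hU h
  have hf : FunSmoothOn E (Uᶜ.indicator (fun _ => (1 : ℝ))) U :=
    (contMDiffOn_const (c := (0 : ℝ))).congr fun y hy => by simp [hy]
  have e : (fun y => Uᶜ.indicator (fun _ => (1 : ℝ)) y • σ y) = σ := by
    funext y
    by_cases hy : y ∈ U
    · simp [h y hy]
    · simp [hy]
  have h1 := nabla.toFun_smul_apply hU hf hσ hx v
  rw [e, h x hx, smul_zero, add_zero] at h1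
  rw [h1, Set.indicator_of_notMem (not_not.2 hx), zero_smul]

theorem toFun_congr_apply (hU : IsOpen U) (hσ : 𝔤.IsSection U σ) (h : ∀ x ∈ U, τ x = σ x) {x : M}
    (hx : x ∈ U) (v : TangentSpace 𝓘(ℝ, E) x) : nabla.toFun τ x v = nabla.toFun σ x v := by
  have hτ := hσ.congr hU h
  have h1 := nabla.toFun_add_apply hU hσ (hτ.sub hU hσ) hx v
  rw [nabla.toFun_apply_eq_zero (σ := τ - σ) hU (fun y hy => sub_eq_zero.2 (h y hy)) hx,
    add_sub_cancel, add_zero] at h1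
  exact h1

theorem cov_isSection (hU : IsOpen U) {V : VField E M} (hV : V.SmoothOn U)
    (hσ : 𝔤.IsSection U σ) : 𝔤.IsSection U (nabla.cov V σ) :=
  nabla.isSection U σ V hU hσ hV

/-- Equivariance of t, solved for ∇: the anchor of tV is V, and the representation on TM is ad. -/
theorem cov_eq (t : 𝔤.Splitting) (hbar : nabla.BarEqAd) (ht : nabla.IsReductiveWith t)
    (hU : IsOpen U) (hσ : 𝔤.IsSection U σ) {V : VField E M} (hV : V.SmoothOn U) {x : M}
    (hx : x ∈ U) :
    nabla.cov V σ x = t.toFun x (ad σ V x) - bracket σ (t.app V) x := by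
  have h := ht U σ V hU hσ hV x hx
  rw [barSelf, t.anchor_app, Splitting.app, hbar U σ V hU hσ hV x hx] at h
  exact eq_sub_of_add_eq h

/-- Apply ad to `cov_eq` and expand the bracket as a commutator. The result says that ∇_V σ acts as
minus the derivative of the connection D along σ. -/
theorem ad_cov (t : 𝔤.Splitting) (hbar : nabla.BarEqAd) (ht : nabla.IsReductiveWith t)
    (hU : IsOpen U) (hσ : 𝔤.IsSection U σ) {V W : VField E M} (hV : V.SmoothOn U)
    (hW : W.SmoothOn U) {x : M} (hx : x ∈ U) :
    ad (nabla.cov V σ) W x = t.leviCivita V (ad σ W) x - ad σ (t.leviCivita V W) x +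
      t.leviCivita (ad σ V) W x := by
  have htV := t.app_smoothOn hU hV
  rw [(nabla.cov_isSection hU hV hσ).1.ad_apply hU hW hx,
    nabla.cov_eq t hbar ht hU hσ hV hx, adAt_sub_left,
    ← (JSec.SmoothOn.bracket hU hσ.1 htV).ad_apply hU hW hx, ad_bracket hU hσ.1 htV hW hx,
    t.leviCivita_apply hU (hσ.1.ad hU hV) hW hx]
  simp only [Splitting.leviCivita]
  abel

end Connection

namespace Splitting

variable (t : 𝔤.Splitting)

theorem leviCivita_add_right (hU : IsOpen U) {V W W' : VField E M} (hW : W.SmoothOn U)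
    (hW' : W'.SmoothOn U) {x : M} (hx : x ∈ U) :
    t.leviCivita V (W + W') x = t.leviCivita V W x + t.leviCivita V W' x :=
  ad_add_right (t.app V) hU hW hW' hx

theorem leviCivita_neg_right (hU : IsOpen U) {V W : VField E M} (hW : W.SmoothOn U) {x : M}
    (hx : x ∈ U) : t.leviCivita V (-W) x = - t.leviCivita V W x :=
  ad_neg_right (t.app V) hU hW hx

/-- The torsion of `∇^{L-C}` is annihilated by the sections of `𝔤`. -/
def PreservesTorsion : Prop :=
  ∀ (U : Set M) (X : JSec E M) (V W : VField E M), IsOpen U → 𝔤.IsSection U X →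
    V.SmoothOn U → W.SmoothOn U → ∀ x ∈ U, ad X (torsion t.leviCivita V W) x =
      torsion t.leviCivita (ad X V) W x + torsion t.leviCivita V (ad X W) x

/-- The curvature of `∇^{L-C}` is annihilated by the sections of `𝔤`. -/
def PreservesCurvature : Prop :=
  ∀ (U : Set M) (X : JSec E M) (V W Y : VField E M), IsOpen U → 𝔤.IsSection U X →
    V.SmoothOn U → W.SmoothOn U → Y.SmoothOn U → ∀ x ∈ U,
      ad X (curvature t.leviCivita V W Y) x =
      curvature t.leviCivita (ad X V) W Y x + curvature t.leviCivita V (ad X W) Y x +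
        curvature t.leviCivita V W (ad X Y) x

end Splitting

namespace Connection

variable (nabla : 𝔤.Connection)

/-- `ad_cov` for the section ∇_W σ, and again for each action of ∇_W σ that appears. The inner
identity must hold on all of U because D_V differentiates it. -/
theorem ad_cov_cov (t : 𝔤.Splitting) (hbar : nabla.BarEqAd) (ht : nabla.IsReductiveWith t)
    (hU : IsOpen U) (hσ : 𝔤.IsSection U σ) {V W Z : VField E M} (hV : V.SmoothOn U)
    (hW : W.SmoothOn U) (hZ : Z.SmoothOn U) {x : M} (hx : x ∈ U) :
    ad (nabla.cov V (nabla.cov W σ)) Z x =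
      t.leviCivita V (t.leviCivita W (ad σ Z)) x - t.leviCivita V (ad σ (t.leviCivita W Z)) x +
        t.leviCivita V (t.leviCivita (ad σ W) Z) x -
      (t.leviCivita W (ad σ (t.leviCivita V Z)) x - ad σ (t.leviCivita W (t.leviCivita V Z)) x +
        t.leviCivita (ad σ W) (t.leviCivita V Z) x) +
      (t.leviCivita (t.leviCivita W (ad σ V)) Z x - t.leviCivita (ad σ (t.leviCivita W V)) Z x +
        t.leviCivita (t.leviCivita (ad σ W) V) Z x) := by
  have hD : ∀ {V W : VField E M}, V.SmoothOn U → W.SmoothOn U → (t.leviCivita V W).SmoothOn U :=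
    fun hV hW => t.leviCivita_smoothOn hU hV hW
  have hA : ∀ {V : VField E M}, V.SmoothOn U → (ad σ V).SmoothOn U := fun hV => hσ.1.ad hU hV
  have hsm : ∀ {Z : VField E M}, Z.SmoothOn U → 
      (t.leviCivita W (ad σ Z) + -ad σ (t.leviCivita W Z) + t.leviCivita (ad σ W) Z).SmoothOn U :=
    fun hZ => ((hD hW (hA hZ)).add (hA (hD hW hZ)).neg).add (hD (hA hW) hZ)
  have hc : ∀ {Z : VField E M}, Z.SmoothOn U → ∀ y ∈ U, ad (nabla.cov W σ) Z y =
      (t.leviCivita W (ad σ Z) + -ad σ (t.leviCivita W Z) + t.leviCivita (ad σ W) Z) y :=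
    fun hZ y hy => by
      rw [nabla.ad_cov t hbar ht hU hσ hW hZ hy, sub_eq_add_neg]
      rfl
  rw [nabla.ad_cov t hbar ht hU (nabla.cov_isSection hU hW hσ) hV hZ hx,
    hc (hD hV hZ) x hx,
    t.leviCivita_congr hU hV (hsm hZ) (V' := V) (fun _ _ => rfl) (hc hZ) hx,
    t.leviCivita_congr hU (hsm hV) hZ (W' := Z) (hc hV) (fun _ _ => rfl) hx,
    t.leviCivita_add_left hU ((hD hW (hA hV)).add (hA (hD hW hV)).neg) (hD (hA hW) hV) hZ hx,
    t.leviCivita_add_left hU (hD hW (hA hV)) (hA (hD hW hV)).neg hZ hx,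
    t.leviCivita_neg_left hU (hA (hD hW hV)) hZ hx]
  have e : t.leviCivita V 
      (t.leviCivita W (ad σ Z) + -ad σ (t.leviCivita W Z) + t.leviCivita (ad σ W) Z) x =
      t.leviCivita V (t.leviCivita W (ad σ Z)) x - t.leviCivita V (ad σ (t.leviCivita W Z)) x +
        t.leviCivita V (t.leviCivita (ad σ W) Z) x := by
    rw [t.leviCivita_add_right hU ((hD hW (hA hZ)).add (hA (hD hW hZ)).neg) (hD (hA hW) hZ) hx,
      t.leviCivita_add_right hU (hD hW (hA hZ)) (hA (hD hW hZ)).neg hx,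
      t.leviCivita_neg_right hU (hA (hD hW hZ)) hx, ← sub_eq_add_neg]
  rw [e]
  simp only [Pi.add_apply, Pi.neg_apply]
  abel

/-- The connection is flat if the torsion and the curvature of `∇^{L-C}` are preserved. -/
theorem flat_of_preserves (t : 𝔤.Splitting) (hbar : nabla.BarEqAd) (ht : nabla.IsReductiveWith t)
    (hT : t.PreservesTorsion) (hR : t.PreservesCurvature)
    (hU : IsOpen U) (hσ : 𝔤.IsSection U σ) {V W : VField E M} (hV : V.SmoothOn U)
    (hW : W.SmoothOn U) {x : M} (hx : x ∈ U) :
    nabla.cov V (nabla.cov W σ) x - nabla.cov W (nabla.cov V σ) x - nabla.cov (lie V W) σ x = 0 := by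
  refine jet_ext fun Z hZ => ?_
  -- The test fields of `jet_ext` are smooth only on the chart domain of x; all data are local.
  wlog hUS : U ⊆ (chartAt E x).source generalizing U
  · exact this (U := U ∩ (chartAt E x).source) (hU.inter (chartAt E x).open_source)
      (hσ.mono Set.inter_subset_left) (hV.mono Set.inter_subset_left)
      (hW.mono Set.inter_subset_left) ⟨hx, mem_chart_source E x⟩ Set.inter_subset_right
  replace hZ := hZ.mono hUS
  have hL := VField.SmoothOn.lie hU hV hW
  have hD : ∀ {V W : VField E M}, V.SmoothOn U → W.SmoothOn U → (t.leviCivita V W).SmoothOn U :=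
    fun hV hW => t.leviCivita_smoothOn hU hV hW
  have hA : ∀ {V : VField E M}, V.SmoothOn U → (ad σ V).SmoothOn U := fun hV => hσ.1.ad hU hV
  have hs : ∀ {V W : VField E M}, V.SmoothOn U → W.SmoothOn U →
      (nabla.cov V (nabla.cov W σ)).SmoothOn U := fun hV hW =>
    (nabla.cov_isSection hU hV (nabla.cov_isSection hU hW hσ)).1
  rw [adAt_zero_left, adAt_sub_left, adAt_sub_left, ← (hs hV hW).ad_apply hU hZ hx,
    ← (hs hW hV).ad_apply hU hZ hx,
    ← (nabla.cov_isSection hU hL hσ).1.ad_apply hU hZ hx,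
    nabla.ad_cov_cov t hbar ht hU hσ hV hW hZ hx, nabla.ad_cov_cov t hbar ht hU hσ hW hV hZ hx,
    nabla.ad_cov t hbar ht hU hσ hL hZ hx]
  -- the two invariance conditions, expanded
  have h1 := hR U σ V W Z hU hσ hV hW hZ x hx
  have e1 : ad σ (curvature t.leviCivita V W Z) x =
      ad σ (t.leviCivita V (t.leviCivita W Z)) x - ad σ (t.leviCivita W (t.leviCivita V Z)) x -
        ad σ (t.leviCivita (lie V W) Z) x := by
    unfold curvature
    rw [ad_sub_right _ hU ((hD hV (hD hW hZ)).sub (hD hW (hD hV hZ))) (hD hL hZ) hx,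
      ad_sub_right _ hU (hD hV (hD hW hZ)) (hD hW (hD hV hZ)) hx]
  rw [e1] at h1
  have h2 : ∀ y ∈ U, ad σ (torsion t.leviCivita V W) y =
      (torsion t.leviCivita (ad σ V) W + torsion t.leviCivita V (ad σ W)) y :=
    fun y hy => hT U σ V W hU hσ hV hW y hy
  have e2 : ∀ y ∈ U, ad σ (torsion t.leviCivita V W) y =
      (ad σ (t.leviCivita V W) + -ad σ (t.leviCivita W V) + -ad σ (lie V W)) y := by
    intro y hy
    unfold torsion
    rw [ad_sub_right _ hU ((hD hV hW).sub (hD hW hV)) hL hy,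
      ad_sub_right _ hU (hD hV hW) (hD hW hV) hy, sub_eq_add_neg, sub_eq_add_neg]
    rfl
  have e3 : ∀ {V W : VField E M}, torsion t.leviCivita V W = 
      t.leviCivita V W + -t.leviCivita W V + -lie V W := fun {V W} => by
    rw [torsion, sub_eq_add_neg, sub_eq_add_neg]
  have hl1 := VField.SmoothOn.lie hU (hA hV) hW
  have hl2 := VField.SmoothOn.lie hU hV (hA hW)
  -- Invariance of the torsion enters only after being placed in the differentiating slot of D_( · )
  -- Z.
  have h3 := (t.leviCivita_congr hU (((hA (hD hV hW)).add (hA (hD hW hV)).neg).add (hA hL).neg) hZ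
    (W' := Z) (e2) (fun _ _ => rfl) hx).symm.trans
    (t.leviCivita_congr hU ((t.torsion_smoothOn hU (hA hV) hW).add
      (t.torsion_smoothOn hU hV (hA hW))) hZ (W' := Z) h2 (fun _ _ => rfl) hx)
  rw [t.leviCivita_add_left hU ((hA (hD hV hW)).add (hA (hD hW hV)).neg) (hA hL).neg hZ hx,
    t.leviCivita_add_left hU (hA (hD hV hW)) (hA (hD hW hV)).neg hZ hx,
    t.leviCivita_neg_left hU (hA (hD hW hV)) hZ hx, t.leviCivita_neg_left hU (hA hL) hZ hx,
    t.leviCivita_add_left hU (t.torsion_smoothOn hU (hA hV) hW)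
      (t.torsion_smoothOn hU hV (hA hW)) hZ hx, e3, e3,
    t.leviCivita_add_left hU ((hD (hA hV) hW).add (hD hW (hA hV)).neg) hl1.neg hZ hx,
    t.leviCivita_add_left hU (hD (hA hV) hW) (hD hW (hA hV)).neg hZ hx,
    t.leviCivita_neg_left hU (hD hW (hA hV)) hZ hx, t.leviCivita_neg_left hU hl1 hZ hx,
    t.leviCivita_add_left hU ((hD hV (hA hW)).add (hD (hA hW) hV).neg) hl2.neg hZ hx,
    t.leviCivita_add_left hU (hD hV (hA hW)) (hD (hA hW) hV).neg hZ hx,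
    t.leviCivita_neg_left hU (hD (hA hW) hV) hZ hx, t.leviCivita_neg_left hU hl2 hZ hx] at h3
  simp only [curvature, Pi.sub_apply] at h1
  rw [← sub_eq_zero] at h1 h3
  -- This is D_{(ad_σ T)(V,W)} Z - (ad_σ R)(V,W)Z = 0. Its left side is, after rearrangement, the
  -- action on Z of the curvature of ∇ at σ.
  have h4 := congrArg₂ (fun a b => b - a) h1 h3
  simp only [sub_zero] at h4
  refine Eq.trans ?_ h4
  abel

end Connection

end InfinitesimalGStructure

/-! ### Invariance under 𝔤 as 𝔥-invariance plus parallelism. -/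

namespace InfinitesimalGStructure

variable {𝔤 : InfinitesimalGStructure E M} {U : Set M}

theorem IsKernelSection.incl {φ : EndField E M} (hφ : 𝔤.IsKernelSection U φ) :
    𝔤.IsSection U (incl φ) :=
  ⟨⟨VField.SmoothOn.zero U, by rw [vert_incl]; exact hφ.1⟩, hφ.2⟩

namespace Splitting

variable (t : 𝔤.Splitting)

/-- X - t(#X) has zero anchor, so it is a section φ of 𝔥, and ad_φ = -φ. -/
theorem exists_kernelSection (hU : IsOpen U) {X : JSec E M} (hX : 𝔤.IsSection U X) :
    ∃ φ : EndField E M, 𝔤.IsKernelSection U φ ∧ ∀ V : VField E M, V.SmoothOn U → ∀ x ∈ U,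
      ad X V x = (t.leviCivita (anchor X) V + -φ.app V) x := by
  have htX := t.app_isSection hU hX.1.1
  let φ : EndField E M := fun y => (X y).2 - (t.toFun y (X y).1).2
  have hsub : X - t.app (anchor X) = incl φ := by
    funext y
    refine Prod.ext ?_ rfl
    exact sub_eq_zero.2 (t.anchor_eq y (X y).1).symm
  have hs := hX.sub hU htX
  rw [hsub] at hs
  refine ⟨φ, ⟨by simpa only [vert_incl] using hs.1.2, hs.2⟩, fun V hV x hx => ?_⟩
  rw [Pi.add_apply, ← ad_incl, leviCivita, hX.1.ad_apply hU hV hx, htX.1.ad_apply hU hV hx,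
    hs.1.ad_apply hU hV hx, ← adAt_add_left]
  congr 1
  rw [← hsub]
  exact (add_sub_cancel _ _).symm

/-- Sections of 𝔥 give invariance and sections tZ give parallelism, since ad_{tZ} = D_Z. Every
section of 𝔤 is a sum of these two kinds, and the condition is additive. -/
theorem preservesTorsion_iff : t.PreservesTorsion ↔
    𝔤.IsKernelInvariant₂ (torsion t.leviCivita) ∧
      IsParallel₂ t.leviCivita (torsion t.leviCivita) := by
  constructor
  · intro h
    refine ⟨fun U φ V W hU hφ hV hW x hx => ?_, fun U Z V W hU hZ hV hW x hx => ?_⟩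
    · have h1 := h U (incl φ) V W hU hφ.incl hV hW x hx
      rw [ad_incl, ad_incl, ad_incl, t.torsion_neg_left hU (hφ.1.app hV) hW hx,
        t.torsion_neg_right hU hV (hφ.1.app hW) hx] at h1
      simp only [Pi.sub_apply, Pi.neg_apply] at h1 ⊢
      rw [neg_eq_iff_eq_neg] at h1
      rw [h1]
      abel
    · have h1 := h U (t.app Z) V W hU (t.app_isSection hU hZ) hV hW x hx
      simp only [Pi.sub_apply]
      rw [leviCivita, h1]
      simp only [leviCivita]
      abel
  · rintro ⟨hk, hp⟩ U X V W hU hX hV hW x hx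
    obtain ⟨φ, hφ, had⟩ := t.exists_kernelSection hU hX
    have hZ := hX.1.1
    have hT := t.torsion_smoothOn hU hV hW
    have hDV := t.leviCivita_smoothOn hU hZ hV
    have hDW := t.leviCivita_smoothOn hU hZ hW
    have hφV := hφ.1.app hV
    have hφW := hφ.1.app hW
    have h1 := hk U φ V W hU hφ hV hW x hx
    have h2 := hp U (anchor X) V W hU hZ hV hW x hx
    rw [had _ hT x hx, t.torsion_congr hU (hDV.add hφV.neg) hW (hX.1.ad hU hV) hW hx
      (had V hV x hx) rfl, t.torsion_congr hU hV (hDW.add hφW.neg) hV (hX.1.ad hU hW) hx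
      rfl (had W hW x hx), t.torsion_add_left hU hDV hφV.neg hW hx,
      t.torsion_neg_left hU hφV hW hx, t.torsion_add_right hU hV hDW hφW.neg hx,
      t.torsion_neg_right hU hV hφW hx]
    simp only [Pi.add_apply, Pi.sub_apply, Pi.neg_apply] at h1 h2 ⊢
    rw [← sub_eq_zero]
    refine Eq.trans ?_ ((congrArg₂ (fun a b => a - b) h2 h1).trans (sub_zero 0))
    abel

theorem preservesCurvature_iff : t.PreservesCurvature ↔
    𝔤.IsKernelInvariant₃ (curvature t.leviCivita) ∧
      IsParallel₃ t.leviCivita (curvature t.leviCivita) := by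
  constructor
  · intro h
    refine ⟨fun U φ V W Y hU hφ hV hW hY x hx => ?_, fun U Z V W Y hU hZ hV hW hY x hx => ?_⟩
    · have h1 := h U (incl φ) V W Y hU hφ.incl hV hW hY x hx
      rw [ad_incl, ad_incl, ad_incl, ad_incl, t.curvature_neg_left hU (hφ.1.app hV) hW hY hx,
        t.curvature_neg_middle hU hV (hφ.1.app hW) hY hx,
        t.curvature_neg_right hU hV hW (hφ.1.app hY) hx] at h1
      simp only [Pi.sub_apply, Pi.neg_apply] at h1 ⊢
      rw [neg_eq_iff_eq_neg] at h1
      rw [h1]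
      abel
    · have h1 := h U (t.app Z) V W Y hU (t.app_isSection hU hZ) hV hW hY x hx
      simp only [Pi.sub_apply]
      rw [leviCivita, h1]
      simp only [leviCivita]
      abel
  · rintro ⟨hk, hp⟩ U X V W Y hU hX hV hW hY x hx
    obtain ⟨φ, hφ, had⟩ := t.exists_kernelSection hU hX
    have hZ := hX.1.1
    have hR := t.curvature_smoothOn hU hV hW hY
    have hDV := t.leviCivita_smoothOn hU hZ hV
    have hDW := t.leviCivita_smoothOn hU hZ hW
    have hDY := t.leviCivita_smoothOn hU hZ hY
    have hφV := hφ.1.app hV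
    have hφW := hφ.1.app hW
    have hφY := hφ.1.app hY
    have h1 := hk U φ V W Y hU hφ hV hW hY x hx
    have h2 := hp U (anchor X) V W Y hU hZ hV hW hY x hx
    rw [had _ hR x hx,
      t.curvature_congr hU (hDV.add hφV.neg) (hX.1.ad hU hV) hW hW hY hY hx
        (had V hV x hx) rfl rfl,
      t.curvature_congr hU hV hV (hDW.add hφW.neg) (hX.1.ad hU hW) hY hY hx
        rfl (had W hW x hx) rfl,
      t.curvature_congr hU hV hV hW hW (hDY.add hφY.neg) (hX.1.ad hU hY) hx
        rfl rfl (had Y hY x hx),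
      t.curvature_add_left hU hDV hφV.neg hW hY hx, t.curvature_neg_left hU hφV hW hY hx,
      t.curvature_add_middle hU hV hDW hφW.neg hY hx, t.curvature_neg_middle hU hV hφW hY hx,
      t.curvature_add_right hU hV hW hDY hφY.neg hx, t.curvature_neg_right hU hV hW hφY hx]
    simp only [Pi.add_apply, Pi.sub_apply, Pi.neg_apply] at h1 h2 ⊢
    rw [← sub_eq_zero]
    refine Eq.trans ?_ ((congrArg₂ (fun a b => a - b) h2 h1).trans (sub_zero 0))
    abel

end Splitting

end InfinitesimalGStructure

/-! ### Local symmetry implies invariance. -/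

theorem VField.exists_smoothOn_univ [T2Space M] (x : M) (v : TangentSpace 𝓘(ℝ, E) x) :
    ∃ V : VField E M, V.SmoothOn Set.univ ∧ V x = v := by
  obtain ⟨f, -⟩ := (SmoothBumpFunction.nhds_basis_tsupport (I := 𝓘(ℝ, E)) x).ex_mem
  refine ⟨fun y => f y • coordField x (coord x x v) y, ?_, ?_⟩
  · intro y _
    refine ContMDiffAt.contMDiffWithinAt ?_
    by_cases hy : y ∈ tsupport f
    · have hy' := f.tsupport_subset_chartAt_source hy
      exact (VField.SmoothOn.smul f.contMDiff.contMDiffOn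
        (smoothOn_coordField x _)).contMDiffAt (chartAt E x).open_source hy'
    · have hz : VField.SmoothOn (fun y => f y • coordField x (coord x x v) y) (tsupport f)ᶜ :=
        (VField.SmoothOn.zero _).congr fun z hz => by
          rw [image_eq_zero_of_notMem_tsupport hz, zero_smul, Pi.zero_apply]
      exact hz.contMDiffAt (isClosed_tsupport f).isOpen_compl hy
  · have h1 : f x = 1 := f.eq_one
    show f x • coordField x (coord x x v) x = v
    rw [h1, one_smul, coordField_coord (mem_chart_source E x)]

theorem flatCov_const {L : Type*} [AddCommGroup L] [Module ℝ L] [FiniteDimensional ℝ L]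
    (V : VField E M) (ξ : L) : flatCov V (fun _ : M => ξ) = 0 := by
  funext x
  refine Finset.sum_eq_zero fun i _ => ?_
  have h : dFun E (fun _ : M => (Module.finBasis ℝ L).repr ξ i) x = 0 := mfderiv_const
  rw [h]
  simp

namespace InfinitesimalGStructure

variable {𝔤 : InfinitesimalGStructure E M} {U : Set M}

namespace Connection

variable (nabla : 𝔤.Connection)

/-- The section `σ` is parallel on `U`. -/
def IsParallelOn (σ : JSec E M) (U : Set M) : Prop :=
  ∀ x ∈ U, ∀ v : TangentSpace 𝓘(ℝ, E) x, nabla.toFun σ x v = 0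

variable {nabla}

/-- Constant sections of the action algebroid are parallel for the flat connection and take every
value in the fibre; the isomorphism carries them to 𝔤. -/
theorem IsSymmetricOn.exists_isParallelOn [T2Space M] (h : nabla.IsSymmetricOn U)
    {x : M} (hx : x ∈ U) {j : Jet E x} (hj : j ∈ 𝔤.fiber x) :
    ∃ e : JSec E M, 𝔤.IsSection U e ∧ nabla.IsParallelOn e U ∧ e x = j := by
  obtain ⟨𝔤₀, _, _, _, a, ⟨Φ⟩⟩ := h
  rw [← Φ.range_eq x hx] at hj
  obtain ⟨ξ, rfl⟩ := hj
  have hξ : TrivSmoothOn E (fun _ : M => ξ) U := fun ℓ => contMDiffOn_const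
  refine ⟨fun y => Φ.toFun y ξ, ⟨Φ.smooth _ hξ, fun y hy => ?_⟩, fun y hy v => ?_, rfl⟩
  · rw [← Φ.range_eq y hy]
    exact ⟨ξ, rfl⟩
  -- Compatibility with the connections is stated for vector fields, so the tangent vector is first
  -- extended to one.
  · obtain ⟨V, hV, rfl⟩ := VField.exists_smoothOn_univ y v
    have h1 := Φ.map_cov V _ (hV.mono (Set.subset_univ U)) hξ y hy
    rw [flatCov_const, Pi.zero_apply, map_zero] at h1
    exact h1.symm

section Parallel

variable {e : JSec E M} {V W Y : VField E M}

/-- The term #∇_V e of ∇̄_e V vanishes, and ∇̄ = ad. -/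
theorem IsParallelOn.ad_eq_lie (hU : IsOpen U) (he : 𝔤.IsSection U e)
    (hp : nabla.IsParallelOn e U) (hbar : nabla.BarEqAd) (hV : V.SmoothOn U) {x : M} (hx : x ∈ U) :
    ad e V x = lie (anchor e) V x := by
  have h := hbar U e V hU he hV x hx
  rw [barTM, Pi.add_apply] at h
  rw [← h, anchor, cov, hp x hx, Prod.fst_zero, zero_add]

/-- The left side of `ad_cov` is zero for a parallel section: parallel sections are infinitesimal
symmetries of D. -/
theorem IsParallelOn.ad_leviCivita (hU : IsOpen U) (he : 𝔤.IsSection U e)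
    (hp : nabla.IsParallelOn e U) (t : 𝔤.Splitting) (hbar : nabla.BarEqAd)
    (ht : nabla.IsReductiveWith t) (hV : V.SmoothOn U) (hW : W.SmoothOn U) {x : M} (hx : x ∈ U) :
    ad e (t.leviCivita V W) x = t.leviCivita V (ad e W) x + t.leviCivita (ad e V) W x := by
  have h := nabla.ad_cov t hbar ht hU he hV hW hx
  rw [(nabla.cov_isSection hU hV he).1.ad_apply hU hW hx, cov, hp x hx, adAt_zero_left] at h
  rw [← sub_eq_zero, ← neg_eq_zero]
  refine Eq.trans ?_ h.symm
  abel

theorem IsParallelOn.ad_lie (hU : IsOpen U) (he : 𝔤.IsSection U e)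
    (hp : nabla.IsParallelOn e U) (hbar : nabla.BarEqAd) (hV : V.SmoothOn U) (hW : W.SmoothOn U)
    {x : M} (hx : x ∈ U) :
    ad e (lie V W) x = lie (ad e V) W x + lie V (ad e W) x := by
  have hA : ∀ {V : VField E M}, V.SmoothOn U → ∀ y ∈ U, ad e V y = lie (anchor e) V y :=
    fun hV y hy => IsParallelOn.ad_eq_lie hU he hp hbar hV hy
  rw [hA (VField.SmoothOn.lie hU hV hW) x hx, lie_lie hU he.1.1 hV hW hx,
    lie_congr hU (hA hV) (fun _ _ => rfl) hx, lie_congr hU (fun _ _ => rfl) (hA hW) hx]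

theorem IsParallelOn.ad_torsion (hU : IsOpen U) (he : 𝔤.IsSection U e)
    (hp : nabla.IsParallelOn e U) (t : 𝔤.Splitting) (hbar : nabla.BarEqAd)
    (ht : nabla.IsReductiveWith t) (hV : V.SmoothOn U) (hW : W.SmoothOn U) {x : M} (hx : x ∈ U) :
    ad e (torsion t.leviCivita V W) x =
      torsion t.leviCivita (ad e V) W x + torsion t.leviCivita V (ad e W) x := by
  have hD : ∀ {V W : VField E M}, V.SmoothOn U → W.SmoothOn U → (t.leviCivita V W).SmoothOn U :=
    fun hV hW => t.leviCivita_smoothOn hU hV hW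
  have hL := VField.SmoothOn.lie hU hV hW
  unfold torsion
  rw [ad_sub_right _ hU ((hD hV hW).sub (hD hW hV)) hL hx,
    ad_sub_right _ hU (hD hV hW) (hD hW hV) hx,
    IsParallelOn.ad_leviCivita hU he hp t hbar ht hV hW hx,
    IsParallelOn.ad_leviCivita hU he hp t hbar ht hW hV hx,
    IsParallelOn.ad_lie hU he hp hbar hV hW hx]
  simp only [Pi.sub_apply]
  abel

/-- The curvature is composed of D and the Lie bracket, for both of which ad_e is a derivation. -/
theorem IsParallelOn.ad_curvature (hU : IsOpen U) (he : 𝔤.IsSection U e)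
    (hp : nabla.IsParallelOn e U) (t : 𝔤.Splitting) (hbar : nabla.BarEqAd)
    (ht : nabla.IsReductiveWith t) (hV : V.SmoothOn U) (hW : W.SmoothOn U) (hY : Y.SmoothOn U)
    {x : M} (hx : x ∈ U) :
    ad e (curvature t.leviCivita V W Y) x =
      curvature t.leviCivita (ad e V) W Y x + curvature t.leviCivita V (ad e W) Y x +
        curvature t.leviCivita V W (ad e Y) x := by
  have hD : ∀ {V W : VField E M}, V.SmoothOn U → W.SmoothOn U → (t.leviCivita V W).SmoothOn U :=
    fun hV hW => t.leviCivita_smoothOn hU hV hW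
  have hA : ∀ {V : VField E M}, V.SmoothOn U → (ad e V).SmoothOn U := fun hV => he.1.ad hU hV
  have hL := VField.SmoothOn.lie hU hV hW
  have key : ∀ {V W : VField E M}, V.SmoothOn U → W.SmoothOn U → 
      ad e (t.leviCivita V (t.leviCivita W Y)) x =
      t.leviCivita V (t.leviCivita W (ad e Y)) x + t.leviCivita V (t.leviCivita (ad e W) Y) x +
        t.leviCivita (ad e V) (t.leviCivita W Y) x := by
    intro V W hV hW
    rw [IsParallelOn.ad_leviCivita hU he hp t hbar ht hV (hD hW hY) hx,
      ← t.leviCivita_add_right hU (hD hW (hA hY)) (hD (hA hW) hY) hx]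
    congr 1
    exact t.leviCivita_congr hU hV ((hD hW (hA hY)).add (hD (hA hW) hY)) (fun _ _ => rfl)
      (fun y hy => IsParallelOn.ad_leviCivita hU he hp t hbar ht hW hY hy) hx
  have key2 : t.leviCivita (ad e (lie V W)) Y x =
      t.leviCivita (lie (ad e V) W) Y x + t.leviCivita (lie V (ad e W)) Y x := by
    have hl := VField.SmoothOn.lie hU (hA hV) hW
    have hl' := VField.SmoothOn.lie hU hV (hA hW)
    rw [← t.leviCivita_add_left hU hl hl' hY hx]
    exact t.leviCivita_congr hU (hl.add hl') hY
      (fun y hy => IsParallelOn.ad_lie hU he hp hbar hV hW hy) (fun _ _ => rfl) hx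
  unfold curvature
  rw [ad_sub_right _ hU ((hD hV (hD hW hY)).sub (hD hW (hD hV hY))) (hD hL hY) hx,
    ad_sub_right _ hU (hD hV (hD hW hY)) (hD hW (hD hV hY)) hx, key hV hW, key hW hV,
    IsParallelOn.ad_leviCivita hU he hp t hbar ht hL hY hx, key2]
  simp only [Pi.sub_apply]
  abel

end Parallel

theorem IsParallelOn.mono {e : JSec E M} {U' : Set M} (hp : nabla.IsParallelOn e U)
    (h : U' ⊆ U) : nabla.IsParallelOn e U' := fun x hx => hp x (h hx)

/-- At x an arbitrary X may be replaced by the parallel section with the same value, because the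
action of a section and the torsion are both pointwise there. -/
theorem IsLocallySymmetric.preservesTorsion [T2Space M] (h : nabla.IsLocallySymmetric)
    (t : 𝔤.Splitting) (hbar : nabla.BarEqAd) (ht : nabla.IsReductiveWith t) :
    t.PreservesTorsion := by
  intro U X V W hU hX hV hW x hx
  obtain ⟨U₀, hU₀, hx₀, hs⟩ := h x
  obtain ⟨e, he, hp, hex⟩ := hs.exists_isParallelOn hx₀ (hX.2 x hx)
  have hU' := hU.inter hU₀
  have hx' : x ∈ U ∩ U₀ := ⟨hx, hx₀⟩
  replace hX := hX.mono (Set.inter_subset_left (t := U₀))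
  replace hV := hV.mono (Set.inter_subset_left (t := U₀))
  replace hW := hW.mono (Set.inter_subset_left (t := U₀))
  replace he := he.mono (Set.inter_subset_right (s := U))
  replace hp := hp.mono (Set.inter_subset_right (s := U))
  have hXe : ∀ {V : VField E M}, V.SmoothOn (U ∩ U₀) → ad X V x = ad e V x := fun hV => by
    rw [hX.1.ad_apply hU' hV hx', he.1.ad_apply hU' hV hx', hex]
  rw [hXe (t.torsion_smoothOn hU' hV hW),
    IsParallelOn.ad_torsion hU' he hp t hbar ht hV hW hx',
    t.torsion_congr hU' (he.1.ad hU' hV) hW (hX.1.ad hU' hV) hW hx' (hXe hV) rfl,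
    t.torsion_congr hU' hV (he.1.ad hU' hW) hV (hX.1.ad hU' hW) hx' rfl (hXe hW)]

theorem IsLocallySymmetric.preservesCurvature [T2Space M] (h : nabla.IsLocallySymmetric)
    (t : 𝔤.Splitting) (hbar : nabla.BarEqAd) (ht : nabla.IsReductiveWith t) :
    t.PreservesCurvature := by
  intro U X V W Y hU hX hV hW hY x hx
  obtain ⟨U₀, hU₀, hx₀, hs⟩ := h x
  obtain ⟨e, he, hp, hex⟩ := hs.exists_isParallelOn hx₀ (hX.2 x hx)
  have hU' := hU.inter hU₀
  have hx' : x ∈ U ∩ U₀ := ⟨hx, hx₀⟩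
  replace hX := hX.mono (Set.inter_subset_left (t := U₀))
  replace hV := hV.mono (Set.inter_subset_left (t := U₀))
  replace hW := hW.mono (Set.inter_subset_left (t := U₀))
  replace hY := hY.mono (Set.inter_subset_left (t := U₀))
  replace he := he.mono (Set.inter_subset_right (s := U))
  replace hp := hp.mono (Set.inter_subset_right (s := U))
  have hXe : ∀ {V : VField E M}, V.SmoothOn (U ∩ U₀) → ad X V x = ad e V x := fun hV => by
    rw [hX.1.ad_apply hU' hV hx', he.1.ad_apply hU' hV hx', hex]
  rw [hXe (t.curvature_smoothOn hU' hV hW hY),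
    IsParallelOn.ad_curvature hU' he hp t hbar ht hV hW hY hx',
    t.curvature_congr hU' (he.1.ad hU' hV) (hX.1.ad hU' hV) hW hW hY hY hx' (hXe hV) rfl rfl,
    t.curvature_congr hU' hV hV (he.1.ad hU' hW) (hX.1.ad hU' hW) hY hY hx' rfl (hXe hW) rfl,
    t.curvature_congr hU' hV hV hW hW (he.1.ad hU' hY) (hX.1.ad hU' hY) hx' rfl rfl (hXe hY)]

end Connection

end InfinitesimalGStructure

/-! ### Smooth components of sections in a frame, and connection forms. -/

/-- The components in the preferred chart at `x` of a one-jet at `y`, acting on coordinate fields. -/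
def jetCoord (x y : M) : Jet E y →ₗ[ℝ] E × (Fin (Module.finrank ℝ E) → E) where
  toFun j := (coord x y j.1, fun i => coord x y (adAt j (coordField x (Module.finBasis ℝ E i))))
  map_add' j k := by
    refine Prod.ext (map_add _ _ _) (funext fun i => ?_)
    exact (congrArg (coord (E := E) x y) (adAt_add_left j k _)).trans
      (map_add (coord (E := E) x y) _ _)
  map_smul' c j := by
    refine Prod.ext (map_smul _ _ _) (funext fun i => ?_)
    exact (congrArg (coord (E := E) x y) (adAt_smul_left c j _)).trans
      (map_smul (coord (E := E) x y) _ _)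

/-- A jet at y is stored relative to the preferred chart at y, which need not vary continuously with
y; the chart at x is fixed here instead. Once the anchor vanishes, the action on coordinate fields
determines the endomorphism on a basis. -/
theorem jetCoord_injective {x y : M} (hy : y ∈ (chartAt E x).source) :
    Function.Injective (jetCoord (E := E) x y) := by
  rw [injective_iff_map_eq_zero]
  intro j hj
  have h1 : j.1 = 0 := coord_injective hy ((congrArg Prod.fst hj).trans (map_zero _).symm)
  have h2 : ∀ i, j.2 (coordField x (Module.finBasis ℝ E i) y) = 0 := fun i => by
    have h3 : adAt j (coordField x (Module.finBasis ℝ E i)) = 0 :=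
      coord_injective hy ((congrFun (congrArg Prod.snd hj) i).trans (map_zero _).symm)
    rw [adAt, h1, map_zero, zero_sub, neg_eq_zero] at h3
    exact h3
  refine Prod.ext h1 (ContinuousLinearMap.ext fun v => ?_)
  let L : E →ₗ[ℝ] E := (j.2.comp (coord (E := E) x y).inverse).toLinearMap
  have hL : L = 0 := (Module.finBasis ℝ E).ext h2
  have h4 := LinearMap.congr_fun hL (coord x y v)
  exact (congrArg j.2 (coordField_coord hy v)).symm.trans h4

theorem JSec.SmoothOn.jetCoord {x : M} {σ : JSec E M} {U : Set M} (hU : IsOpen U)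
    (hUx : U ⊆ (chartAt E x).source) (hσ : σ.SmoothOn U) :
    ContMDiffOn 𝓘(ℝ, E) 𝓘(ℝ, E × (Fin (Module.finrank ℝ E) → E)) ∞
      (fun y => jetCoord x y (σ y)) U := by
  refine ContMDiffOn.prodMk_space ((smoothOn_iff_coord hU hUx).1 hσ.1)
    (contMDiffOn_pi_space.2 fun i => ?_)
  exact (smoothOn_iff_coord hU hUx).1
    (hσ.adAt hU ((smoothOn_coordField x _).mono hUx))

/-- With P a left inverse of the frame matrix at x, the square matrix B(y) = P ∘ s(y) is smooth and
is the identity at x. Near x its inverse is smooth too, and applied to P of the section it returns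
the components. -/
theorem funSmoothOn_of_sum_smul_eq {U : Set M} (hU : IsOpen U) {r : ℕ} {s : Fin r → JSec E M}
    (hs : ∀ i, (s i).SmoothOn U) (hli : ∀ y ∈ U, LinearIndependent ℝ fun i => s i y)
    {f : Fin r → M → ℝ} (hf : JSec.SmoothOn (fun y => ∑ i, f i y • s i y) U) (i : Fin r) :
    FunSmoothOn E (f i) U := by
  intro x hx
  refine ContMDiffAt.contMDiffWithinAt ?_
  set U' := U ∩ (chartAt E x).source with hU'def
  have hU' : IsOpen U' := hU.inter (chartAt E x).open_source
  have hx' : x ∈ U' := ⟨hx, mem_chart_source E x⟩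
  have hU'x : U' ⊆ (chartAt E x).source := Set.inter_subset_right
  obtain ⟨P, hP⟩ := LinearMap.exists_leftInverse_of_injective
    (jetCoord (E := E) x x ∘ₗ Fintype.linearCombination ℝ (fun i => s i x)) (by
      rw [LinearMap.ker_eq_bot]
      exact (jetCoord_injective (mem_chart_source E x)).comp
        (linearIndependent_iff_injective_fintypeLinearCombination.1 (hli x hx)))
  let B : M → (Fin r → ℝ) →L[ℝ] (Fin r → ℝ) := fun y => LinearMap.toContinuousLinearMap
    (P ∘ₗ jetCoord (E := E) x y ∘ₗ Fintype.linearCombination ℝ (fun i => s i y))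
  have hB1 : B x = ContinuousLinearMap.id ℝ _ := by
    ext v
    exact congrFun (LinearMap.congr_fun hP v) _
  have hPs : ContDiff ℝ ∞ P := (LinearMap.toContinuousLinearMap P).contDiff
  have hBs : ContMDiffAt 𝓘(ℝ, E) 𝓘(ℝ, (Fin r → ℝ) →L[ℝ] (Fin r → ℝ)) ∞ B x := by
    refine contMDiffAt_clm_of_apply fun w => ?_
    have h1 : JSec.SmoothOn (fun y => ∑ i, w i • s i y) U' :=
      JSec.SmoothOn.sum hU' _ fun i _ => JSec.SmoothOn.smul hU' contMDiffOn_const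
        ((hs i).mono Set.inter_subset_left)
    exact hPs.contMDiff.contMDiffAt.comp x
      ((h1.jetCoord hU' hU'x).contMDiffAt (hU'.mem_nhds hx'))
  have hg : ContMDiffAt 𝓘(ℝ, E) 𝓘(ℝ, Fin r → ℝ) ∞ (fun y => B y fun i => f i y) x :=
    hPs.contMDiff.contMDiffAt.comp x
      (((hf.mono Set.inter_subset_left).jetCoord hU' hU'x).contMDiffAt (hU'.mem_nhds hx'))
  have hunit : IsUnit (B x) := by
    rw [hB1]
    exact isUnit_one
  have hinv : ContMDiffAt 𝓘(ℝ, E) 𝓘(ℝ, (Fin r → ℝ) →L[ℝ] (Fin r → ℝ)) ∞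
      (fun y => Ring.inverse (B y)) x := by
    obtain ⟨u, hu⟩ := hunit
    have := contDiffAt_ringInverse ℝ (n := ∞) u
    rw [hu] at this
    exact this.contMDiffAt.comp x hBs
  have hev : ∀ᶠ y in 𝓝 x, IsUnit (B y) :=
    hBs.continuousAt.eventually (Units.isOpen.mem_nhds hunit)
  have hfin : ContMDiffAt 𝓘(ℝ, E) 𝓘(ℝ, Fin r → ℝ) ∞ (fun y i => f i y) x := by
    refine (hinv.clm_apply hg).congr_of_eventuallyEq ?_
    filter_upwards [hev] with y hy
    have h1 := DFunLike.congr_fun (Ring.inverse_mul_cancel (B y) hy) fun i => f i y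
    exact h1.symm
  exact contMDiffAt_pi_space.1 hfin i

theorem dFun_comp_extChartAt {x y : M} (hy : y ∈ (chartAt E x).source) {f : E → ℝ}
    (hf : DifferentiableAt ℝ f (extChartAt 𝓘(ℝ, E) x y)) (v : TangentSpace 𝓘(ℝ, E) y) :
    dFun E (fun y => f (extChartAt 𝓘(ℝ, E) x y)) y v =
      fderiv ℝ f (extChartAt 𝓘(ℝ, E) x y) (coord x y v) := by
  have h := (mdifferentiableAt_extChartAt (I := 𝓘(ℝ, E)) hy).hasMFDerivAt
  have h2 := hf.hasFDerivAt.hasMFDerivAt.comp y h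
  exact DFunLike.congr_fun h2.mfderiv v

/-- The section with components `w` in the frame `s`, at `y`. -/
abbrev frameMap {r : ℕ} (s : Fin r → JSec E M) (y : M) : (Fin r → ℝ) →ₗ[ℝ] Jet E y :=
  Fintype.linearCombination ℝ (fun i => s i y)

theorem frameMap_injective {r : ℕ} {s : Fin r → JSec E M} {y : M}
    (h : LinearIndependent ℝ fun i => s i y) : Function.Injective (frameMap s y) :=
  linearIndependent_iff_injective_fintypeLinearCombination.1 h

namespace InfinitesimalGStructure

variable {𝔤 : InfinitesimalGStructure E M} {U : Set M} {r : ℕ} {s : Fin r → JSec E M}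

theorem IsSection.frameMap (hU : IsOpen U) (hs : ∀ i, 𝔤.IsSection U (s i)) {f : M → Fin r → ℝ}
    (hf : ∀ i, FunSmoothOn E (fun y => f y i) U) :
    𝔤.IsSection U (fun y => frameMap s y (f y)) :=
  IsSection.sum hU Finset.univ fun i _ => IsSection.smul hU (hf i) (hs i)

theorem IsSection.exists_eq_frameMap (hU : IsOpen U) (hs : ∀ i, 𝔤.IsSection U (s i))
    (hli : ∀ y ∈ U, LinearIndependent ℝ fun i => s i y)
    (hspan : ∀ y ∈ U, Submodule.span ℝ (Set.range fun i => s i y) = 𝔤.fiber y)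
    {σ : JSec E M} (hσ : 𝔤.IsSection U σ) :
    ∃ f : M → Fin r → ℝ, (∀ i, FunSmoothOn E (fun y => f y i) U) ∧
      ∀ y ∈ U, σ y = InfGStr.frameMap s y (f y) := by
  have h : ∀ y, ∃ c : Fin r → ℝ, y ∈ U → σ y = InfGStr.frameMap s y c := by
    intro y
    by_cases hy : y ∈ U
    · have h1 := hσ.2 y hy
      rw [← hspan y hy, ← Fintype.range_linearCombination] at h1
      obtain ⟨c, hc⟩ := h1
      exact ⟨c, fun _ => hc.symm⟩
    · exact ⟨0, fun h => absurd h hy⟩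
  choose f hf using h
  exact ⟨f, funSmoothOn_of_sum_smul_eq hU (fun i => (hs i).1) hli
    (hσ.1.congr hU fun y hy => (hf y hy).symm), hf⟩

namespace Connection

variable {nabla : 𝔤.Connection}

theorem toFun_sum_apply (hU : IsOpen U) {ι : Type*} (t : Finset ι) {σ : ι → JSec E M}
    (h : ∀ i ∈ t, 𝔤.IsSection U (σ i)) {x : M} (hx : x ∈ U) (v : TangentSpace 𝓘(ℝ, E) x) :
    nabla.toFun (fun y => ∑ i ∈ t, σ i y) x v = ∑ i ∈ t, nabla.toFun (σ i) x v := by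
  classical
  induction t using Finset.induction_on with
  | empty => exact nabla.toFun_apply_eq_zero hU (fun y _ => rfl) hx v
  | insert a t ha ih =>
    have h1 : ∀ i ∈ t, 𝔤.IsSection U (σ i) := fun i hi => h i (Finset.mem_insert_of_mem hi)
    rw [Finset.sum_insert ha, ← ih h1,
      ← nabla.toFun_add_apply hU (h a (Finset.mem_insert_self a t)) (IsSection.sum hU t h1) hx v]
    congr 2
    funext y
    exact Finset.sum_insert ha

theorem toFun_frameMap (hU : IsOpen U) (hs : ∀ i, 𝔤.IsSection U (s i)) {f : M → Fin r → ℝ}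
    (hf : ∀ i, FunSmoothOn E (fun y => f y i) U) {x : M} (hx : x ∈ U)
    (v : TangentSpace 𝓘(ℝ, E) x) :
    nabla.toFun (fun y => frameMap s y (f y)) x v =
      frameMap s x (fun i => dFun E (fun y => f y i) x v) +
        ∑ i, f x i • nabla.toFun (s i) x v := by
  refine (nabla.toFun_sum_apply hU Finset.univ
    (fun i _ => IsSection.smul hU (hf i) (hs i)) hx v).trans ?_
  rw [Fintype.linearCombination_apply, ← Finset.sum_add_distrib]
  refine Finset.sum_congr rfl fun i _ => ?_
  rw [nabla.toFun_smul_apply hU (hf i) (hs i) hx v, add_comm]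

/-- The Christoffel symbols are the smooth frame components of the covariant derivatives of frame
sections along coordinate fields; A is assembled from them in the chart. -/
theorem exists_connection_form (hU : IsOpen U) {x : M} (hUx : U ⊆ (chartAt E x).source)
    (hs : ∀ i, 𝔤.IsSection U (s i)) (hli : ∀ y ∈ U, LinearIndependent ℝ fun i => s i y)
    (hspan : ∀ y ∈ U, Submodule.span ℝ (Set.range fun i => s i y) = 𝔤.fiber y) :
    ∃ A : E → E →L[ℝ] (Fin r → ℝ) →L[ℝ] (Fin r → ℝ),
      ContDiffOn ℝ ∞ A ((extChartAt 𝓘(ℝ, E) x).target ∩ (extChartAt 𝓘(ℝ, E) x).symm ⁻¹' U) ∧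
      ∀ y ∈ U, ∀ v w, frameMap s y (A (extChartAt 𝓘(ℝ, E) x y) (coord x y v) w) =
        ∑ i, w i • nabla.toFun (s i) y v := by
  let b := Module.finBasis ℝ E
  have h1 : ∀ a i, ∃ f : M → Fin r → ℝ, (∀ j, FunSmoothOn E (fun y => f y j) U) ∧
      ∀ y ∈ U, nabla.cov (coordField x (b a)) (s i) y = frameMap s y (f y) := fun a i =>
    IsSection.exists_eq_frameMap hU hs hli hspan
      (nabla.cov_isSection hU ((smoothOn_coordField x _).mono hUx) (hs i))
  choose C hC hCs using h1
  let A : E → E →L[ℝ] (Fin r → ℝ) →L[ℝ] (Fin r → ℝ) := fun z =>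
    ∑ a, ∑ i, (LinearMap.toContinuousLinearMap (b.coord a)).smulRight
      ((ContinuousLinearMap.proj (R := ℝ) (φ := fun _ : Fin r => ℝ) i).smulRight
        (C a i ((extChartAt 𝓘(ℝ, E) x).symm z)))
  have hA : ∀ z k w, A z k w = ∑ a, ∑ i, (b.coord a k) • w i •
      C a i ((extChartAt 𝓘(ℝ, E) x).symm z) := fun z k w => by
    simp [A]
  refine ⟨A, contDiffOn_clm_apply.2 fun k => contDiffOn_clm_apply.2 fun w => ?_,
    fun y hy v w => ?_⟩
  · simp only [hA]
    refine ContDiffOn.sum fun a _ => ContDiffOn.sum fun i _ => ?_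
    have h2 : ContDiffOn ℝ ∞ (fun z => C a i ((extChartAt 𝓘(ℝ, E) x).symm z))
        ((extChartAt 𝓘(ℝ, E) x).target ∩ (extChartAt 𝓘(ℝ, E) x).symm ⁻¹' U) := by
      refine contDiffOn_pi.2 fun j => ?_
      rw [← contMDiffOn_iff_contDiffOn]
      exact (hC a i j).comp ((contMDiffOn_extChartAt_symm x).mono Set.inter_subset_left)
        fun z hz => hz.2
    exact ContDiffOn.const_smul (b.coord a k) (ContDiffOn.const_smul (w i) h2)
  · rw [hA, (extChartAt 𝓘(ℝ, E) x).left_inv (by simpa using hUx hy)]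
    have hv : v = ∑ a, b.coord a (coord x y v) • coordField x (b a) y := by
      refine coord_injective (hUx hy) ?_
      rw [map_sum]
      conv_lhs => rw [← b.sum_repr (coord x y v)]
      refine Finset.sum_congr rfl fun a _ => ?_
      rw [map_smul, coord_coordField (hUx hy)]
      rfl
    conv_rhs => rw [hv]
    simp only [map_sum, map_smul, Finset.smul_sum]
    rw [Finset.sum_comm]
    refine Finset.sum_congr rfl fun i _ => Finset.sum_congr rfl fun a _ => ?_
    rw [← hCs a i y hy, smul_comm]
    rfl

end Connection

end InfinitesimalGStructure

/-! ### Flat connections have local parallel frames. -/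

namespace InfinitesimalGStructure.Connection

variable {𝔤 : InfinitesimalGStructure E M} {nabla : 𝔤.Connection}

/-- The curvature of the connection `nabla` on `𝔤` vanishes. -/
def IsFlat (nabla : 𝔤.Connection) : Prop :=
  ∀ (U : Set M) (σ : JSec E M) (V W : VField E M), IsOpen U → 𝔤.IsSection U σ → V.SmoothOn U →
    W.SmoothOn U → ∀ x ∈ U,
      nabla.cov V (nabla.cov W σ) x - nabla.cov W (nabla.cov V σ) x - nabla.cov (lie V W) σ x = 0

section ConnectionForm

variable {U : Set M} {r : ℕ} {s : Fin r → JSec E M} {x : M}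
  {A : E → E →L[ℝ] (Fin r → ℝ) →L[ℝ] (Fin r → ℝ)}

theorem toFun_frameMap_of_connection_form (hU : IsOpen U) (hs : ∀ i, 𝔤.IsSection U (s i))
    (hA : ∀ y ∈ U, ∀ v w, frameMap s y (A (extChartAt 𝓘(ℝ, E) x y) (coord x y v) w) =
        ∑ i, w i • nabla.toFun (s i) y v)
    {f : M → Fin r → ℝ} (hf : ∀ i, FunSmoothOn E (fun y => f y i) U) {y : M} (hy : y ∈ U)
    (v : TangentSpace 𝓘(ℝ, E) y) :
    nabla.toFun (fun y => frameMap s y (f y)) y v = frameMap s y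
      ((fun i => dFun E (fun y => f y i) y v) +
        A (extChartAt 𝓘(ℝ, E) x y) (coord x y v) (f y)) := by
  rw [toFun_frameMap hU hs hf hy, map_add, hA y hy]

/-- Flatness is evaluated on coordinate fields, which commute, and on a section with constant
components, so that only A and its derivative remain. -/
theorem IsFlat.connection_form (hflat : nabla.IsFlat) (hU : IsOpen U)
    (hUx : U ⊆ (chartAt E x).source) (hs : ∀ i, 𝔤.IsSection U (s i))
    (hli : ∀ y ∈ U, LinearIndependent ℝ fun i => s i y)
    (hAs : ContDiffOn ℝ ∞ A
      ((extChartAt 𝓘(ℝ, E) x).target ∩ (extChartAt 𝓘(ℝ, E) x).symm ⁻¹' U))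
    (hA : ∀ y ∈ U, ∀ v w, frameMap s y (A (extChartAt 𝓘(ℝ, E) x y) (coord x y v) w) =
        ∑ i, w i • nabla.toFun (s i) y v)
    {y : M} (hy : y ∈ U) (h k : E) (c : Fin r → ℝ) :
    fderiv ℝ (fun z => A z k) (extChartAt 𝓘(ℝ, E) x y) h c -
      fderiv ℝ (fun z => A z h) (extChartAt 𝓘(ℝ, E) x y) k c +
      (A (extChartAt 𝓘(ℝ, E) x y) h (A (extChartAt 𝓘(ℝ, E) x y) k c) -
        A (extChartAt 𝓘(ℝ, E) x y) k (A (extChartAt 𝓘(ℝ, E) x y) h c)) = 0 := by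
  set S := (extChartAt 𝓘(ℝ, E) x).target ∩ (extChartAt 𝓘(ℝ, E) x).symm ⁻¹' U with hS
  have hSo : IsOpen S :=
    (continuousOn_extChartAt_symm x).isOpen_inter_preimage (isOpen_extChartAt_target x) hU
  have hmem : ∀ y ∈ U, extChartAt 𝓘(ℝ, E) x y ∈ S := fun y hy => by
    have hy' : y ∈ (extChartAt 𝓘(ℝ, E) x).source := by simpa using hUx hy
    exact ⟨(extChartAt 𝓘(ℝ, E) x).map_source hy', by
      rwa [Set.mem_preimage, (extChartAt 𝓘(ℝ, E) x).left_inv hy']⟩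
  have hφ : ContMDiffOn 𝓘(ℝ, E) 𝓘(ℝ, E) ∞ (extChartAt 𝓘(ℝ, E) x) U :=
    contMDiffOn_extChartAt.mono hUx
  have hAk : ∀ k, ContDiffOn ℝ ∞ (fun z => A z k) S := fun k => hAs.clm_apply contDiffOn_const
  have hAkc : ∀ k (c : Fin r → ℝ) i, ContDiffOn ℝ ∞ (fun z => A z k c i) S := fun k c i =>
    contDiffOn_pi.1 ((hAk k).clm_apply contDiffOn_const) i
  have hsm : ∀ k (c : Fin r → ℝ) i,
      FunSmoothOn E (fun y => A (extChartAt 𝓘(ℝ, E) x y) k c i) U := fun k c i =>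
    (hAkc k c i).contMDiffOn.comp hφ hmem
  have hconst : ∀ i : Fin r, FunSmoothOn E (fun _ : M => c i) U := fun i => contMDiffOn_const
  have hcf : ∀ k, (coordField (E := E) (M := M) x k).SmoothOn U :=
    fun k => (smoothOn_coordField x k).mono hUx
  have hσ : 𝔤.IsSection U (fun y => frameMap s y c) := IsSection.frameMap hU hs hconst
  have hcov : ∀ k, ∀ y ∈ U, nabla.cov (coordField x k) (fun y => frameMap s y c) y =
      frameMap s y (A (extChartAt 𝓘(ℝ, E) x y) k c) := fun k y hy => by
    refine (toFun_frameMap_of_connection_form hU hs hA hconst hy _).trans ?_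
    rw [coord_coordField (hUx hy)]
    congr 1
    refine (congrArg (· + _) (funext fun i => ?_)).trans (zero_add _)
    exact DFunLike.congr_fun (mfderiv_const (c := c i)) _
  have hcov2 : ∀ h k, nabla.cov (coordField x h)
      (nabla.cov (coordField x k) (fun y => frameMap s y c)) y =
      frameMap s y (fderiv ℝ (fun z => A z k) (extChartAt 𝓘(ℝ, E) x y) h c +
        A (extChartAt 𝓘(ℝ, E) x y) h (A (extChartAt 𝓘(ℝ, E) x y) k c)) := fun h k => by
    refine (nabla.toFun_congr_apply hU (IsSection.frameMap hU hs (hsm k c)) (hcov k) hy _).trans ?_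
    refine (toFun_frameMap_of_connection_form hU hs hA (hsm k c) hy _).trans ?_
    rw [coord_coordField (hUx hy)]
    congr 2
    funext i
    have hd : DifferentiableAt ℝ (fun z => A z k) (extChartAt 𝓘(ℝ, E) x y) :=
      ((hAk k).contDiffAt (hSo.mem_nhds (hmem y hy))).differentiableAt (by simp)
    have hd' : HasFDerivAt (fun z => A z k c i) ((ContinuousLinearMap.proj i).comp
        ((fderiv ℝ (fun z => A z k) (extChartAt 𝓘(ℝ, E) x y)).flip c)) (extChartAt 𝓘(ℝ, E) x y) := by
      have h1 := hd.hasFDerivAt.clm_apply (hasFDerivAt_const c (extChartAt 𝓘(ℝ, E) x y))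
      refine (hasFDerivAt_pi'.1 h1 i).congr_fderiv ?_
      ext v
      simp
    refine (dFun_comp_extChartAt (hUx hy) (f := fun z => A z k c i) hd'.differentiableAt _).trans ?_
    rw [hd'.fderiv, coord_coordField (hUx hy)]
    rfl
  have hlie : nabla.cov (lie (coordField x h) (coordField x k)) (fun y => frameMap s y c) y = 0 := by
    rw [cov, lie_coordField (hUx hy), map_zero]
  have key := hflat U _ _ _ hU hσ (hcf h) (hcf k) y hy
  rw [hlie, sub_zero, hcov2, hcov2, ← map_sub] at key
  have key' := frameMap_injective (hli y hy) (key.trans (map_zero _).symm)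
  rw [← key']
  abel

end ConnectionForm

/-- The neighbourhood is a ball in a chart, so functions with zero differential are constant on it.
This is recorded in the conclusion for use on the structure functions. -/
theorem IsFlat.exists_parallel_frame (hflat : nabla.IsFlat) (x : M) :
    ∃ U : Set M, IsOpen U ∧ x ∈ U ∧ (∀ f : M → ℝ, FunSmoothOn E f U →
        (∀ y ∈ U, ∀ v, dFun E f y v = 0) → ∀ y ∈ U, f y = f x) ∧
      ∃ (r : ℕ) (e : Fin r → JSec E M), (∀ i, 𝔤.IsSection U (e i)) ∧
        (∀ i, nabla.IsParallelOn (e i) U) ∧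
        (∀ y ∈ U, LinearIndependent ℝ fun i => e i y) ∧
        ∀ y ∈ U, Submodule.span ℝ (Set.range fun i => e i y) = 𝔤.fiber y := by
  obtain ⟨U₁, hU₁, hxU₁, r, s, hs₁, hfr₁⟩ := 𝔤.exists_frame x
  set U := U₁ ∩ (chartAt E x).source with hUdef
  have hU : IsOpen U := hU₁.inter (chartAt E x).open_source
  have hxU : x ∈ U := ⟨hxU₁, mem_chart_source E x⟩
  have hUx : U ⊆ (chartAt E x).source := Set.inter_subset_right
  have hli : ∀ y ∈ U, LinearIndependent ℝ fun i => s i y := fun y hy => (hfr₁ y hy.1).1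
  have hspan : ∀ y ∈ U, Submodule.span ℝ (Set.range fun i => s i y) = 𝔤.fiber y :=
    fun y hy => (hfr₁ y hy.1).2
  have hs : ∀ i, 𝔤.IsSection U (s i) := fun i => ⟨(hs₁ i).mono Set.inter_subset_left,
    fun y hy => by
      rw [← hspan y hy]
      exact Submodule.subset_span ⟨i, rfl⟩⟩
  obtain ⟨A, hAs, hA⟩ := exists_connection_form (nabla := nabla) hU hUx hs hli hspan
  set φ := extChartAt 𝓘(ℝ, E) x with hφ
  set S := φ.target ∩ φ.symm ⁻¹' U with hS
  have hSo : IsOpen S :=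
    (continuousOn_extChartAt_symm x).isOpen_inter_preimage (isOpen_extChartAt_target x) hU
  have hsrc : ∀ y, y ∈ φ.source ↔ y ∈ (chartAt E x).source := fun y => by
    rw [hφ, extChartAt_source]
  have hxS : φ x ∈ S := ⟨mem_extChartAt_target x, by
    rwa [Set.mem_preimage, φ.left_inv (mem_extChartAt_source x)]⟩
  obtain ⟨ρ, hρ, hρS, hsol⟩ := exists_parallel_of_flat hSo hxS hAs fun z hz h k c => by
    have := hflat.connection_form hU hUx hs hli hAs hA hz.2 h k c
    rwa [← hφ, φ.right_inv hz.1] at this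
  -- Solutions with the standard basis as initial values: their determinant is 1 at the centre,
  -- hence nonzero on a smaller ball of radius δ.
  choose u hu0 hus hud using fun i : Fin r => hsol (Pi.single i 1)
  have hdet : ContinuousAt (fun z => Matrix.det (Matrix.of fun i j => u i z j)) (φ x) := by
    have h1 : ∀ i, ContinuousAt (u i) (φ x) := fun i =>
      (hus i).continuousOn.continuousAt (Metric.ball_mem_nhds _ hρ)
    have h2 : ContinuousAt (fun z => Matrix.of fun i j => u i z j) (φ x) :=
      continuousAt_pi.2 fun i => h1 i
    exact (continuous_id.matrix_det.continuousAt).comp h2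
  have hdet1 : Matrix.det (Matrix.of fun i j => u i (φ x) j) = 1 := by
    have : (Matrix.of fun i j => u i (φ x) j) = (1 : Matrix (Fin r) (Fin r) ℝ) := by
      ext i j
      rw [Matrix.of_apply, hu0, Matrix.one_apply, Pi.single_apply]
      simp [eq_comm]
    rw [this, Matrix.det_one]
  obtain ⟨δ, hδ, hball⟩ := Metric.eventually_nhds_iff_ball.1
    ((hdet.eventually_ne (by rw [hdet1]; exact one_ne_zero)).and (Metric.ball_mem_nhds (φ x) hρ))
  let U' := φ.source ∩ φ ⁻¹' Metric.ball (φ x) δ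
  have hU' : IsOpen U' :=
    (continuousOn_extChartAt x).isOpen_inter_preimage (isOpen_extChartAt_source x) Metric.isOpen_ball
  have hU'U : U' ⊆ U := fun y hy => by
    have := (hρS (hball _ hy.2).2).2
    rwa [Set.mem_preimage, φ.left_inv hy.1] at this
  have hmaps : Set.MapsTo φ U' (Metric.ball (φ x) ρ) := fun y hy => (hball _ hy.2).2
  have hus' : ∀ i j, FunSmoothOn E (fun y => u i (φ y) j) U' := fun i j =>
    (contDiffOn_pi.1 (hus i) j).contMDiffOn.comp
      (contMDiffOn_extChartAt.mono (hU'U.trans hUx)) hmaps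
  have hs' : ∀ i, 𝔤.IsSection U' (s i) := fun i => (hs i).mono hU'U
  refine ⟨U', hU', ⟨mem_extChartAt_source x, Metric.mem_ball_self hδ⟩, ?_, r,
    fun i y => frameMap s y (u i (φ y)), fun i => IsSection.frameMap hU' hs' (hus' i), ?_, ?_, ?_⟩
  · intro f hf hdf y hy
    have hsub : Metric.ball (φ x) δ ⊆ φ.target := fun z hz => (hρS (hball z hz).2).1
    have hz' : ∀ z ∈ Metric.ball (φ x) δ, φ.symm z ∈ U' := fun z hz =>
      ⟨φ.map_target (hsub hz), by rwa [Set.mem_preimage, φ.right_inv (hsub hz)]⟩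
    have hg : ContDiffOn ℝ ∞ (fun z => f (φ.symm z)) (Metric.ball (φ x) δ) := by
      rw [← contMDiffOn_iff_contDiffOn]
      exact hf.comp ((contMDiffOn_extChartAt_symm x).mono hsub) hz'
    have hgd : ∀ z ∈ Metric.ball (φ x) δ, fderiv ℝ (fun z => f (φ.symm z)) z = 0 := by
      intro z hz
      have hd : DifferentiableAt ℝ (fun z => f (φ.symm z)) z :=
        (hg.contDiffAt (Metric.isOpen_ball.mem_nhds hz)).differentiableAt (by simp)
      have hy' := hz' z hz
      have hzz : φ (φ.symm z) = z := φ.right_inv (hsub hz)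
      ext h
      have h1 := dFun_comp_extChartAt (x := x) (y := φ.symm z) ((hsrc _).1 hy'.1)
        (f := fun z => f (φ.symm z)) (by rw [← hφ, hzz]; exact hd) (coordField x h _)
      rw [coord_coordField ((hsrc _).1 hy'.1), ← hφ, hzz] at h1
      refine h1.symm.trans ?_
      refine Eq.trans ?_ (hdf _ hy' (coordField x h _))
      have hev : (fun y => f (φ.symm (φ y))) =ᶠ[𝓝 (φ.symm z)] f := by
        filter_upwards [hU'.mem_nhds hy'] with y hy
        exact congrArg f (φ.left_inv hy.1)
      exact DFunLike.congr_fun (hev.mfderiv_eq (I := 𝓘(ℝ, E)) (I' := 𝓘(ℝ, ℝ))) _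
    have h2 := (convex_ball (φ x) δ).is_const_of_fderivWithin_eq_zero (𝕜 := ℝ)
      (hg.differentiableOn (by simp)) (fun z hz => by
        rw [fderivWithin_of_isOpen Metric.isOpen_ball hz, hgd z hz])
      hy.2 (Metric.mem_ball_self hδ)
    simpa only [φ.left_inv hy.1, φ.left_inv (mem_extChartAt_source x)] using h2
  · intro i y hy v
    refine (toFun_frameMap_of_connection_form hU' hs' (fun y hy => hA y (hU'U hy)) (hus' i) hy
      v).trans ?_
    have h1 := hud i _ (hmaps hy)
    refine (congrArg _ ?_).trans (map_zero (frameMap s y))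
    funext j
    have h2 := hasFDerivAt_pi'.1 h1 j
    rw [Pi.add_apply, dFun_comp_extChartAt (hUx (hU'U hy)) (f := fun z => u i z j)
      h2.differentiableAt, h2.fderiv]
    exact neg_add_cancel _
  · intro y hy
    have h1 := Matrix.linearIndependent_rows_of_det_ne_zero (hball _ hy.2).1
    exact h1.map' (frameMap s y) (LinearMap.ker_eq_bot.2 (frameMap_injective (hli y (hU'U hy))))
  · intro y hy
    have h1 := Matrix.linearIndependent_rows_of_det_ne_zero (hball _ hy.2).1
    have h2 := h1.span_eq_top_of_card_eq_finrank' (by simp)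
    have h3 : LinearMap.range (frameMap s y) = Submodule.span ℝ (Set.range fun i => s i y) :=
      Fintype.range_linearCombination ℝ _
    rw [← hspan y (hU'U hy), ← h3, LinearMap.range_eq_map, ← h2, Submodule.map_span,
      ← Set.range_comp]
    rfl

end InfinitesimalGStructure.Connection

/-! ### Algebraic identities of the bracket, checked on vector fields. -/

section Bracket

variable {σ τ ρ : JSec E M} {U : Set M} {x : M}

theorem jet_ext_of_isOpen {j k : Jet E x} (hU : IsOpen U) (hx : x ∈ U)
    (h : ∀ (U' : Set M) (W : VField E M), IsOpen U' → x ∈ U' → U' ⊆ U → W.SmoothOn U' →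
      adAt j W = adAt k W) : j = k :=
  jet_ext fun W hW => h (U ∩ (chartAt E x).source) W (hU.inter (chartAt E x).open_source)
    ⟨hx, mem_chart_source E x⟩ Set.inter_subset_left (hW.mono Set.inter_subset_right)

theorem adAt_bracket (hU : IsOpen U) (hσ : σ.SmoothOn U) (hτ : τ.SmoothOn U) {W : VField E M}
    (hW : W.SmoothOn U) (hx : x ∈ U) :
    adAt (bracket σ τ x) W = ad σ (ad τ W) x - ad τ (ad σ W) x := by
  rw [← (JSec.SmoothOn.bracket hU hσ hτ).ad_apply hU hW hx, ad_bracket hU hσ hτ hW hx]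

theorem bracket_swap (hU : IsOpen U) (hσ : σ.SmoothOn U) (hτ : τ.SmoothOn U) (hx : x ∈ U) :
    bracket σ τ x = - bracket τ σ x := by
  refine jet_ext_of_isOpen hU hx fun U' W hU' hx' hsub hW => ?_
  have h1 : adAt (- bracket τ σ x) W = - adAt (bracket τ σ x) W := by
    rw [← neg_one_smul ℝ, adAt_smul_left, neg_one_smul]
  rw [h1, adAt_bracket hU' (hσ.mono hsub) (hτ.mono hsub) hW hx',
    adAt_bracket hU' (hτ.mono hsub) (hσ.mono hsub) hW hx', neg_sub]

theorem bracket_add_right (hU : IsOpen U) (hσ : σ.SmoothOn U) (hτ : τ.SmoothOn U)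
    (hρ : ρ.SmoothOn U) (hx : x ∈ U) :
    bracket σ (τ + ρ) x = bracket σ τ x + bracket σ ρ x := by
  refine jet_ext_of_isOpen hU hx fun U' W hU' hx' hsub hW => ?_
  replace hσ := hσ.mono hsub
  replace hτ := hτ.mono hsub
  replace hρ := hρ.mono hsub
  have hτρ := JSec.SmoothOn.add hU' hτ hρ
  rw [adAt_add_left, adAt_bracket hU' hσ hτρ hW hx', adAt_bracket hU' hσ hτ hW hx',
    adAt_bracket hU' hσ hρ hW hx', hτρ.ad_apply hU' (hσ.ad hU' hW) hx', Pi.add_apply,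
    adAt_add_left, ← hτ.ad_apply hU' (hσ.ad hU' hW) hx', ← hρ.ad_apply hU' (hσ.ad hU' hW) hx',
    ad_congr σ (W := ad τ W + ad ρ W) hU' (fun y hy => by
      rw [hτρ.ad_apply hU' hW hy, Pi.add_apply, adAt_add_left, Pi.add_apply,
        hτ.ad_apply hU' hW hy, hρ.ad_apply hU' hW hy]) hx',
    ad_add_right σ hU' (hτ.ad hU' hW) (hρ.ad hU' hW) hx']
  abel

theorem bracket_smul_right {f : M → ℝ} (hU : IsOpen U) (hf : FunSmoothOn E f U)
    (hσ : σ.SmoothOn U) (hτ : τ.SmoothOn U) (hx : x ∈ U) :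
    bracket σ (fun y => f y • τ y) x = f x • bracket σ τ x + dFun E f x (σ x).1 • τ x := by
  refine jet_ext_of_isOpen hU hx fun U' W hU' hx' hsub hW => ?_
  replace hf : FunSmoothOn E f U' := ContMDiffOn.mono hf hsub
  replace hσ := hσ.mono hsub
  replace hτ := hτ.mono hsub
  have hfτ := JSec.SmoothOn.smul hU' hf hτ
  rw [adAt_add_left, adAt_smul_left, adAt_smul_left, adAt_bracket hU' hσ hfτ hW hx',
    adAt_bracket hU' hσ hτ hW hx', hfτ.ad_apply hU' (hσ.ad hU' hW) hx',
    adAt_smul_left, ← hτ.ad_apply hU' (hσ.ad hU' hW) hx', hσ.ad_apply hU' (hfτ.ad hU' hW) hx',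
    adAt_congr (σ x) (W := fun y => f y • ad τ W y) hU' (fun y hy => by
      rw [hfτ.ad_apply hU' hW hy, adAt_smul_left, hτ.ad_apply hU' hW hy]) hx',
    adAt_smul_right (σ x) (hf.mdifferentiableAt hU' hx') ((hτ.ad hU' hW).mdifferentiableAt hU' hx'),
    ← hσ.ad_apply hU' (hτ.ad hU' hW) hx', ← hτ.ad_apply hU' hW hx', smul_sub]
  abel

theorem bracket_eq_zero_right (hU : IsOpen U) (hσ : σ.SmoothOn U) (hτ : ∀ y ∈ U, τ y = 0)
    (hx : x ∈ U) : bracket σ τ x = 0 := by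
  have hτs : τ.SmoothOn U := (JSec.SmoothOn.zero hU).congr hU hτ
  refine jet_ext_of_isOpen hU hx fun U' W hU' hx' hsub hW => ?_
  replace hσ := hσ.mono hsub
  replace hτs := hτs.mono hsub
  have h0 : ∀ {V : VField E M}, V.SmoothOn U' → ∀ y ∈ U', ad τ V y = 0 := fun hV y hy => by
    rw [hτs.ad_apply hU' hV hy, hτ y (hsub hy), adAt_zero_left]
  have h1 : ad σ 0 x = 0 := by
    have := ad_add_right σ hU' (VField.SmoothOn.zero U') (VField.SmoothOn.zero U') hx'
    rwa [add_zero, left_eq_add] at this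
  rw [adAt_bracket hU' hσ hτs hW hx', h0 (hσ.ad hU' hW) x hx',
    ad_congr σ (W := 0) hU' (h0 hW) hx', h1, sub_zero, adAt_zero_left]

theorem bracket_eq_zero_left (hU : IsOpen U) (hσ : ∀ y ∈ U, σ y = 0) (hτ : τ.SmoothOn U)
    (hx : x ∈ U) : bracket σ τ x = 0 := by
  rw [bracket_swap hU ((JSec.SmoothOn.zero hU).congr hU hσ) hτ hx,
    bracket_eq_zero_right hU hτ hσ hx, neg_zero]

theorem bracket_congr_right (hU : IsOpen U) (hσ : σ.SmoothOn U) (hτ : τ.SmoothOn U)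
    (h : ∀ y ∈ U, ρ y = τ y) (hx : x ∈ U) : bracket σ ρ x = bracket σ τ x := by
  have hρ : ρ.SmoothOn U := hτ.congr hU h
  have h1 := bracket_add_right hU hσ hτ (JSec.SmoothOn.sub hU hρ hτ) hx
  rwa [add_sub_cancel, bracket_eq_zero_right (τ := ρ - τ) hU hσ (fun y hy => by
    rw [Pi.sub_apply, h y hy, sub_self]) hx, add_zero] at h1

/-- Under ad each double bracket becomes a double commutator of operators, for which the Jacobi
identity is formal. -/
theorem bracket_bracket (hU : IsOpen U) (hσ : σ.SmoothOn U) (hτ : τ.SmoothOn U)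
    (hρ : ρ.SmoothOn U) (hx : x ∈ U) :
    bracket σ (bracket τ ρ) x = bracket (bracket σ τ) ρ x + bracket τ (bracket σ ρ) x := by
  refine jet_ext_of_isOpen hU hx fun U' W hU' hx' hsub hW => ?_
  replace hσ := hσ.mono hsub
  replace hτ := hτ.mono hsub
  replace hρ := hρ.mono hsub
  have key : ∀ {α β γ : JSec E M}, α.SmoothOn U' → β.SmoothOn U' → γ.SmoothOn U' →
      adAt (bracket α (bracket β γ) x) W = ad α (ad β (ad γ W)) x - ad α (ad γ (ad β W)) x -
        (ad β (ad γ (ad α W)) x - ad γ (ad β (ad α W)) x) := fun hα hβ hγ => by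
    rw [adAt_bracket hU' hα (JSec.SmoothOn.bracket hU' hβ hγ) hW hx',
      ad_bracket hU' hβ hγ (hα.ad hU' hW) hx', ad_congr _ hU' (fun y hy =>
        (ad_bracket hU' hβ hγ hW hy).trans (Pi.sub_apply _ _ _).symm) hx',
      ad_sub_right _ hU' (hβ.ad hU' (hγ.ad hU' hW)) (hγ.ad hU' (hβ.ad hU' hW)) hx']
  have h1 : adAt (bracket (bracket σ τ) ρ x) W = - adAt (bracket ρ (bracket σ τ) x) W := by
    rw [bracket_swap hU' (JSec.SmoothOn.bracket hU' hσ hτ) hρ hx', ← neg_one_smul ℝ,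
      adAt_smul_left, neg_one_smul]
  rw [adAt_add_left, h1, key hσ hτ hρ, key hρ hσ hτ, key hτ hσ hρ]
  abel

theorem bracket_sum_right (hU : IsOpen U) (hσ : σ.SmoothOn U) {ι : Type*} (t : Finset ι)
    {τ : ι → JSec E M} (hτ : ∀ i ∈ t, (τ i).SmoothOn U) (hx : x ∈ U) :
    bracket σ (fun y => ∑ i ∈ t, τ i y) x = ∑ i ∈ t, bracket σ (τ i) x := by
  classical
  induction t using Finset.induction_on with
  | empty => exact bracket_eq_zero_right hU hσ (fun y _ => rfl) hx
  | insert a t ha ih =>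
    have h1 : ∀ i ∈ t, (τ i).SmoothOn U := fun i hi => hτ i (Finset.mem_insert_of_mem hi)
    rw [Finset.sum_insert ha, ← ih h1, ← bracket_add_right hU hσ
      (hτ a (Finset.mem_insert_self a t)) (JSec.SmoothOn.sum hU t h1) hx]
    congr 2
    funext y
    exact Finset.sum_insert ha

theorem bracket_frameMap_right {r : ℕ} {s : Fin r → JSec E M} {f : M → Fin r → ℝ} (hU : IsOpen U)
    (hσ : σ.SmoothOn U) (hs : ∀ i, (s i).SmoothOn U)
    (hf : ∀ i, FunSmoothOn E (fun y => f y i) U) (hx : x ∈ U) :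
    bracket σ (fun y => frameMap s y (f y)) x =
      frameMap s x (fun i => dFun E (fun y => f y i) x (σ x).1) +
        ∑ i, f x i • bracket σ (s i) x := by
  refine (bracket_sum_right hU hσ Finset.univ
    (fun i _ => JSec.SmoothOn.smul hU (hf i) (hs i)) hx).trans ?_
  rw [Fintype.linearCombination_apply, ← Finset.sum_add_distrib]
  refine Finset.sum_congr rfl fun i _ => ?_
  rw [bracket_smul_right hU (hf i) hσ (hs i) hx, add_comm]

/-- The Leibniz rule in the second slot, then in the first by antisymmetry. For a frame with
constant structure functions this is the bracket of an action algebroid. -/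
theorem bracket_frameMap {r : ℕ} {s : Fin r → JSec E M} {f g : M → Fin r → ℝ} (hU : IsOpen U)
    (hs : ∀ i, (s i).SmoothOn U) (hf : ∀ i, FunSmoothOn E (fun y => f y i) U)
    (hg : ∀ i, FunSmoothOn E (fun y => g y i) U) (hx : x ∈ U) :
    bracket (fun y => frameMap s y (f y)) (fun y => frameMap s y (g y)) x =
      frameMap s x (fun i => dFun E (fun y => g y i) x (frameMap s x (f x)).1) -
      frameMap s x (fun i => dFun E (fun y => f y i) x (frameMap s x (g x)).1) +
        ∑ i, ∑ j, (f x i * g x j) • bracket (s i) (s j) x := by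
  have hfs : JSec.SmoothOn (fun y => frameMap s y (f y)) U :=
    JSec.SmoothOn.sum hU _ fun i _ => JSec.SmoothOn.smul hU (hf i) (hs i)
  rw [bracket_frameMap_right hU hfs hs hg hx]
  have h1 : ∀ j, bracket (fun y => frameMap s y (f y)) (s j) x =
      -frameMap s x (fun i => dFun E (fun y => f y i) x (s j x).1) +
        ∑ i, f x i • bracket (s i) (s j) x := fun j => by
    rw [bracket_swap hU hfs (hs j) hx, bracket_frameMap_right hU (hs j) hs hf hx, neg_add,
      ← Finset.sum_neg_distrib]
    congr 1
    refine Finset.sum_congr rfl fun i _ => ?_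
    rw [← smul_neg, ← bracket_swap hU (hs i) (hs j) hx]
  have h2 : (fun i => dFun E (fun y => f y i) x (frameMap s x (g x)).1) =
      ∑ j, g x j • fun i => dFun E (fun y => f y i) x (s j x).1 := by
    funext i
    rw [Fintype.linearCombination_apply, Prod.fst_sum, map_sum, Finset.sum_apply]
    refine Finset.sum_congr rfl fun j _ => ?_
    exact (dFun E (fun y => f y i) x).map_smul _ _
  rw [h2, map_sum, sub_add, sub_eq_add_neg]
  congr 1
  rw [Finset.sum_comm, ← Finset.sum_sub_distrib, ← Finset.sum_neg_distrib]
  refine Finset.sum_congr rfl fun j _ => ?_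
  rw [h1, map_smul, smul_add, Finset.smul_sum, smul_neg, neg_sub, sub_eq_add_neg, add_comm]
  congr 1
  refine Finset.sum_congr rfl fun i _ => ?_
  rw [smul_smul, mul_comm]

end Bracket

/-! ### From a parallel frame to an action algebroid. -/

theorem apply_flatCov {L : Type*} [AddCommGroup L] [Module ℝ L] [FiniteDimensional ℝ L]
    (V : VField E M) {X : M → L} {U : Set M} (hU : IsOpen U) (hX : TrivSmoothOn E X U) {x : M}
    (hx : x ∈ U) (ℓ : L →ₗ[ℝ] ℝ) : ℓ (flatCov V X x) = dFun E (fun y => ℓ (X y)) x (V x) := by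
  let b := Module.finBasis ℝ L
  let F : M → Fin (Module.finrank ℝ L) → ℝ := fun y i => b.repr (X y) i
  have hF : ContMDiffAt 𝓘(ℝ, E) 𝓘(ℝ, Fin (Module.finrank ℝ L) → ℝ) ∞ F x :=
    contMDiffAt_pi_space.2 fun i => ContMDiffOn.contMDiffAt (hX (b.coord i)) (hU.mem_nhds hx)
  have hF' := (hF.mdifferentiableAt (by simp)).hasMFDerivAt
  set F' := mfderiv 𝓘(ℝ, E) 𝓘(ℝ, Fin (Module.finrank ℝ L) → ℝ) F x
  have h1 : ∀ g : (Fin (Module.finrank ℝ L) → ℝ) →L[ℝ] ℝ,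
      dFun E (fun y => g (F y)) x (V x) = g (F' (V x)) := fun g =>
    DFunLike.congr_fun ((g.hasMFDerivAt (x := F x)).comp x hF').mfderiv (V x)
  let g : (Fin (Module.finrank ℝ L) → ℝ) →ₗ[ℝ] ℝ := ℓ ∘ₗ b.equivFun.symm.toLinearMap
  have h2 : (fun y => ℓ (X y)) = fun y => LinearMap.toContinuousLinearMap g (F y) := by
    funext y
    exact congrArg ℓ (b.equivFun.symm_apply_apply (X y)).symm
  rw [h2, h1]
  have h3 : flatCov V X x = b.equivFun.symm (F' (V x)) := by
    refine Eq.trans ?_ (b.equivFun_symm_apply _).symm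
    refine Finset.sum_congr rfl fun i _ => ?_
    exact congrArg (· • b i) (h1 (ContinuousLinearMap.proj i))
  rw [h3]
  rfl

/-- Passing to an abstract L with an equivalence ψ keeps the bracket β separate from structures
already present on `Fin r → ℝ`. -/
theorem exists_lieAlgebra {r : ℕ} (β : (Fin r → ℝ) →ₗ[ℝ] (Fin r → ℝ) →ₗ[ℝ] (Fin r → ℝ))
    (hβ : ∀ ξ, β ξ ξ = 0) (hβ' : ∀ ξ η ζ, β ξ (β η ζ) = β (β ξ η) ζ + β η (β ξ ζ)) :
    ∃ (L : Type) (_ : LieRing L) (_ : LieAlgebra ℝ L) (ψ : L ≃ₗ[ℝ] (Fin r → ℝ)),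
      ∀ ξ η : L, ψ ⁅ξ, η⁆ = β (ψ ξ) (ψ η) := by
  let _ : LieRing (Fin r → ℝ) :=
    { (inferInstance : AddCommGroup (Fin r → ℝ)) with
      bracket := fun ξ η => β ξ η
      add_lie := fun ξ η ζ => by
        show β (ξ + η) ζ = β ξ ζ + β η ζ
        rw [map_add, LinearMap.add_apply]
      lie_add := fun ξ η ζ => map_add (β ξ) η ζ
      lie_self := hβ
      leibniz_lie := hβ' }
  let _ : LieAlgebra ℝ (Fin r → ℝ) :=
    { (inferInstance : Module ℝ (Fin r → ℝ)) with
      lie_smul := fun c ξ η => map_smul (β ξ) c η }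
  exact ⟨Fin r → ℝ, inferInstance, inferInstance, LinearEquiv.refl ℝ _, fun _ _ => rfl⟩

namespace InfinitesimalGStructure.Connection

variable {𝔤 : InfinitesimalGStructure E M} {nabla : 𝔤.Connection} {U : Set M}

/-- Every term on the right of the Cartan identity contains a covariant derivative of σ or τ. -/
theorem IsParallelOn.bracket {σ τ : JSec E M} (hCartan : nabla.IsCartan) [T2Space M]
    (hU : IsOpen U) (hσ : 𝔤.IsSection U σ) (hτ : 𝔤.IsSection U τ)
    (hσp : nabla.IsParallelOn σ U) (hτp : nabla.IsParallelOn τ U) :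
    nabla.IsParallelOn (bracket σ τ) U := by
  intro x hx v
  obtain ⟨V, hV, rfl⟩ := VField.exists_smoothOn_univ x v
  have h := hCartan U σ τ V hU hσ hτ (hV.mono (Set.subset_univ U)) x hx
  rw [bracket_eq_zero_left (σ := nabla.cov V σ) hU (fun y hy => hσp y hy (V y)) hτ.1 hx,
    bracket_eq_zero_right (τ := nabla.cov V τ) hU hσ.1 (fun y hy => hτp y hy (V y)) hx] at h
  have h1 : ∀ W : VField E M, nabla.cov W σ x = 0 := fun W => hσp x hx (W x)
  have h2 : ∀ W : VField E M, nabla.cov W τ x = 0 := fun W => hτp x hx (W x)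
  rw [h1, h2, add_zero, add_zero, sub_zero] at h
  exact h

/-- In a parallel frame ∇ is componentwise differentiation and the structure functions are
constants, so frame components identify 𝔤 with the action algebroid of the Lie algebra they define.
-/
theorem isSymmetricOn_of_parallel_frame [T2Space M] (hCartan : nabla.IsCartan) (hU : IsOpen U)
    {x : M} (hx : x ∈ U)
    (hconst : ∀ f : M → ℝ, FunSmoothOn E f U → (∀ y ∈ U, ∀ v, dFun E f y v = 0) →
      ∀ y ∈ U, f y = f x)
    {r : ℕ} {e : Fin r → JSec E M} (he : ∀ i, 𝔤.IsSection U (e i))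
    (hp : ∀ i, nabla.IsParallelOn (e i) U) (hli : ∀ y ∈ U, LinearIndependent ℝ fun i => e i y)
    (hspan : ∀ y ∈ U, Submodule.span ℝ (Set.range fun i => e i y) = 𝔤.fiber y) :
    nabla.IsSymmetricOn U := by
  have hes : ∀ i, (e i).SmoothOn U := fun i => (he i).1
  have hcovf : ∀ {f : M → Fin r → ℝ}, (∀ i, FunSmoothOn E (fun y => f y i) U) → ∀ y ∈ U, ∀ v,
      nabla.toFun (fun y => frameMap e y (f y)) y v =
        frameMap e y (fun i => dFun E (fun y => f y i) y v) := fun hf y hy v => by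
    rw [toFun_frameMap hU he hf hy, add_eq_left]
    exact Finset.sum_eq_zero fun i _ => by rw [hp i y hy, smul_zero]
  -- The bracket of two frame sections is parallel, so its components have zero differential and
  -- keep their value at x.
  have hC : ∀ i j, ∃ c : Fin r → ℝ, ∀ y ∈ U, bracket (e i) (e j) y = frameMap e y c := by
    intro i j
    obtain ⟨c, hc, hce⟩ := IsSection.exists_eq_frameMap hU he hli hspan
      (IsSection.bracket hU (he i) (he j))
    refine ⟨c x, fun y hy => ?_⟩
    rw [hce y hy]
    congr 1
    funext k
    refine hconst (fun y => c y k) (hc k) (fun z hz v => ?_) y hy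
    have h1 := IsParallelOn.bracket hCartan hU (he i) (he j) (hp i) (hp j) z hz v
    rw [nabla.toFun_congr_apply hU (IsSection.frameMap hU he hc) hce hz v, hcovf hc z hz] at h1
    exact congrFun (frameMap_injective (hli z hz) (h1.trans (map_zero _).symm)) k
  choose C hC using hC
  let β : (Fin r → ℝ) →ₗ[ℝ] (Fin r → ℝ) →ₗ[ℝ] (Fin r → ℝ) :=
    LinearMap.mk₂ ℝ (fun ξ η => ∑ i, ∑ j, (ξ i * η j) • C i j)
      (fun ξ ξ' η => by simp only [Pi.add_apply, add_mul, add_smul, Finset.sum_add_distrib])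
      (fun c ξ η => by simp only [Pi.smul_apply, smul_eq_mul, mul_assoc, mul_smul, Finset.smul_sum])
      (fun ξ η η' => by simp only [Pi.add_apply, mul_add, add_smul, Finset.sum_add_distrib])
      (fun c ξ η => by
        simp only [Pi.smul_apply, smul_eq_mul, mul_left_comm _ c, mul_smul c, Finset.smul_sum])
  have hβ : ∀ ξ η, β ξ η = ∑ i, ∑ j, (ξ i * η j) • C i j := fun ξ η => rfl
  have hconstf : ∀ (ξ : Fin r → ℝ) i, FunSmoothOn E (fun _ : M => ξ i) U :=
    fun ξ i => contMDiffOn_const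
  have hsm : ∀ ξ : Fin r → ℝ, JSec.SmoothOn (fun y => frameMap e y ξ) U := fun ξ =>
    (IsSection.frameMap hU he (hconstf ξ)).1
  have hbr : ∀ {f g : M → Fin r → ℝ}, (∀ i, FunSmoothOn E (fun y => f y i) U) →
      (∀ i, FunSmoothOn E (fun y => g y i) U) → ∀ y ∈ U,
      bracket (fun y => frameMap e y (f y)) (fun y => frameMap e y (g y)) y =
        frameMap e y ((fun i => dFun E (fun y => g y i) y (frameMap e y (f y)).1) -
          (fun i => dFun E (fun y => f y i) y (frameMap e y (g y)).1) + β (f y) (g y)) := by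
    intro f g hf hg y hy
    rw [bracket_frameMap hU hes hf hg hy, map_add, map_sub, hβ, map_sum]
    congr 1
    refine Finset.sum_congr rfl fun i _ => ?_
    rw [map_sum]
    refine Finset.sum_congr rfl fun j _ => ?_
    rw [hC i j y hy, map_smul]
  have hbrc : ∀ ξ η : Fin r → ℝ, ∀ y ∈ U,
      bracket (fun y => frameMap e y ξ) (fun y => frameMap e y η) y = frameMap e y (β ξ η) := by
    intro ξ η y hy
    have h0 : ∀ (ζ : Fin r → ℝ) (v : TangentSpace 𝓘(ℝ, E) y),
        (fun i => dFun E (fun _ : M => ζ i) y v) = 0 := fun ζ v =>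
      funext fun i => DFunLike.congr_fun (mfderiv_const (c := ζ i)) v
    rw [hbr (hconstf ξ) (hconstf η) y hy, h0, h0, sub_zero, zero_add]
  have hinj := frameMap_injective (hli x hx)
  -- Both Lie algebra axioms are read off at the single point x, where the frame is injective: β is
  -- the bracket of sections with constant components.
  obtain ⟨L, _, _, ψ, hψ⟩ := exists_lieAlgebra β
    (fun ξ => self_eq_neg.1 (hinj (by
      rw [map_neg, ← hbrc ξ ξ x hx]
      exact bracket_swap hU (hsm ξ) (hsm ξ) hx)))
    (fun ξ η ζ => hinj (by
      have h := bracket_bracket hU (hsm ξ) (hsm η) (hsm ζ) hx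
      rw [bracket_congr_right hU (hsm ξ) (hsm _) (hbrc η ζ) hx, hbrc ξ _ x hx,
        bracket_congr_right hU (hsm η) (hsm _) (hbrc ξ ζ) hx, hbrc η _ x hx,
        bracket_swap hU (JSec.SmoothOn.bracket hU (hsm ξ) (hsm η)) (hsm ζ) hx,
        bracket_congr_right hU (hsm ζ) (hsm _) (hbrc ξ η) hx,
        ← bracket_swap hU (hsm _) (hsm ζ) hx, hbrc _ ζ x hx] at h
      rw [h, map_add]))
  have : FiniteDimensional ℝ L := ψ.symm.finiteDimensional
  have hX : ∀ {X : M → L}, TrivSmoothOn E X U → ∀ i, FunSmoothOn E (fun y => ψ (X y) i) U :=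
    fun hX i => hX (LinearMap.proj i ∘ₗ ψ.toLinearMap)
  have hflat : ∀ (V : VField E M) {X : M → L}, TrivSmoothOn E X U → ∀ y ∈ U,
      ψ (flatCov V X y) = fun i => dFun E (fun y => ψ (X y) i) y (V y) := fun V X hX y hy =>
    funext fun i => apply_flatCov V hU hX hy (LinearMap.proj i ∘ₗ ψ.toLinearMap)
  -- The Lie algebra acts by the anchors of the sections with constant components; the anchor
  -- respects brackets.
  let a : LieAction E M L U :=
    { toFun := fun y => LinearMap.fst ℝ (TangentSpace 𝓘(ℝ, E) y)
        (TangentSpace 𝓘(ℝ, E) y →L[ℝ] TangentSpace 𝓘(ℝ, E) y) ∘ₗ frameMap e y ∘ₗ ψ.toLinearMap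
      smooth := fun ξ => (hsm (ψ ξ)).1
      map_lie := fun ξ η y hy => by
        have h1 := congrArg Prod.fst (hbrc (ψ ξ) (ψ η) y hy)
        rw [← hψ] at h1
        exact h1.symm.trans (congrFun (anchor_bracket _ _) y) }
  refine ⟨L, _, _, this, a, ⟨
    { toFun := fun y => frameMap e y ∘ₗ ψ.toLinearMap
      injective := fun y hy => (frameMap_injective (hli y hy)).comp ψ.injective
      range_eq := fun y hy => ?_
      smooth := fun X hXs => (IsSection.frameMap hU he (hX hXs)).1
      anchor_eq := fun y hy ξ => rfl
      map_bracket := fun X Y hXs hYs y hy => ?_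
      map_cov := fun V X hV hXs y hy => ?_ }⟩⟩
  · rw [LinearMap.range_comp, LinearEquiv.range, ← LinearMap.range_eq_map, ← hspan y hy]
    exact Fintype.range_linearCombination ℝ _
  · refine Eq.trans ?_ (hbr (hX hXs) (hX hYs) y hy).symm
    refine congrArg (frameMap e y) ?_
    show ψ (flatCov (a.anchor X) Y y - flatCov (a.anchor Y) X y + ⁅X y, Y y⁆) = _
    rw [map_add, map_sub, hψ, hflat _ hYs y hy, hflat _ hXs y hy]
    rfl
  · refine Eq.trans ?_ (hcovf (hX hXs) y hy (V y)).symm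
    exact congrArg (frameMap e y) (hflat V hXs y hy)

theorem IsFlat.isLocallySymmetric [T2Space M] (hflat : nabla.IsFlat) (hCartan : nabla.IsCartan) :
    nabla.IsLocallySymmetric := by
  intro x
  obtain ⟨U, hU, hx, hconst, r, e, he, hp, hli, hspan⟩ := hflat.exists_parallel_frame x
  exact ⟨U, hU, hx, isSymmetricOn_of_parallel_frame hCartan hU hx hconst he hp hli hspan⟩

end InfinitesimalGStructure.Connection

end

end InfGStr

end

theorem theoremB
    {E : Type*} [NormedAddCommGroup E] [NormedSpace ℝ E] [FiniteDimensional ℝ E]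
    {M : Type*} [TopologicalSpace M] [T2Space M] [SecondCountableTopology M]
    [ChartedSpace E M] [IsManifold (modelWithCornersSelf ℝ E) ((⊤ : ℕ∞) : WithTop ℕ∞) M]
    (𝔤 : InfGStr.InfinitesimalGStructure E M) (h𝔤 : 𝔤.IsTransitive)
    (nabla : 𝔤.Connection) (hCartan : nabla.IsCartan) (hbar : nabla.BarEqAd)
    (t : 𝔤.Splitting) (ht : nabla.IsReductiveWith t) :
    nabla.IsLocallySymmetric ↔
      (𝔤.IsKernelInvariant₂ (InfGStr.torsion t.leviCivita) ∧
        InfGStr.IsParallel₂ t.leviCivita (InfGStr.torsion t.leviCivita)) ∧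
      (𝔤.IsKernelInvariant₃ (InfGStr.curvature t.leviCivita) ∧
        InfGStr.IsParallel₃ t.leviCivita (InfGStr.curvature t.leviCivita)) := by
  -- Both sides are restated as invariance under all of 𝔤, the form in which each implication is
  -- proved.
  rw [← t.preservesTorsion_iff, ← t.preservesCurvature_iff]
  exact ⟨fun h => ⟨h.preservesTorsion t hbar ht, h.preservesCurvature t hbar ht⟩, fun h =>
    InfGStr.InfinitesimalGStructure.Connection.IsFlat.isLocallySymmetric
      (fun _ _ _ _ hU hσ hV hW _ hx => nabla.flat_of_preserves t hbar ht h.1 h.2 hU hσ hV hW hx)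
      hCartan⟩
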